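/- Let $\tfrac12<\nu<1$. For $\epsilon>0$ and a configuration $\xi=(\xi_j)_{j\in\mathbb Z^2}$ of points of the open unit disc of $\mathbb R^2$, place a circular obstacle of radius $\epsilon$ at each point $\sqrt\epsilon\,(j+\epsilon^{1-\nu}\xi_j)$, $j\in\mathbb Z^2$. Let $T^t_{\epsilon,\xi}$ be the corresponding Lorentz process on $\mathbb R^2\times S^1$: a point particle moves with unit speed along straight lines and is reflected specularly whenever it hits an obstacle from the outside; it may start inside an obstacle and leaves it without change of velocity. The obstacle range of the site $j$ is the closed disc with centre $\sqrt\epsilon\, j$ and radius $\epsilon^{3/2-\nu}+\epsilon$. For $\bar t>0$ let $\mathcal L(x,v)=\mathcal L_{\epsilon,\xi,\bar t}(x,v)$ be the event that the path starting at $(x,v)$ makes a loop during $[0,\bar t]$, that is, visits some obstacle range, leaves it, and returns to it. (i) There are constants $C$, $c$ and $\epsilon_0>0$, depending only on $\nu$, such that for all $0<\epsilon<\epsilon_0$, all $\bar t\ge\sqrt\epsilon$, all configurations $\xi$ and every lattice cell $B$ (a square of side $\sqrt\epsilon$ centred at a point of $\sqrt\epsilon\,\mathbb Z^2$), the fraction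 of the points $(x,v)\in B\times S^1$ for which $\mathcal L(x,v)$ occurs is at most $$C\,\bar t\,e^{c\bar t}\,\log(\bar t/\sqrt\epsilon)\;\epsilon^{2(1-\nu)} .$$ (ii) Let $f_0$ be a probability density on $\mathbb R^2\times S^1$, $g$ a bounded continuous function on $\mathbb R^2\times S^1$, and $\bar t>0$. Then $$\int_{\mathbb R^2\times S^1} f_0(x,v)\,\bigl|g(T^t_{\epsilon,\xi}(x,v))\bigr|\,\mathbf 1_{\mathcal L(x,v)}\,dx\,dv\;\longrightarrow\;0\qquad(\epsilon\to0),$$ uniformly in the configuration $\xi$ and in $t\in[0,\bar t]$. (iii) In particular, if the $\xi_j$ are random, i.i.d. with a rotationally symmetric probability density $\phi$ supported in the open unit disc, then for $f_0,g,\bar t$ as in (ii) and every $t\in[0,\bar t]$ $$\int_{\mathbb R^2\times S^1} f_0(x,v)\,\mathbb E\bigl[g(T^t_{\epsilon,\xi}(x,v))\,\mathbf 1_{\mathcal L(x,v)}\bigr]\,dx\,dv\;\longrightarrow\;0\qquad(\epsilon\to0).$$ In (ii) and (iii) the integrands are integrable for all sufficiently small $\epsilon$ (in (iii) with respect to the product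 of $dx\,dv$ and the probability measure). -/

import Mathlib

open MeasureTheory ProbabilityTheory Filter Topology
open scoped ENNReal RealInnerProductSpace BoundedContinuousFunction

namespace LorentzGas

noncomputable section

/-- The Euclidean plane. -/
abbrev Plane : Type := EuclideanSpace ℝ (Fin 2)

/-- The unit circle of velocities. -/
abbrev Velocity : Type := Metric.sphere (0 : Plane) 1

/-- The phase space of pairs (position, velocity). -/
abbrev Phase : Type := Plane × Velocity

/-- The measure `dx dv`: Lebesgue measure times arc length. -/
def phaseMeasure : Measure Phase :=
  (volume : Measure Plane).prod (volume : Measure Plane).toSphere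

/-- Specular reflection of a velocity in the line orthogonal to `n`, that is
`v - 2 (v · ω) ω` with `ω = n / ‖n‖`. -/
def reflect (n : Plane) (v : Velocity) : Velocity :=
  ⟨(ℝ ∙ n)ᗮ.reflection (v : Plane), by simp⟩

/-- Free flight during time `s`. -/
def freeFlight (s : ℝ) (z : Phase) : Phase := (z.1 + s • (z.2 : Plane), z.2)

section Dynamics

/- Circular obstacles of radius `r` with centres `c i`. -/
variable {ι : Type*} (c : ι → Plane) (r : ℝ)

/-- The straight ray from `z` reaches the boundary of obstacle `i` from the outside at the strictly
positive time `s`. (Leaving an obstacle from the inside, or touching it tangentially,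
does not change the velocity, hence is not a hit.) -/
def IsHit (z : Phase) (s : ℝ) (i : ι) : Prop :=
  0 < s ∧ ‖z.1 + s • (z.2 : Plane) - c i‖ = r ∧
    ⟪(z.2 : Plane), z.1 + s • (z.2 : Plane) - c i⟫ < 0

/-- The time of the first hit along the straight ray from `z`; it is `⊤` if there is none. -/
def hitTime (z : Phase) : ℝ≥0∞ :=
  ⨅ (s : ℝ) (_ : ∃ i, IsHit c r z s i), ENNReal.ofReal s

open Classical in
/-- The state just after the first hit; `z` itself if there is none. -/
def bounce (z : Phase) : Phase :=
  if h : ∃ i, IsHit c r z (hitTime c r z).toReal i then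
    (z.1 + (hitTime c r z).toReal • (z.2 : Plane),
      reflect (z.1 + (hitTime c r z).toReal • (z.2 : Plane) - c h.choose) z.2)
  else z

/-- The time `t_n` of the `n`-th hit along the trajectory of `z` (`t_0 = 0`, and `t_n = ⊤` if there
are fewer than `n` hits). -/
def collisionTime (n : ℕ) (z : Phase) : ℝ≥0∞ :=
  ∑ k ∈ Finset.range n, hitTime c r ((bounce c r)^[k] z)

open Classical in
/-- The Lorentz flow: with `t_n ≤ t < t_{n+1}`, apply `n` bounces and then fly freely for the
remaining time. (The value `z` is a default for trajectories with infinitely many hits before `t`;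
there are none if the obstacles are at a positive mutual distance.) -/
def flow (t : ℝ) (z : Phase) : Phase :=
  if h : ∃ n, collisionTime c r n z ≤ ENNReal.ofReal t ∧
      ENNReal.ofReal t < collisionTime c r (n + 1) z then
    freeFlight (t - (collisionTime c r (Nat.find h) z).toReal) ((bounce c r)^[Nat.find h] z)
  else z

end Dynamics

section PerturbedLattice

/-- A site of the lattice `ℤ²`. -/
abbrev Site : Type := Fin 2 → ℤ

/-- The lattice point in the plane. -/
def sitePoint (i : Site) : Plane := WithLp.toLp 2 fun k => (i k : ℝ)

/-- The obstacle centres in the macroscopic scale, `√ε (i + ε^(1-ν) ξ_i)`. -/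
def center (ν ε : ℝ) (ξ : Site → Plane) (i : Site) : Plane :=
  √ε • (sitePoint i + ε ^ (1 - ν) • ξ i)

/-- The Lorentz process at time `t`, with obstacles of radius `ε` in the macroscopic scale. -/
def lorentz (ν ε : ℝ) (ξ : Site → Plane) (t : ℝ) (z : Phase) : Phase :=
  flow (center ν ε ξ) ε t z

/-- The obstacle range of site `i` in the macroscopic scale: the disc, centred at the rescaled
lattice point, that contains the obstacle for all possible positions of its centre. -/
def obstacleRange (ν ε : ℝ) (i : Site) : Set Plane :=
  Metric.closedBall (√ε • sitePoint i) (√ε * (ε ^ (1 - ν) + √ε))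

/-- The starting points of those trajectories that, within the time interval `[0, T]`, are in some
obstacle range, leave it, and return to it. -/
def loopSet (ν ε : ℝ) (ξ : Site → Plane) (T : ℝ) : Set Phase :=
  {z | ∃ (i : Site) (s₁ s₂ s₃ : ℝ), 0 ≤ s₁ ∧ s₁ < s₂ ∧ s₂ < s₃ ∧ s₃ ≤ T ∧
    (lorentz ν ε ξ s₁ z).1 ∈ obstacleRange ν ε i ∧
    (lorentz ν ε ξ s₂ z).1 ∉ obstacleRange ν ε i ∧
    (lorentz ν ε ξ s₃ z).1 ∈ obstacleRange ν ε i}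

/-- The lattice cell of site `i` in the macroscopic scale, a square of side `√ε`. -/
def cell (ε : ℝ) (i : Site) : Set Plane :=
  {x | ∀ k, x k ∈ Set.Ico (√ε * ((i k : ℝ) - 1 / 2)) (√ε * ((i k : ℝ) + 1 / 2))}

/-- A displacement of every site within the open unit disc. -/
def IsConfiguration (ξ : Site → Plane) : Prop := ∀ i, ‖ξ i‖ < 1

/-- A rotationally symmetric probability density supported in the open unit disc. -/
structure IsDisplacementDensity (φ : Plane → ℝ) : Prop where
  measurable : Measurable φ
  nonneg : ∀ x, 0 ≤ φ x
  integral_eq_one : ∫ x, φ x = 1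
  eq_zero_of_one_le_norm : ∀ x, 1 ≤ ‖x‖ → φ x = 0
  rotationally_symmetric : ∀ x y, ‖x‖ = ‖y‖ → φ x = φ y

/-- The random displacements `ξ i` are i.i.d. with density `φ`. -/
structure IsDisplacementField {Ω : Type*} [MeasurableSpace Ω] (P : Measure Ω) (φ : Plane → ℝ)
    (ξ : Site → Ω → Plane) : Prop where
  measurable : ∀ i, Measurable (ξ i)
  indep : iIndepFun ξ P
  law : ∀ i, P.map (ξ i) = volume.withDensity fun x => ENNReal.ofReal (φ x)

/-- A probability density on phase space. -/
structure IsPhaseDensity (f : Phase → ℝ) : Prop where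
  nonneg : ∀ z, 0 ≤ f z
  integrable : Integrable f phaseMeasure
  integral_eq_one : ∫ z, f z ∂phaseMeasure = 1

/-- The observable `g` along the trajectory at time `t`, restricted to the event that the trajectory
makes a loop within `[0, T]`. -/
def loopObservable (ν ε : ℝ) (ξ : Site → Plane) (T t : ℝ) (g : Phase → ℝ) : Phase → ℝ :=
  (loopSet ν ε ξ T).indicator fun z => g (lorentz ν ε ξ t z)

end PerturbedLattice

end

end LorentzGas

open LorentzGas

namespace LorentzGas

/-! Write `h = √ε` for the lattice spacing, `r = ε = h²` for the radius of the obstacles, `R` for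
the radius of the obstacle ranges and `θ = R / h`, which is at most `2 ε^(1-ν)`. The estimate holds
for each configuration separately; the only source of smallness is defocusing together with the
geometry of the lattice.

Defocusing. Fix the velocity and an itinerary: the obstacles that are hit, with the side of each
impact. For two parallel rays with the same itinerary, each jump by a lattice vector `u` expands the
difference of directions by a factor of at least `h |u| / (16 r) = |u| / (16 h)`. If both rays
finally reach the range of a site at lattice distance `|q|`, their last directions differ by `O(θ /
|q|)`. So the starting points in a cell with this itinerary lie in a strip of width `O(r θ / |q|)`
times the product of the weights `16 h / |u|` (`contract_follows`, `volume_le_of_itinerary`).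

Summation. The sum of `16 h / |u|` over the jumps possible in time `T` is of order `T`, hence not
small. Each weight is therefore damped by `exp (-κ h |u|)`. A flight of that length takes time at
least `h |u| / 2`, so this costs only a factor `exp (2 κ T)`, and for `κ = 512` the weights of all
itineraries together sum to at most `2` (`tsum_pathWeight_le`). The first obstacle lies in a strip
with `O(T / h)` sites. This accounts for one factor `θ`.

The second factor comes from the earlier visit to the same range. A loop contains a flight that
meets the range of a site `i` and ends at another site, and a later flight that starts at another
site and meets that range again (`exists_flights_of_makesLoop`). Let `w` be the vector from `i` to
the end of the earlier flight. If that flight is the initial one, the velocity is within `O(θ /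
|w|)` of the line of `w`, and averaging over velocities gains this factor
(`lintegral_firstFlightSum_le`). If it is a jump `u`, then `w` lies in a thin tube about the line of
`u` (`inTube_of_flight`). Pairs `u`, `w` that are not collinear are counted with a gain `θ`
(`tsum_tube_le`). Collinear pairs contribute only a cubed logarithm (`tsum_collinear_le`), and `h`
times it is `O(ε^(1-ν))` because `ν > 1/2`. A sum of type `1 / (|w| |w + q|)` gives the logarithm in
the final bound.

For a density on phase space, a small fraction of every cell is a small measure in every ball;
absolute continuity of the integral and smallness of the tail do the rest, uniformly in the
configuration. The random case follows by Fubini, for which the flow must be jointly measurable in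
the starting point and the configuration. -/

/-! ### Plane geometry -/

/-- The oriented area `v ∧ x`. -/
def cross (v x : Plane) : ℝ := v 0 * x 1 - v 1 * x 0

theorem inner_eq (v x : Plane) : ⟪v, x⟫ = v 0 * x 0 + v 1 * x 1 := by
  simp [PiLp.inner_apply, Fin.sum_univ_two, mul_comm]

theorem norm_sq_eq (x : Plane) : ‖x‖ ^ 2 = x 0 ^ 2 + x 1 ^ 2 := by
  rw [EuclideanSpace.norm_sq_eq]; simp [Fin.sum_univ_two]

theorem cross_add (v x y : Plane) : cross v (x + y) = cross v x + cross v y := by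
  simp [cross]; ring

theorem cross_sub (v x y : Plane) : cross v (x - y) = cross v x - cross v y := by
  simp [cross]; ring

theorem cross_sub_left (v w x : Plane) : cross (v - w) x = cross v x - cross w x := by
  simp [cross]; ring

theorem cross_smul (v x : Plane) (t : ℝ) : cross v (t • x) = t * cross v x := by
  simp [cross]; ring

theorem cross_self (v : Plane) : cross v v = 0 := by
  simp [cross]; ring

theorem cross_add_smul_self (v x : Plane) (t : ℝ) : cross v (x + t • v) = cross v x := by
  rw [cross_add, cross_smul, cross_self]; ring

theorem cross_sq_add_inner_sq (v x : Plane) :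
    cross v x ^ 2 + ⟪v, x⟫ ^ 2 = ‖v‖ ^ 2 * ‖x‖ ^ 2 := by
  rw [norm_sq_eq, norm_sq_eq, inner_eq, cross]; ring

theorem abs_cross_le (v x : Plane) : |cross v x| ≤ ‖v‖ * ‖x‖ := by
  apply abs_le_of_sq_le_sq _ (by positivity)
  nlinarith [cross_sq_add_inner_sq v x, sq_nonneg ⟪v, x⟫]

theorem abs_cross_unit_le (v : Velocity) (x : Plane) : |cross v x| ≤ ‖x‖ := by
  have := abs_cross_le v x
  rwa [norm_eq_of_mem_sphere, one_mul] at this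

theorem velocity_sq (v : Velocity) : (v : Plane) 0 ^ 2 + (v : Plane) 1 ^ 2 = 1 := by
  rw [← norm_sq_eq, norm_eq_of_mem_sphere]; norm_num

theorem velocity_inner_self (v : Velocity) : ⟪(v : Plane), v⟫ = 1 := by
  rw [inner_eq]; nlinarith [velocity_sq v]

theorem reflect_coe (n : Plane) (v : Velocity) :
    (reflect n v : Plane) = (v : Plane) - (2 * ⟪(v : Plane), n⟫ / ‖n‖ ^ 2) • n := by
  rw [reflect]
  simp only
  rw [Submodule.reflection_orthogonal_apply, Submodule.reflection_singleton_apply]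
  simp only [neg_sub, real_inner_comm, RCLike.ofReal_real_eq_id, id_eq]
  rw [two_smul, ← add_smul]
  congr 2
  ring

/-- The component of the reflected velocity along the incoming one. -/
theorem inner_reflect {r : ℝ} (hr : 0 < r) (n : Plane) (v : Velocity) (hn : ‖n‖ = r) :
    ⟪(v : Plane), (reflect n v : Plane)⟫ = 2 * (cross v n / r) ^ 2 - 1 := by
  have h1 := cross_sq_add_inner_sq v n
  rw [norm_eq_of_mem_sphere, hn] at h1
  rw [reflect_coe, inner_sub_right, inner_smul_right, velocity_inner_self, hn, div_pow]
  field_simp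
  nlinarith

/-- The transversal component of the reflected velocity. -/
theorem cross_reflect {r : ℝ} (hr : 0 < r) (n : Plane) (v : Velocity) (hn : ‖n‖ = r) :
    cross v (reflect n v) = 2 * (cross v n / r) * -(⟪(v : Plane), n⟫ / r) := by
  rw [reflect_coe, cross_sub, cross_smul, cross_self, hn]
  field_simp
  ring

theorem cross_reflect_normal (n : Plane) (v : Velocity) :
    cross (reflect n v) n = cross v n := by
  rw [reflect_coe, cross_sub_left]
  simp [cross]; ring

theorem inner_reflect_normal {r : ℝ} (hr : 0 < r) (n : Plane) (v : Velocity) (hn : ‖n‖ = r) :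
    ⟪(reflect n v : Plane), n⟫ = -⟪(v : Plane), n⟫ := by
  rw [reflect_coe, inner_sub_left, inner_smul_left, real_inner_self_eq_norm_sq, hn]
  simp; field_simp; ring

/-- With the plane read as `ℂ`, inner product and `cross` are the real and imaginary parts of `v̄
v'`, and `v̄ v' - w̄ w' = v̄ (v' - w') + (v̄ - w̄) w'`. -/
theorem norm_cross_sub_cross_le (v w v' w' : Velocity) :
    ((⟪(v : Plane), (v' : Plane)⟫ - ⟪(w : Plane), (w' : Plane)⟫) ^ 2 +
      (cross v v' - cross w w') ^ 2) ≤
      (‖(v' : Plane) - w'‖ + ‖(v : Plane) - w‖) ^ 2 := by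
  set a := (v' : Plane) - w' with ha
  set b := (v : Plane) - w with hb
  have e1 : ⟪(v : Plane), (v' : Plane)⟫ - ⟪(w : Plane), (w' : Plane)⟫ =
      ⟪(v : Plane), a⟫ + ⟪b, (w' : Plane)⟫ := by
    rw [inner_sub_right, inner_sub_left]; ring
  have e2 : cross v v' - cross w w' = cross v a + cross b w' := by
    rw [cross_sub, cross_sub_left]; ring
  have h1 := cross_sq_add_inner_sq v a
  have h2 := cross_sq_add_inner_sq b w'
  rw [norm_eq_of_mem_sphere] at h1 h2
  have h3 : ⟪(v : Plane), a⟫ * ⟪b, (w' : Plane)⟫ + cross v a * cross b w' ≤ ‖a‖ * ‖b‖ := by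
    apply le_of_sq_le_sq _ (by positivity)
    have : (⟪(v : Plane), a⟫ * ⟪b, (w' : Plane)⟫ + cross v a * cross b w') ^ 2 ≤
      (cross v a ^ 2 + ⟪(v : Plane), a⟫ ^ 2) * (cross b w' ^ 2 + ⟪b, (w' : Plane)⟫ ^ 2) := by
      nlinarith [sq_nonneg (⟪(v : Plane), a⟫ * cross b w' - cross v a * ⟪b, (w' : Plane)⟫)]
    rw [h1, h2] at this
    nlinarith
  rw [e1, e2]
  nlinarith

/-- For unit complex numbers `z = s + ic` and `w = t + id` the right side is `|z² - w²|² = |z - w|²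
|z + w|²`. The sign conditions make the inner product of `z` and `w` nonnegative, so `|z + w|² ≥ 2`.
Here `s`, `c` are sine and cosine of the angle of incidence, and a reflection doubles that angle. -/
theorem sq_sub_le_of_double_angle {s c t d : ℝ} (h1 : s ^ 2 + c ^ 2 = 1) (h2 : t ^ 2 + d ^ 2 = 1)
    (hst : 0 ≤ s * t) (hcd : 0 ≤ c * d) :
    (s - t) ^ 2 ≤ (2 * s ^ 2 - 1 - (2 * t ^ 2 - 1)) ^ 2 + (2 * s * c - 2 * t * d) ^ 2 := by
  have e1 : 2 * s ^ 2 - 1 = s ^ 2 - c ^ 2 := by linarith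
  have e2 : 2 * t ^ 2 - 1 = t ^ 2 - d ^ 2 := by linarith
  have e3 : (s + t) ^ 2 + (c + d) ^ 2 = 2 + 2 * (s * t + c * d) := by linear_combination h1 + h2
  have e4 : (s ^ 2 - c ^ 2 - (t ^ 2 - d ^ 2)) ^ 2 + (2 * s * c - 2 * t * d) ^ 2 =
      ((s - t) ^ 2 + (c - d) ^ 2) * ((s + t) ^ 2 + (c + d) ^ 2) := by ring
  rw [e1, e2, e4, e3]
  have h3 : (s - t) ^ 2 * 1 ≤ ((s - t) ^ 2 + (c - d) ^ 2) * (2 + 2 * (s * t + c * d)) := by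
    apply mul_le_mul <;> first | positivity | nlinarith [sq_nonneg (c - d)]
  linarith

/-- Defocusing: rays that hit the same side of a disc at different places are scattered in
different directions. -/
theorem abs_cross_sub_le_of_reflect {r : ℝ} (hr : 0 < r) {n m : Plane} {v w : Velocity}
    (hn : ‖n‖ = r) (hm : ‖m‖ = r) (hvn : ⟪(v : Plane), n⟫ ≤ 0) (hwm : ⟪(w : Plane), m⟫ ≤ 0)
    (hs : 0 ≤ cross v n * cross w m) :
    |cross v n - cross w m| ≤
      r * (‖(reflect n v : Plane) - reflect m w‖ + ‖(v : Plane) - w‖) := by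
  have key := norm_cross_sub_cross_le v w (reflect n v) (reflect m w)
  rw [inner_reflect hr n v hn, inner_reflect hr m w hm, cross_reflect hr n v hn,
    cross_reflect hr m w hm] at key
  have h1 := cross_sq_add_inner_sq v n
  have h2 := cross_sq_add_inner_sq w m
  rw [norm_eq_of_mem_sphere, hn] at h1
  rw [norm_eq_of_mem_sphere, hm] at h2
  set X := ‖(reflect n v : Plane) - reflect m w‖ + ‖(v : Plane) - w‖ with hX
  have hX0 : 0 ≤ X := by positivity
  set s := cross v n / r with hs'
  set t := cross w m / r with ht'
  set c := -(⟪(v : Plane), n⟫ / r) with hc'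
  set d := -(⟪(w : Plane), m⟫ / r) with hd'
  have es : cross v n = r * s := by rw [hs']; field_simp
  have et : cross w m = r * t := by rw [ht']; field_simp
  have ec : ⟪(v : Plane), n⟫ = -(r * c) := by rw [hc']; field_simp
  have ed : ⟪(w : Plane), m⟫ = -(r * d) := by rw [hd']; field_simp
  have hr2 : 0 < r ^ 2 := by positivity
  have h1' : s ^ 2 + c ^ 2 = 1 := by
    rw [es, ec] at h1
    have : r ^ 2 * (s ^ 2 + c ^ 2 - 1) = 0 := by nlinarith
    rcases mul_eq_zero.mp this with h | h <;> linarith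
  have h2' : t ^ 2 + d ^ 2 = 1 := by
    rw [et, ed] at h2
    have : r ^ 2 * (t ^ 2 + d ^ 2 - 1) = 0 := by nlinarith
    rcases mul_eq_zero.mp this with h | h <;> linarith
  have hc0 : 0 ≤ c := by rw [hc']; have := div_nonpos_of_nonpos_of_nonneg hvn hr.le; linarith
  have hd0 : 0 ≤ d := by rw [hd']; have := div_nonpos_of_nonpos_of_nonneg hwm hr.le; linarith
  -- The common side of impact is essential: rays grazing the disc on opposite sides are both
  -- undeflected.
  have hst : 0 ≤ s * t := by
    rw [hs', ht', div_mul_div_comm]; positivity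
  have hcd : 0 ≤ c * d := mul_nonneg hc0 hd0
  have : (s - t) ^ 2 ≤ X ^ 2 := (sq_sub_le_of_double_angle h1' h2' hst hcd).trans key
  have h3 : |s - t| ≤ X := abs_le_of_sq_le_sq this hX0
  rw [es, et, ← mul_sub, abs_mul, abs_of_pos hr]
  gcongr

/-- Unit vectors in a cone around the direction `d` are separated by their component
orthogonal to `d`. -/
theorem norm_sub_le_of_cross {v w : Velocity} {d : Plane} (hv : 0 < ⟪(v : Plane), d⟫)
    (hw : 0 < ⟪(w : Plane), d⟫) (hv' : |cross v d| ≤ ‖d‖ / 2) (hw' : |cross w d| ≤ ‖d‖ / 2) :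
    ‖d‖ / 2 * ‖(v : Plane) - w‖ ≤ |cross v d - cross w d| := by
  have h1 := cross_sq_add_inner_sq v d
  have h2 := cross_sq_add_inner_sq w d
  have h3 := cross_sq_add_inner_sq ((v : Plane) - w) d
  rw [norm_eq_of_mem_sphere] at h1 h2
  rw [cross_sub_left, inner_sub_left] at h3
  set D := ‖d‖
  have hD : 0 ≤ D := norm_nonneg d
  set a := ⟪(v : Plane), d⟫
  set b := ⟪(w : Plane), d⟫
  set p := cross v d
  set q := cross w d
  have hp : p ^ 2 ≤ (D / 2) ^ 2 := sq_le_sq' (by linarith [(abs_le.mp hv').1]) (abs_le.mp hv').2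
  have hq : q ^ 2 ≤ (D / 2) ^ 2 := sq_le_sq' (by linarith [(abs_le.mp hw').1]) (abs_le.mp hw').2
  have ha : D / 2 ≤ a := by
    apply le_of_sq_le_sq _ hv.le; nlinarith
  have hb : D / 2 ≤ b := by
    apply le_of_sq_le_sq _ hw.le; nlinarith
  -- Since `a² + p² = b² + q² = D²` and `a + b ≥ D ≥ |p + q|`, the components along `d` differ by no
  -- more than those across it.
  have hab : (a - b) * (a + b) = -((p - q) * (p + q)) := by nlinarith
  have hpq : |p + q| ≤ D := (abs_add_le _ _).trans (by linarith)
  have hle : |a - b| ≤ |p - q| := by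
    have hpos : 0 < a + b := by linarith
    have e : |a - b| * (a + b) = |p - q| * |p + q| := by
      rw [← abs_mul, ← abs_neg ((p - q) * (p + q)), ← hab, abs_mul, abs_of_pos hpos]
    have : |a - b| * (a + b) ≤ |p - q| * (a + b) := by
      rw [e]; gcongr; linarith
    exact le_of_mul_le_mul_right this hpos
  have hsq : (a - b) ^ 2 ≤ (p - q) ^ 2 := sq_le_sq.mpr hle
  apply le_of_sq_le_sq _ (abs_nonneg _)
  rw [sq_abs]
  nlinarith [sq_nonneg (p - q)]

/-! ### Itineraries in a perturbed lattice -/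

/-- The size of a lattice vector in the maximum norm. -/
def supNorm (u : Site) : ℕ := max (u 0).natAbs (u 1).natAbs

theorem natAbs_le_supNorm (u : Site) (k : Fin 2) : (u k).natAbs ≤ supNorm u := by
  fin_cases k <;> simp [supNorm]

theorem abs_le_supNorm (u : Site) (k : Fin 2) : |(u k : ℝ)| ≤ supNorm u := by
  have h := natAbs_le_supNorm u k
  rw [← Int.cast_abs, Int.abs_eq_natAbs]
  exact_mod_cast h

theorem supNorm_eq_zero {u : Site} : supNorm u = 0 ↔ u = 0 := by
  constructor
  · intro h
    have h0 := natAbs_le_supNorm u 0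
    have h1 := natAbs_le_supNorm u 1
    ext k; fin_cases k <;> simp <;> omega
  · rintro rfl; simp [supNorm]

theorem supNorm_pos {u : Site} : 0 < supNorm u ↔ u ≠ 0 := by
  rw [Nat.pos_iff_ne_zero, Ne, supNorm_eq_zero]

theorem one_le_supNorm {u : Site} (hu : u ≠ 0) : (1 : ℝ) ≤ supNorm u := by
  exact_mod_cast supNorm_pos.mpr hu

theorem supNorm_le_norm_sitePoint (u : Site) : (supNorm u : ℝ) ≤ ‖sitePoint u‖ := by
  apply le_of_sq_le_sq _ (norm_nonneg _)
  rw [norm_sq_eq]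
  simp only [sitePoint, supNorm]
  rcases max_choice (u 0).natAbs (u 1).natAbs with h | h <;> rw [h]
  · have : (((u 0).natAbs : ℕ) : ℝ) ^ 2 = (u 0 : ℝ) ^ 2 := by
      rw [Nat.cast_natAbs, Int.cast_abs, sq_abs]
    nlinarith [sq_nonneg (u 1 : ℝ)]
  · have : (((u 1).natAbs : ℕ) : ℝ) ^ 2 = (u 1 : ℝ) ^ 2 := by
      rw [Nat.cast_natAbs, Int.cast_abs, sq_abs]
    nlinarith [sq_nonneg (u 0 : ℝ)]

theorem norm_sitePoint_le (u : Site) : ‖sitePoint u‖ ≤ 3 / 2 * supNorm u := by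
  apply le_of_sq_le_sq _ (by positivity)
  rw [norm_sq_eq]
  simp only [sitePoint]
  have h0 := sq_le_sq' (by linarith [(abs_le.mp (abs_le_supNorm u 0)).1])
    (abs_le.mp (abs_le_supNorm u 0)).2
  have h1 := sq_le_sq' (by linarith [(abs_le.mp (abs_le_supNorm u 1)).1])
    (abs_le.mp (abs_le_supNorm u 1)).2
  nlinarith

theorem sitePoint_sub (u w : Site) : sitePoint (u - w) = sitePoint u - sitePoint w := by
  ext k; simp [sitePoint]

/-- Discs of radius `r` with centres `c i`, contained in the discs of radius `R` about the points
of a lattice of a much larger spacing `h`. -/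
structure IsPerturbedLattice (h r R : ℝ) (c : Site → Plane) : Prop where
  r_pos : 0 < r
  small : 100 * R ≤ h
  displacement : ∀ i, ‖c i - h • sitePoint i‖ + r ≤ R

namespace IsPerturbedLattice

variable {h r R : ℝ} {c : Site → Plane} (H : IsPerturbedLattice h r R c)
include H

theorem r_le : r ≤ R := by
  have := H.displacement 0
  linarith [norm_nonneg (c 0 - h • sitePoint 0)]

theorem R_pos : 0 < R := H.r_pos.trans_le H.r_le

theorem h_pos : 0 < h := by linarith [H.R_pos, H.small]

theorem norm_center_sub (i j : Site) :
    ‖(c j - c i) - h • sitePoint (j - i)‖ ≤ 2 * R - 2 * r := by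
  have h1 := H.displacement i
  have h2 := H.displacement j
  have : (c j - c i) - h • sitePoint (j - i) =
      (c j - h • sitePoint j) - (c i - h • sitePoint i) := by
    rw [sitePoint_sub, smul_sub]; abel
  rw [this]
  refine (norm_sub_le _ _).trans ?_
  linarith

theorem norm_smul_sitePoint (u : Site) : h * supNorm u ≤ ‖h • sitePoint u‖ := by
  rw [norm_smul, Real.norm_of_nonneg H.h_pos.le]
  exact mul_le_mul_of_nonneg_left (supNorm_le_norm_sitePoint u) H.h_pos.le

theorem le_mul_supNorm {u : Site} (hu : u ≠ 0) : h ≤ h * supNorm u :=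
  le_mul_of_one_le_right H.h_pos.le (one_le_supNorm hu)

theorem le_norm_center_sub (i j : Site) :
    h * supNorm (j - i) - 2 * R + 2 * r ≤ ‖c j - c i‖ := by
  have h1 := H.norm_center_sub i j
  have h2 := H.norm_smul_sitePoint (j - i)
  have h3 := norm_sub_norm_le (h • sitePoint (j - i)) (c j - c i)
  rw [norm_sub_rev (h • sitePoint (j - i))] at h3
  linarith

end IsPerturbedLattice

/-- The ray from `z` hits obstacle `i` at time `s`, on the side given by the sign `σ`, and `z'` is
the state just after that. -/
def HitStep (c : Site → Plane) (r : ℝ) (z : Phase) (s : ℝ) (i : Site) (σ : Bool) (z' : Phase) :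
    Prop :=
  IsHit c r z s i ∧
    z' = (z.1 + s • (z.2 : Plane), reflect (z.1 + s • (z.2 : Plane) - c i) z.2) ∧
    (σ = true ↔ 0 ≤ cross z.2 (z.1 - c i))

theorem cross_flight_sub (v : Velocity) (x y : Plane) (s : ℝ) :
    cross v (x + s • (v : Plane) - y) = cross v (x - y) := by
  rw [cross_sub, cross_add_smul_self, cross_sub]

namespace HitStep

variable {c : Site → Plane} {r : ℝ} {z z' w w' : Phase} {s t : ℝ} {i : Site} {σ : Bool}

theorem norm_eq (hz : HitStep c r z s i σ z') : ‖z'.1 - c i‖ = r := by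
  rw [hz.2.1]; exact hz.1.2.1

/-- The impact parameter is constant along a ray and is preserved by the reflection, so one number
describes a collision before and after. -/
theorem cross_eq (hz : HitStep c r z s i σ z') :
    cross z'.2 (z'.1 - c i) = cross z.2 (z.1 - c i) := by
  rw [hz.2.1]; simp only
  rw [cross_reflect_normal, cross_flight_sub]

theorem abs_cross_sub_le (hr : 0 < r) (hz : HitStep c r z s i σ z')
    (hw : HitStep c r w t i σ w') :
    |cross z.2 (z.1 - c i) - cross w.2 (w.1 - c i)| ≤
      r * (‖(z'.2 : Plane) - w'.2‖ + ‖(z.2 : Plane) - w.2‖) := by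
  have key := abs_cross_sub_le_of_reflect hr hz.1.2.1 hw.1.2.1 hz.1.2.2.le hw.1.2.2.le (by
    rw [cross_flight_sub, cross_flight_sub]
    by_cases hσ : σ = true
    · exact mul_nonneg (hz.2.2.mp hσ) (hw.2.2.mp hσ)
    · have h1 := mt hz.2.2.mpr hσ
      have h2 := mt hw.2.2.mpr hσ
      exact mul_nonneg_of_nonpos_of_nonpos (by linarith) (by linarith))
  rw [cross_flight_sub, cross_flight_sub] at key
  rw [hz.2.1, hw.2.1]
  exact key

end HitStep

section Flight

variable {c : Site → Plane} {r : ℝ}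

/-- A flight between two discs is the vector between their centres up to the sum of the radii.
Duration, direction and transversal component of the flight are read off from this. -/
theorem norm_add_smul_sub_le {x y p : Plane} {ρ ρ' s : ℝ} (v : Velocity) (hx : ‖x - p‖ ≤ ρ)
    (hy : ‖x + s • (v : Plane) - y‖ ≤ ρ') : ‖s • (v : Plane) - (y - p)‖ ≤ ρ + ρ' := by
  have : s • (v : Plane) - (y - p) = (x + s • (v : Plane) - y) - (x - p) := by abel
  rw [this]
  refine (norm_sub_le _ _).trans ?_
  linarith

theorem norm_smul_velocity (v : Velocity) (s : ℝ) : ‖s • (v : Plane)‖ = |s| := by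
  rw [norm_smul, norm_eq_of_mem_sphere, mul_one, Real.norm_eq_abs]

theorem sub_le_of_flight {x y p : Plane} {ρ ρ' s : ℝ} (v : Velocity) (hs : 0 ≤ s)
    (hx : ‖x - p‖ ≤ ρ) (hy : ‖x + s • (v : Plane) - y‖ ≤ ρ') : ‖y - p‖ - (ρ + ρ') ≤ s := by
  have h1 := norm_add_smul_sub_le v hx hy
  have h2 := norm_sub_norm_le (y - p) (s • (v : Plane))
  rw [norm_smul_velocity, abs_of_nonneg hs, norm_sub_rev (y - p)] at h2
  linarith

theorem inner_pos_of_flight {x y p : Plane} {ρ ρ' s : ℝ} (v : Velocity) (hs : 0 ≤ s)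
    (hx : ‖x - p‖ ≤ ρ) (hy : ‖x + s • (v : Plane) - y‖ ≤ ρ') (hd : 2 * (ρ + ρ') < ‖y - p‖) :
    0 < ⟪(v : Plane), y - p⟫ := by
  have h1 := norm_add_smul_sub_le v hx hy
  have h2 := sub_le_of_flight v hs hx hy
  have h3 : ⟪(v : Plane), y - p⟫ = s - ⟪(v : Plane), s • (v : Plane) - (y - p)⟫ := by
    rw [inner_sub_right (v : Plane) (s • (v : Plane)), inner_smul_right, velocity_inner_self]; ring
  have h4 := abs_real_inner_le_norm (v : Plane) (s • (v : Plane) - (y - p))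
  rw [norm_eq_of_mem_sphere, one_mul] at h4
  have := (abs_le.mp h4).2
  linarith

theorem abs_cross_le_of_flight {x y p : Plane} {ρ ρ' s : ℝ} (v : Velocity)
    (hx : ‖x - p‖ ≤ ρ) (hy : ‖x + s • (v : Plane) - y‖ ≤ ρ') :
    |cross v (y - p)| ≤ ρ + ρ' := by
  have h1 := norm_add_smul_sub_le v hx hy
  have h2 := abs_cross_unit_le v (s • (v : Plane) - (y - p))
  rw [cross_sub, cross_smul, cross_self, mul_zero, zero_sub, abs_neg] at h2
  linarith

end Flight

namespace IsPerturbedLattice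

variable {h r R : ℝ} {c : Site → Plane} (H : IsPerturbedLattice h r R c)
include H

/-- The flight time bounds the length of the jump; this pays for the damping in `jumpWeight`. -/
theorem supNorm_le_of_hit {z : Phase} {s : ℝ} {i j : Site} (hij : j ≠ i) (hz : ‖z.1 - c i‖ = r)
    (hs : IsHit c r z s j) : h * supNorm (j - i) ≤ 2 * s := by
  have h1 := sub_le_of_flight z.2 hs.1.le hz.le hs.2.1.le
  have h2 := H.le_norm_center_sub i j
  have h3 := H.le_mul_supNorm (sub_ne_zero.mpr hij)
  linarith [H.small, H.R_pos]

/-- Two rays from obstacle `i` to obstacle `i + u`: the flight and the next reflection expand. -/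
theorem contract {z w z' w' : Phase} {s t : ℝ} {i u : Site} {σ : Bool} (hu : u ≠ 0)
    (hz : ‖z.1 - c i‖ = r) (hw : ‖w.1 - c i‖ = r)
    (hzw : |cross z.2 (z.1 - c i) - cross w.2 (w.1 - c i)| ≤ 2 * r * ‖(z.2 : Plane) - w.2‖)
    (hz' : HitStep c r z s (i + u) σ z') (hw' : HitStep c r w t (i + u) σ w') :
    |cross z'.2 (z'.1 - c (i + u)) - cross w'.2 (w'.1 - c (i + u))| ≤
        2 * r * ‖(z'.2 : Plane) - w'.2‖ ∧
      ‖(z.2 : Plane) - w.2‖ ≤ 16 * r / (h * supNorm u) * ‖(z'.2 : Plane) - w'.2‖ := by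
  have hr := H.r_pos
  have hexp := HitStep.abs_cross_sub_le hr hz' hw'
  rw [hz'.cross_eq, hw'.cross_eq]
  set x := ‖(z.2 : Plane) - w.2‖ with hx
  set x' := ‖(z'.2 : Plane) - w'.2‖ with hx'
  have hx0 : 0 ≤ x := norm_nonneg _
  have hx0' : 0 ≤ x' := norm_nonneg _
  have hD := H.le_norm_center_sub i (i + u)
  rw [add_sub_cancel_left] at hD
  have hu1 := H.le_mul_supNorm hu
  have hsmall := H.small
  have hrR := H.r_le
  set d := c (i + u) - c i with hd
  set D := ‖d‖ with hDdef
  have hDr : 16 * r ≤ D := by linarith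
  have hDu : h * supNorm u / 2 ≤ D := by linarith
  have cone := norm_sub_le_of_cross
    (inner_pos_of_flight z.2 hz'.1.1.le hz.le hz'.1.2.1.le (by linarith))
    (inner_pos_of_flight w.2 hw'.1.1.le hw.le hw'.1.2.1.le (by linarith))
    ((abs_cross_le_of_flight z.2 hz.le hz'.1.2.1.le).trans (by linarith))
    ((abs_cross_le_of_flight w.2 hw.le hw'.1.2.1.le).trans (by linarith))
  -- The impact parameters of one ray at the two obstacles differ by `cross v d`. A difference of
  -- directions thus reappears as a difference of impact parameters at the second obstacle.
  have e : cross z.2 d - cross w.2 d =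
      (cross z.2 (z.1 - c i) - cross w.2 (w.1 - c i)) -
        (cross z.2 (z.1 - c (i + u)) - cross w.2 (w.1 - c (i + u))) := by
    simp only [hd, cross_sub]; ring
  rw [← hd, e] at cone
  set y := |cross z.2 (z.1 - c (i + u)) - cross w.2 (w.1 - c (i + u))| with hy
  have h1 : D / 2 * x ≤ 2 * r * x + y := by
    refine cone.trans ((abs_sub _ _).trans ?_)
    linarith
  have h2 : D / 4 * x ≤ y := by nlinarith
  have h3 : 4 * r * x ≤ y := by nlinarith
  -- By `h3` the term `r * x` in `hexp` is at most `y / 4` and can be absorbed. This reproduces the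
  -- hypothesis `hzw` at the next obstacle, so the estimate can be iterated.
  have h4 : y ≤ 2 * r * x' := by nlinarith
  refine ⟨h4, ?_⟩
  have hpos : 0 < h * supNorm u := H.h_pos.trans_le hu1
  rw [div_mul_eq_mul_div, le_div_iff₀ hpos]
  nlinarith

end IsPerturbedLattice

/-- The trajectory of `z`, which starts on obstacle `i`, makes the given sequence of jumps from
obstacle to obstacle (with the given signs of the impact parameters) in time `τ`; the state at the
end is `z'`. Other obstacles are ignored. -/
def Follows (c : Site → Plane) (r : ℝ) : Site → Phase → ℝ → List (Site × Bool) → Phase → Prop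
  | _, z, τ, [], z' => τ = 0 ∧ z' = z
  | i, z, τ, a :: l, z' => a.1 ≠ 0 ∧ ∃ s z₁, HitStep c r z s (i + a.1) a.2 z₁ ∧
      Follows c r (i + a.1) z₁ (τ - s) l z'

/-- The total displacement of a sequence of jumps. -/
def totalJump (l : List (Site × Bool)) : Site := (l.map Prod.fst).sum

@[simp] theorem totalJump_nil : totalJump [] = 0 := rfl

@[simp] theorem totalJump_cons (a : Site × Bool) (l : List (Site × Bool)) :
    totalJump (a :: l) = a.1 + totalJump l := by simp [totalJump]

/-- The weight of a jump. It includes a damping that pays for the length of the flight. -/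
noncomputable def jumpWeight (h r κ : ℝ) (u : Site) : ℝ :=
  16 * r / (h * supNorm u) * Real.exp (-(κ * (h * supNorm u)))

theorem jumpWeight_nonneg {h r κ : ℝ} (hh : 0 ≤ h) (hr : 0 ≤ r) (u : Site) :
    0 ≤ jumpWeight h r κ u := by unfold jumpWeight; positivity

/-- The weight of a sequence of jumps. -/
noncomputable def pathWeight (h r κ : ℝ) (l : List (Site × Bool)) : ℝ :=
  (l.map fun a => jumpWeight h r κ a.1).prod

@[simp] theorem pathWeight_nil (h r κ : ℝ) : pathWeight h r κ [] = 1 := rfl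

@[simp] theorem pathWeight_cons (h r κ : ℝ) (a : Site × Bool) (l : List (Site × Bool)) :
    pathWeight h r κ (a :: l) = jumpWeight h r κ a.1 * pathWeight h r κ l := by
  simp [pathWeight]

theorem pathWeight_nonneg {h r κ : ℝ} (hh : 0 ≤ h) (hr : 0 ≤ r) (l : List (Site × Bool)) :
    0 ≤ pathWeight h r κ l := by
  induction l with
  | nil => simp
  | cons a l ih => rw [pathWeight_cons]; exact mul_nonneg (jumpWeight_nonneg hh hr _) ih

theorem follows_norm_eq {c : Site → Plane} {r : ℝ} {i : Site} {z z' : Phase} {τ : ℝ} {l : List (Site × Bool)}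
    (hz : ‖z.1 - c i‖ = r) (hl : Follows c r i z τ l z') :
    ‖z'.1 - c (i + totalJump l)‖ = r := by
  induction l generalizing i z τ with
  | nil => rw [Follows] at hl; rw [hl.2]; simpa using hz
  | cons a l ih =>
    obtain ⟨_, s, z₁, h1, h2⟩ := hl
    rw [totalJump_cons, ← add_assoc]
    exact ih h1.norm_eq h2

theorem follows_time_nonneg {c : Site → Plane} {r : ℝ} {i : Site} {z z' : Phase} {τ : ℝ} {l : List (Site × Bool)}
    (hl : Follows c r i z τ l z') : 0 ≤ τ := by
  induction l generalizing i z τ with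
  | nil => exact hl.1.ge
  | cons a l ih =>
    obtain ⟨_, s, z₁, h1, h2⟩ := hl
    linarith [ih h2, h1.1.1]

namespace IsPerturbedLattice

variable {h r R : ℝ} {c : Site → Plane} (H : IsPerturbedLattice h r R c)
include H

/-- The expansion along an itinerary. -/
theorem contract_follows {κ : ℝ} (hκ : 0 ≤ κ) {i : Site} {z w z' w' : Phase} {τ τ' : ℝ}
    {l : List (Site × Bool)} (hz : ‖z.1 - c i‖ = r) (hw : ‖w.1 - c i‖ = r)
    (hzw : |cross z.2 (z.1 - c i) - cross w.2 (w.1 - c i)| ≤ 2 * r * ‖(z.2 : Plane) - w.2‖)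
    (hz' : Follows c r i z τ l z') (hw' : Follows c r i w τ' l w') :
    ‖(z.2 : Plane) - w.2‖ ≤
      Real.exp (2 * κ * τ) * pathWeight h r κ l * ‖(z'.2 : Plane) - w'.2‖ := by
  induction l generalizing i z w τ τ' with
  | nil =>
    rw [Follows] at hz' hw'
    rw [hz'.1, hz'.2, hw'.2]; simp
  | cons a l ih =>
    obtain ⟨ha, s, z₁, h1, h2⟩ := hz'
    obtain ⟨_, s', w₁, h1', h2'⟩ := hw'
    obtain ⟨c1, c2⟩ := H.contract ha hz hw hzw h1 h1'
    have h3 := ih h1.norm_eq h1'.norm_eq c1 h2 h2'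
    have hs := H.supNorm_le_of_hit (by simpa using ha) hz h1.1
    rw [add_sub_cancel_left] at hs
    have hpos : 0 < h * supNorm a.1 := H.h_pos.trans_le (H.le_mul_supNorm ha)
    have hr := H.r_pos
    refine c2.trans ((mul_le_mul_of_nonneg_left h3 (by positivity)).trans ?_)
    rw [pathWeight_cons, jumpWeight]
    have e : Real.exp (2 * κ * τ) =
        Real.exp (2 * κ * (τ - s)) * Real.exp (2 * κ * s) := by
      rw [← Real.exp_add]; congr 1; ring
    -- The flight time `s` is at least half the length of the jump, so the growth over time `s`
    -- outweighs the damping.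
    have hexp : 1 ≤ Real.exp (2 * κ * s) * Real.exp (-(κ * (h * supNorm a.1))) := by
      rw [← Real.exp_add]
      apply Real.one_le_exp
      nlinarith
    have hP := pathWeight_nonneg (κ := κ) H.h_pos.le hr.le l
    rw [e]
    calc 16 * r / (h * supNorm a.1) *
          (Real.exp (2 * κ * (τ - s)) * pathWeight h r κ l * ‖(z'.2 : Plane) - w'.2‖)
        = (16 * r / (h * supNorm a.1) * (Real.exp (2 * κ * (τ - s)) * pathWeight h r κ l *
            ‖(z'.2 : Plane) - w'.2‖)) * 1 := by ring
      _ ≤ (16 * r / (h * supNorm a.1) * (Real.exp (2 * κ * (τ - s)) * pathWeight h r κ l *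
            ‖(z'.2 : Plane) - w'.2‖)) *
            (Real.exp (2 * κ * s) * Real.exp (-(κ * (h * supNorm a.1)))) := by
          apply mul_le_mul_of_nonneg_left hexp; positivity
      _ = _ := by ring

/-- The last flight ends in a range and not on an obstacle, so nothing is known about a reflection
there. Both rays pass within `2 * R` of the line of centres, whose length is at least half of `h *
supNorm (i - j)`; the cone estimate bounds the difference of directions. -/
theorem norm_sub_le_of_return {z w : Phase} {s t : ℝ} {i j : Site} (hij : i ≠ j)
    (hz : ‖z.1 - c j‖ = r) (hw : ‖w.1 - c j‖ = r) (hs : 0 ≤ s) (ht : 0 ≤ t)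
    (hz' : ‖z.1 + s • (z.2 : Plane) - h • sitePoint i‖ ≤ R)
    (hw' : ‖w.1 + t • (w.2 : Plane) - h • sitePoint i‖ ≤ R) :
    ‖(z.2 : Plane) - w.2‖ ≤ 16 * R / (h * supNorm (i - j)) := by
  have hu := sub_ne_zero.mpr hij
  have hu1 := H.le_mul_supNorm hu
  have hsmall := H.small
  have hrR := H.r_le
  have hr := H.r_pos
  have hdis := H.displacement j
  have h1 := H.norm_smul_sitePoint (i - j)
  set d := h • sitePoint i - c j with hd
  have hD : h * supNorm (i - j) - R ≤ ‖d‖ := by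
    have e : h • sitePoint (i - j) = d + (c j - h • sitePoint j) := by
      rw [hd, sitePoint_sub, smul_sub]; abel
    rw [e] at h1
    linarith [norm_add_le d (c j - h • sitePoint j)]
  have a1 := abs_cross_le_of_flight z.2 hz.le hz'
  have a2 := abs_cross_le_of_flight w.2 hw.le hw'
  have cone := norm_sub_le_of_cross
    (inner_pos_of_flight z.2 hs hz.le hz' (by linarith))
    (inner_pos_of_flight w.2 ht hw.le hw' (by linarith))
    (a1.trans (by linarith)) (a2.trans (by linarith))
  have hpos : 0 < h * supNorm (i - j) := H.h_pos.trans_le hu1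
  have h2 : |cross z.2 d - cross w.2 d| ≤ 4 * R := by
    refine (abs_sub _ _).trans ?_
    linarith
  rw [le_div_iff₀ hpos]
  nlinarith [norm_nonneg ((z.2 : Plane) - w.2)]

/-- Two rays of the same velocity that have the same itinerary and then meet the same obstacle range
are close. -/
theorem abs_cross_sub_le_of_itinerary {κ : ℝ} (hκ : 0 ≤ κ) {x y : Plane} {v : Velocity}
    {s₀ t₀ τ τ' s t : ℝ} {j i : Site} {σ : Bool} {l : List (Site × Bool)} {z₁ w₁ z w : Phase}
    (hij : i ≠ j + totalJump l)
    (hz₁ : HitStep c r (x, v) s₀ j σ z₁) (hw₁ : HitStep c r (y, v) t₀ j σ w₁)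
    (hz : Follows c r j z₁ τ l z) (hw : Follows c r j w₁ τ' l w) (hs : 0 ≤ s) (ht : 0 ≤ t)
    (hz' : ‖z.1 + s • (z.2 : Plane) - h • sitePoint i‖ ≤ R)
    (hw' : ‖w.1 + t • (w.2 : Plane) - h • sitePoint i‖ ≤ R) :
    |cross v (x - y)| ≤ 2 * r * (Real.exp (2 * κ * τ) * pathWeight h r κ l *
      (16 * R / (h * supNorm (i - (j + totalJump l))))) := by
  have hr := H.r_pos
  have h1 := HitStep.abs_cross_sub_le hr hz₁ hw₁
  -- The incoming velocities coincide, so the first collision starts the induction with the constant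
  -- `r`, better than the required `2 * r`.
  simp only [sub_self, norm_zero, add_zero] at h1
  have h2 : |cross z₁.2 (z₁.1 - c j) - cross w₁.2 (w₁.1 - c j)| ≤
      2 * r * ‖(z₁.2 : Plane) - w₁.2‖ := by
    rw [hz₁.cross_eq, hw₁.cross_eq]
    refine h1.trans ?_
    nlinarith [norm_nonneg ((z₁.2 : Plane) - w₁.2)]
  have h3 := H.contract_follows hκ hz₁.norm_eq hw₁.norm_eq h2 hz hw
  have h4 := H.norm_sub_le_of_return hij (follows_norm_eq hz₁.norm_eq hz)
    (follows_norm_eq hw₁.norm_eq hw) hs ht hz' hw'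
  have e : cross v (x - y) = cross v (x - c j) - cross v (y - c j) := by
    simp only [cross_sub]; ring
  have hP := pathWeight_nonneg (κ := κ) H.h_pos.le hr.le l
  have h5 : ‖(z₁.2 : Plane) - w₁.2‖ ≤ Real.exp (2 * κ * τ) * pathWeight h r κ l *
      (16 * R / (h * supNorm (i - (j + totalJump l)))) :=
    h3.trans (mul_le_mul_of_nonneg_left h4 (by positivity))
  rw [e]
  refine h1.trans ?_
  nlinarith [norm_nonneg ((z₁.2 : Plane) - w₁.2)]

end IsPerturbedLattice

/-! ### The trajectories of the Lorentz flow -/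

section Hits

variable {ι : Type*} {c : ι → Plane} {r : ℝ}

/-- The discriminant of the equation for the times when a ray meets a circle. -/
noncomputable def discrim (y : Plane) (r : ℝ) (z : Phase) : ℝ :=
  ⟪(z.2 : Plane), z.1 - y⟫ ^ 2 - (‖z.1 - y‖ ^ 2 - r ^ 2)

/-- The time when a ray enters a disc. -/
noncomputable def entryTime (y : Plane) (r : ℝ) (z : Phase) : ℝ :=
  -⟪(z.2 : Plane), z.1 - y⟫ - √(discrim y r z)

theorem norm_flight_sq (z : Phase) (s : ℝ) (y : Plane) :
    ‖z.1 + s • (z.2 : Plane) - y‖ ^ 2 =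
      ‖z.1 - y‖ ^ 2 + 2 * s * ⟪(z.2 : Plane), z.1 - y⟫ + s ^ 2 := by
  have : z.1 + s • (z.2 : Plane) - y = (z.1 - y) + s • (z.2 : Plane) := by abel
  rw [this, norm_add_sq_real, inner_smul_right, norm_smul_velocity, sq_abs,
    real_inner_comm (z.2 : Plane)]
  ring

theorem inner_flight (z : Phase) (s : ℝ) (y : Plane) :
    ⟪(z.2 : Plane), z.1 + s • (z.2 : Plane) - y⟫ = ⟪(z.2 : Plane), z.1 - y⟫ + s := by
  have : z.1 + s • (z.2 : Plane) - y = (z.1 - y) + s • (z.2 : Plane) := by abel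
  rw [this, inner_add_right, inner_smul_right, velocity_inner_self, mul_one]

/-- The ray meets the circle at the roots of a quadratic. Moving inwards selects the smaller root,
and a strictly positive discriminant excludes tangency. The explicit root is what makes the dynamics
measurable. -/
theorem isHit_iff (hr : 0 < r) {z : Phase} {s : ℝ} {i : ι} :
    IsHit c r z s i ↔ 0 < discrim (c i) r z ∧ 0 < entryTime (c i) r z ∧
      s = entryTime (c i) r z := by
  have hn : ‖z.1 + s • (z.2 : Plane) - c i‖ = r ↔
      ‖z.1 - c i‖ ^ 2 + 2 * s * ⟪(z.2 : Plane), z.1 - c i⟫ + s ^ 2 = r ^ 2 := by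
    rw [← norm_flight_sq]
    exact (pow_left_inj₀ (norm_nonneg _) hr.le two_ne_zero).symm
  rw [IsHit, hn, inner_flight, entryTime]
  set b := ⟪(z.2 : Plane), z.1 - c i⟫ with hb
  have hD : discrim (c i) r z = b ^ 2 - (‖z.1 - c i‖ ^ 2 - r ^ 2) := rfl
  constructor
  · rintro ⟨h1, h2, h3⟩
    have hd : discrim (c i) r z = (-(b + s)) ^ 2 := by rw [hD]; linarith
    have h4 : √(discrim (c i) r z) = -(b + s) := by
      rw [hd]; exact Real.sqrt_sq (by linarith)
    refine ⟨by rw [hd]; apply pow_pos; linarith, by rw [h4]; linarith, by rw [h4]; ring⟩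
  · rintro ⟨h1, h2, rfl⟩
    have h3 := Real.sq_sqrt h1.le
    have h4 := Real.sqrt_pos.mpr h1
    refine ⟨h2, ?_, by linarith⟩
    rw [hD] at *
    nlinarith

open Classical in
-- Each obstacle is hit at most once by a ray, so the infimum over real times becomes one over
-- obstacles, which is countable for the lattice.
theorem hitTime_eq (hr : 0 < r) (z : Phase) :
    hitTime c r z = ⨅ i, if 0 < discrim (c i) r z ∧ 0 < entryTime (c i) r z then
      ENNReal.ofReal (entryTime (c i) r z) else ⊤ := by
  apply le_antisymm
  · refine le_iInf fun i => ?_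
    split_ifs with h
    · exact iInf₂_le (entryTime (c i) r z) ⟨i, (isHit_iff hr).mpr ⟨h.1, h.2, rfl⟩⟩
    · exact le_top
  · refine le_iInf₂ fun s ⟨i, hi⟩ => ?_
    obtain ⟨h1, h2, h3⟩ := (isHit_iff hr).mp hi
    refine (iInf_le _ i).trans ?_
    rw [if_pos ⟨h1, h2⟩, h3]

theorem hitTime_le {z : Phase} {s : ℝ} {i : ι} (h : IsHit c r z s i) :
    hitTime c r z ≤ ENNReal.ofReal s := iInf₂_le s ⟨i, h⟩

theorem collisionTime_zero (z : Phase) : collisionTime c r 0 z = 0 := by simp [collisionTime]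

theorem collisionTime_succ (n : ℕ) (z : Phase) :
    collisionTime c r (n + 1) z =
      collisionTime c r n z + hitTime c r ((bounce c r)^[n] z) := by
  rw [collisionTime, Finset.sum_range_succ, collisionTime]

theorem collisionTime_mono (z : Phase) : Monotone fun n => collisionTime c r n z :=
  monotone_nat_of_le_succ fun n => by rw [collisionTime_succ]; exact le_self_add

theorem flow_eq {n : ℕ} {t : ℝ} {z : Phase} (h1 : collisionTime c r n z ≤ ENNReal.ofReal t)
    (h2 : ENNReal.ofReal t < collisionTime c r (n + 1) z) :
    flow c r t z =
      freeFlight (t - (collisionTime c r n z).toReal) ((bounce c r)^[n] z) := by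
  classical
  have h : ∃ n, collisionTime c r n z ≤ ENNReal.ofReal t ∧
      ENNReal.ofReal t < collisionTime c r (n + 1) z := ⟨n, h1, h2⟩
  have hn : Nat.find h = n := by
    rw [Nat.find_eq_iff]
    refine ⟨⟨h1, h2⟩, fun m hm ⟨_, h4⟩ => ?_⟩
    exact absurd (h4.trans_le (collisionTime_mono z (Nat.succ_le_of_lt hm))) (not_lt.mpr h1)
  rw [flow, dif_pos h]
  simp only [hn]

end Hits

theorem finite_supNorm_le (N : ℕ) : {u : Site | supNorm u ≤ N}.Finite := by
  apply (Set.finite_Icc (fun _ => -(N : ℤ) : Site) (fun _ => (N : ℤ))).subset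
  intro u hu
  have h := fun k => (natAbs_le_supNorm u k).trans hu
  constructor <;> intro k <;> have := h k <;> simp only <;> omega

namespace IsPerturbedLattice

variable {h r R : ℝ} {c : Site → Plane} (H : IsPerturbedLattice h r R c)
include H

/-- Only obstacles in a bounded region are within reach. Finiteness ensures that the infimum in
`hitTime` is attained. -/
theorem finite_hits (z : Phase) (S : ℝ) : {i | ∃ s, s ≤ S ∧ IsHit c r z s i}.Finite := by
  apply (finite_supNorm_le ⌈(S + r + ‖z.1 - c 0‖ + 2 * R) / h⌉₊).subset
  rintro i ⟨s, hs, h1, h2, -⟩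
  have h3 := H.le_norm_center_sub 0 i
  rw [sub_zero] at h3
  have h4 : ‖c i - c 0‖ ≤ s + r + ‖z.1 - c 0‖ := by
    have e : c i - c 0 = s • (z.2 : Plane) - (z.1 + s • (z.2 : Plane) - c i) + (z.1 - c 0) := by
      abel
    rw [e]
    refine (norm_add_le _ _).trans ?_
    have := norm_sub_le (s • (z.2 : Plane)) (z.1 + s • (z.2 : Plane) - c i)
    rw [norm_smul_velocity, abs_of_pos h1, h2] at this
    linarith
  have h5 : (supNorm i : ℝ) ≤ (S + r + ‖z.1 - c 0‖ + 2 * R) / h := by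
    rw [le_div_iff₀ H.h_pos]
    linarith [H.r_pos]
  exact_mod_cast h5.trans (Nat.le_ceil _)

theorem exists_hit {z : Phase} (hz : hitTime c r z ≠ ⊤) :
    ∃ i, IsHit c r z (hitTime c r z).toReal i := by
  obtain ⟨s₀, i₀, h0⟩ : ∃ s i, IsHit c r z s i := by
    by_contra! hcon
    apply hz
    simp only [hitTime, iInf_eq_top]
    rintro s ⟨i, hi⟩
    exact absurd hi (hcon s i)
  have hfin := H.finite_hits z s₀
  obtain ⟨i, ⟨s, hs, hi⟩, hmin⟩ := Set.exists_min_image _ (fun i => entryTime (c i) r z) hfin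
    ⟨i₀, s₀, le_rfl, h0⟩
  have e := ((isHit_iff H.r_pos).mp hi).2.2
  have : hitTime c r z = ENNReal.ofReal s := by
    apply le_antisymm (hitTime_le hi)
    refine le_iInf₂ fun t ⟨k, hk⟩ => ENNReal.ofReal_le_ofReal ?_
    rcases le_total t s₀ with ht | ht
    · have := hmin k ⟨t, ht, hk⟩
      rw [← ((isHit_iff H.r_pos).mp hk).2.2, ← e] at this
      exact this
    · exact hs.trans ht
  refine ⟨i, ?_⟩
  rw [this, ENNReal.toReal_ofReal hi.1.le]
  exact hi

theorem hitTime_pos (z : Phase) : 0 < hitTime c r z := by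
  by_cases hz : hitTime c r z = ⊤
  · rw [hz]; exact ENNReal.zero_lt_top
  · obtain ⟨i, hi⟩ := H.exists_hit hz
    exact (ENNReal.toReal_pos_iff.mp hi.1).1

/-- Distinct obstacles are disjoint, so the choice in the definition of `bounce` is immaterial. -/
theorem eq_of_hit {z : Phase} {s : ℝ} {i j : Site} (hi : IsHit c r z s i)
    (hj : IsHit c r z s j) : i = j := by
  by_contra hij
  have h1 := H.le_norm_center_sub j i
  have h2 := H.le_mul_supNorm (sub_ne_zero.mpr hij)
  have h3 : ‖c i - c j‖ ≤ r + r := by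
    have e : c i - c j = (z.1 + s • (z.2 : Plane) - c j) - (z.1 + s • (z.2 : Plane) - c i) := by
      abel
    rw [e]
    refine (norm_sub_le _ _).trans ?_
    rw [hi.2.1, hj.2.1]
  linarith [H.small, H.R_pos, H.r_le]

theorem bounce_eq {z : Phase} {i : Site} (hi : IsHit c r z (hitTime c r z).toReal i) :
    bounce c r z = (z.1 + (hitTime c r z).toReal • (z.2 : Plane),
      reflect (z.1 + (hitTime c r z).toReal • (z.2 : Plane) - c i) z.2) := by
  have hex : ∃ i, IsHit c r z (hitTime c r z).toReal i := ⟨i, hi⟩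
  rw [bounce, dif_pos hex, H.eq_of_hit hex.choose_spec hi]

theorem hitStep_bounce {z : Phase} (hz : hitTime c r z ≠ ⊤) :
    ∃ i σ, HitStep c r z (hitTime c r z).toReal i σ (bounce c r z) := by
  classical
  obtain ⟨i, hi⟩ := H.exists_hit hz
  exact ⟨i, decide (0 ≤ cross z.2 (z.1 - c i)), hi, H.bounce_eq hi, by simp⟩

/-- After a reflection the velocity points outwards, and its inner product with the position
relative to the centre only grows along the ray. -/
theorem ne_of_hit_of_hitStep {z z' : Phase} {s t : ℝ} {i j : Site} {σ : Bool}
    (hz : HitStep c r z s i σ z') (ht : IsHit c r z' t j) : j ≠ i := by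
  rintro rfl
  have h1 : 0 < ⟪(z'.2 : Plane), z'.1 - c j⟫ := by
    rw [hz.2.1]
    simp only
    rw [inner_reflect_normal H.r_pos _ _ hz.1.2.1]
    linarith [hz.1.2.2]
  have h2 := ht.2.2
  rw [inner_flight] at h2
  linarith [ht.1]

/-- A lower bound for the time between consecutive collisions. -/
theorem le_hitTime_of_hitStep {z z' : Phase} {s : ℝ} {i : Site} {σ : Bool}
    (hz : HitStep c r z s i σ z') : ENNReal.ofReal (h / 2) ≤ hitTime c r z' := by
  refine le_iInf₂ fun t ⟨j, hj⟩ => ENNReal.ofReal_le_ofReal ?_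
  have hne := H.ne_of_hit_of_hitStep hz hj
  have h1 := H.supNorm_le_of_hit hne hz.norm_eq hj
  have h2 := H.le_mul_supNorm (sub_ne_zero.mpr hne)
  linarith

/-- The first collision can come arbitrarily early, which explains the shift of the index; all later
flights last at least `h / 2`. Hence collisions do not accumulate and the default value in `flow`
never occurs. -/
theorem le_collisionTime (z : Phase) (n : ℕ) :
    ENNReal.ofReal (n * (h / 2)) ≤ collisionTime c r (n + 1) z := by
  induction n with
  | zero => simp
  | succ n ih =>
    rw [collisionTime_succ]
    by_cases htop : hitTime c r ((bounce c r)^[n] z) = ⊤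
    · rw [collisionTime_succ n, htop]; simp
    · obtain ⟨i, σ, hi⟩ := H.hitStep_bounce htop
      have := H.le_hitTime_of_hitStep hi
      rw [Function.iterate_succ_apply']
      calc ENNReal.ofReal (((n + 1 : ℕ) : ℝ) * (h / 2))
          = ENNReal.ofReal (n * (h / 2)) + ENNReal.ofReal (h / 2) := by
            rw [← ENNReal.ofReal_add (by have := H.h_pos; positivity) (by linarith [H.h_pos])]
            congr 1; push_cast; ring
        _ ≤ _ := add_le_add ih this

theorem exists_collisionTime_le_lt (z : Phase) (t : ℝ) :
    ∃ n, collisionTime c r n z ≤ ENNReal.ofReal t ∧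
      ENNReal.ofReal t < collisionTime c r (n + 1) z := by
  classical
  have hex : ∃ n, ENNReal.ofReal t < collisionTime c r (n + 1) z := by
    obtain ⟨n, hn⟩ := exists_nat_gt (|t| / (h / 2))
    rw [div_lt_iff₀ (by linarith [H.h_pos])] at hn
    refine ⟨n, lt_of_lt_of_le ?_ (H.le_collisionTime z n)⟩
    exact (ENNReal.ofReal_lt_ofReal_iff_of_nonneg (abs_nonneg t)).mpr hn |>.trans_le'
      (ENNReal.ofReal_le_ofReal (le_abs_self t))
  refine ⟨Nat.find hex, ?_, Nat.find_spec hex⟩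
  rcases hn : Nat.find hex with _ | m
  · rw [collisionTime_zero]; exact zero_le
  · have := Nat.find_min hex (m := m) (by omega)
    exact not_lt.mp this

/-- The position during a flight, including both collisions. -/
theorem flow_position {n : ℕ} {t : ℝ} {z : Phase} (ht : 0 ≤ t)
    (h1 : collisionTime c r n z ≤ ENNReal.ofReal t)
    (h2 : ENNReal.ofReal t ≤ collisionTime c r (n + 1) z) :
    (flow c r t z).1 = ((bounce c r)^[n] z).1 +
      (t - (collisionTime c r n z).toReal) • (((bounce c r)^[n] z).2 : Plane) := by
  rcases h2.lt_or_eq with h2 | h2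
  · rw [flow_eq h1 h2]; rfl
  · have hfin : collisionTime c r (n + 1) z ≠ ⊤ := by rw [← h2]; exact ENNReal.ofReal_ne_top
    have hfin' := hfin
    rw [collisionTime_succ, ENNReal.add_ne_top] at hfin'
    -- At the moment of collision the flow already uses the next flight, of positive length by
    -- `hitTime_pos`; only the velocity has jumped.
    have h3 : ENNReal.ofReal t < collisionTime c r (n + 1 + 1) z := by
      rw [collisionTime_succ (n + 1), h2]
      exact ENNReal.lt_add_right hfin (H.hitTime_pos _).ne'
    obtain ⟨i, σ, hi⟩ := H.hitStep_bounce hfin'.2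
    have h4 : t = (collisionTime c r (n + 1) z).toReal := by
      rw [← h2, ENNReal.toReal_ofReal ht]
    rw [flow_eq h2.ge h3, ← h4, sub_self, freeFlight, zero_smul, add_zero,
      Function.iterate_succ_apply', hi.2.1, h4, collisionTime_succ,
      ENNReal.toReal_add hfin'.1 hfin'.2, add_sub_cancel_left]

/-- Within one flight, both ends included, this is unit speed. Induction on the number of collisions
before `t` joins the flights. -/
theorem norm_flow_sub_le {z : Phase} {s t : ℝ} (hs : 0 ≤ s) (hst : s ≤ t) :
    ‖(flow c r t z).1 - (flow c r s z).1‖ ≤ t - s := by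
  have key : ∀ n, ∀ t, s ≤ t → collisionTime c r n z ≤ ENNReal.ofReal t →
      ENNReal.ofReal t ≤ collisionTime c r (n + 1) z →
      ‖(flow c r t z).1 - (flow c r s z).1‖ ≤ t - s := by
    have same : ∀ n, ∀ s t, 0 ≤ s → s ≤ t → collisionTime c r n z ≤ ENNReal.ofReal s →
        ENNReal.ofReal t ≤ collisionTime c r (n + 1) z →
        ‖(flow c r t z).1 - (flow c r s z).1‖ ≤ t - s := by
      intro n s t hs hst h1 h2
      rw [H.flow_position hs h1 ((ENNReal.ofReal_le_ofReal hst).trans h2),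
        H.flow_position (hs.trans hst) (h1.trans (ENNReal.ofReal_le_ofReal hst)) h2,
        add_sub_add_left_eq_sub, ← sub_smul, norm_smul_velocity, sub_sub_sub_cancel_right,
        abs_of_nonneg (by linarith)]
    intro n
    induction n with
    | zero =>
      intro t hst h1 h2
      exact same 0 s t hs hst (by rw [collisionTime_zero]; exact zero_le) h2
    | succ n ih =>
      intro t hst h1 h2
      rcases le_total (collisionTime c r (n + 1) z) (ENNReal.ofReal s) with h3 | h3
      · exact same (n + 1) s t hs hst h3 h2
      · have hfin : collisionTime c r (n + 1) z ≠ ⊤ :=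
          (h1.trans_lt ENNReal.ofReal_lt_top).ne
        set m := (collisionTime c r (n + 1) z).toReal with hm
        have hm' : ENNReal.ofReal m = collisionTime c r (n + 1) z := ENNReal.ofReal_toReal hfin
        have hsm : s ≤ m := by
          rw [← hm'] at h3
          exact (ENNReal.ofReal_le_ofReal_iff ENNReal.toReal_nonneg).mp h3
        have hmt : m ≤ t := by
          rw [← hm'] at h1
          exact (ENNReal.ofReal_le_ofReal_iff (hs.trans hst)).mp h1
        have a1 := ih m hsm (by rw [hm']; exact collisionTime_mono z n.le_succ) hm'.le
        have a2 := same (n + 1) m t (hs.trans hsm) hmt hm'.ge h2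
        have e : (flow c r t z).1 - (flow c r s z).1 =
          ((flow c r t z).1 - (flow c r m z).1) + ((flow c r m z).1 - (flow c r s z).1) := by abel
        rw [e]
        refine (norm_add_le _ _).trans ?_
        linarith
  obtain ⟨n, h1, h2⟩ := H.exists_collisionTime_le_lt z t
  exact key n t hst h1 h2.le

theorem continuousOn_flow (z : Phase) :
    ContinuousOn (fun t => (flow c r t z).1) (Set.Ici 0) := by
  have : LipschitzOnWith 1 (fun t => (flow c r t z).1) (Set.Ici 0) := by
    apply LipschitzOnWith.of_dist_le_mul
    intro s hs t ht
    rw [NNReal.coe_one, one_mul]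
    rcases le_total s t with hst | hst
    · rw [dist_comm, dist_comm s, dist_eq_norm, Real.dist_eq, abs_of_nonneg (by linarith)]
      exact H.norm_flow_sub_le hs hst
    · rw [dist_eq_norm, Real.dist_eq, abs_of_nonneg (by linarith)]
      exact H.norm_flow_sub_le ht hst
  exact this.continuousOn

end IsPerturbedLattice

/-! ### Measurability of the flow -/

/-- The sets may overlap, because `f` agrees with each `F i` on all of `A i`; no measurable
selection of an obstacle or of an index is needed. -/
theorem measurable_of_cover {α β ι : Type*} [MeasurableSpace α] [MeasurableSpace β] [Countable ι]
    {f g : α → β} {F : ι → α → β} {A : ι → Set α} (hA : ∀ i, MeasurableSet (A i))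
    (hF : ∀ i, Measurable (F i)) (hg : Measurable g) (h1 : ∀ i, ∀ a ∈ A i, f a = F i a)
    (h2 : ∀ a, a ∉ ⋃ i, A i → f a = g a) : Measurable f := by
  intro S hS
  have : f ⁻¹' S = (⋃ i, A i ∩ F i ⁻¹' S) ∪ ((⋃ i, A i)ᶜ ∩ g ⁻¹' S) := by
    ext a
    simp only [Set.mem_preimage, Set.mem_union, Set.mem_inter_iff, Set.mem_compl_iff]
    by_cases ha : a ∈ ⋃ i, A i
    · obtain ⟨i, hi⟩ := Set.mem_iUnion.mp ha
      simp only [ha, not_true_eq_false, false_and, or_false, Set.mem_iUnion, Set.mem_inter_iff,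
        Set.mem_preimage]
      constructor
      · intro h; exact ⟨i, hi, by rwa [← h1 i a hi]⟩
      · rintro ⟨j, hj, h⟩; rwa [h1 j a hj]
    · simp only [ha, not_false_eq_true, true_and, h2 a ha, Set.mem_iUnion, Set.mem_inter_iff]
      constructor
      · exact Or.inr
      · rintro (⟨j, hj, -⟩ | h)
        · exact absurd (Set.mem_iUnion.mpr ⟨j, hj⟩) ha
        · exact h
  rw [this]
  exact (MeasurableSet.iUnion fun i => (hA i).inter (hF i hS)).union
    ((MeasurableSet.iUnion hA).compl.inter (hg hS))

section Measurable

variable {α : Type*} [MeasurableSpace α] {h r R : ℝ} {c : α → Site → Plane} {z : α → Phase}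

theorem measurable_discrim {y : α → Plane} (hy : Measurable y) (hz : Measurable z) :
    Measurable fun a => discrim (y a) r (z a) := by
  unfold discrim
  fun_prop

theorem measurable_entryTime {y : α → Plane} (hy : Measurable y) (hz : Measurable z) :
    Measurable fun a => entryTime (y a) r (z a) := by
  unfold entryTime
  have := measurable_discrim (r := r) hy hz
  fun_prop

theorem measurable_hitTime (hr : 0 < r) (hc : ∀ i, Measurable fun a => c a i)
    (hz : Measurable z) : Measurable fun a => hitTime (c a) r (z a) := by
  classical
  simp only [hitTime_eq hr]
  refine Measurable.iInf fun i => Measurable.ite ?_ ?_ measurable_const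
  · exact (measurableSet_lt measurable_const (measurable_discrim (hc i) hz)).inter
      (measurableSet_lt measurable_const (measurable_entryTime (hc i) hz))
  · exact (measurable_entryTime (hc i) hz).ennreal_ofReal

theorem measurable_reflect {n : α → Plane} {v : α → Velocity} (hn : Measurable n)
    (hv : Measurable v) : Measurable fun a => reflect (n a) (v a) := by
  apply Measurable.subtype_mk (f := fun a => ((reflect (n a) (v a) : Velocity) : Plane))
  simp only [reflect_coe]
  fun_prop

theorem measurableSet_isHit (hr : 0 < r) (i : Site) {s : α → ℝ} (hs : Measurable s)
    (hc : ∀ i, Measurable fun a => c a i) (hz : Measurable z) :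
    MeasurableSet {a | IsHit (c a) r (z a) (s a) i} := by
  simp only [isHit_iff hr]
  exact (measurableSet_lt measurable_const (measurable_discrim (hc i) hz)).inter
    ((measurableSet_lt measurable_const (measurable_entryTime (hc i) hz)).inter
      (measurableSet_eq_fun hs (measurable_entryTime (hc i) hz)))

variable (H : ∀ a, IsPerturbedLattice h r R (c a))
include H

theorem measurable_bounce (hr : 0 < r) (hc : ∀ i, Measurable fun a => c a i)
    (hz : Measurable z) : Measurable fun a => bounce (c a) r (z a) := by
  have ht : Measurable fun a => (hitTime (c a) r (z a)).toReal :=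
    (measurable_hitTime hr hc hz).ennreal_toReal
  refine measurable_of_cover
    (A := fun i => {a | IsHit (c a) r (z a) (hitTime (c a) r (z a)).toReal i})
    (F := fun i a => ((z a).1 + (hitTime (c a) r (z a)).toReal • ((z a).2 : Plane),
      reflect ((z a).1 + (hitTime (c a) r (z a)).toReal • ((z a).2 : Plane) - c a i) (z a).2))
    (fun i => measurableSet_isHit hr i ht hc hz) (fun i => ?_) hz
    (fun i a ha => (H a).bounce_eq ha) (fun a ha => ?_)
  · have h1 : Measurable fun a =>
      (z a).1 + (hitTime (c a) r (z a)).toReal • ((z a).2 : Plane) := by fun_prop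
    exact h1.prodMk (measurable_reflect (h1.sub (hc i)) (by fun_prop))
  · rw [bounce, dif_neg]
    rintro ⟨i, hi⟩
    exact ha (Set.mem_iUnion.mpr ⟨i, hi⟩)

theorem measurable_bounce_iterate (hr : 0 < r) (hc : ∀ i, Measurable fun a => c a i)
    (hz : Measurable z) (n : ℕ) : Measurable fun a => (bounce (c a) r)^[n] (z a) := by
  induction n with
  | zero => exact hz
  | succ n ih =>
    simp only [Function.iterate_succ_apply']
    exact measurable_bounce H hr hc ih

theorem measurable_collisionTime (hr : 0 < r) (hc : ∀ i, Measurable fun a => c a i)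
    (hz : Measurable z) (n : ℕ) : Measurable fun a => collisionTime (c a) r n (z a) := by
  unfold collisionTime
  exact Finset.measurable_fun_sum _ fun k _ =>
    measurable_hitTime hr hc (measurable_bounce_iterate H hr hc hz k)

theorem measurable_flow (hr : 0 < r) (hc : ∀ i, Measurable fun a => c a i)
    (hz : Measurable z) (t : ℝ) : Measurable fun a => flow (c a) r t (z a) := by
  refine measurable_of_cover
    (A := fun n => {a | collisionTime (c a) r n (z a) ≤ ENNReal.ofReal t ∧
      ENNReal.ofReal t < collisionTime (c a) r (n + 1) (z a)})
    (F := fun n a => freeFlight (t - (collisionTime (c a) r n (z a)).toReal)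
      ((bounce (c a) r)^[n] (z a)))
    (fun n => (measurableSet_le (measurable_collisionTime H hr hc hz n) measurable_const).inter
      (measurableSet_lt measurable_const (measurable_collisionTime H hr hc hz (n + 1))))
    (fun n => ?_) hz (fun n a ha => flow_eq ha.1 ha.2) (fun a ha => ?_)
  · have h1 := (measurable_collisionTime H hr hc hz n).ennreal_toReal
    have h2 := measurable_bounce_iterate H hr hc hz n
    unfold freeFlight
    fun_prop
  · obtain ⟨n, hn⟩ := (H a).exists_collisionTime_le_lt (z a) t
    exact absurd (Set.mem_iUnion.mpr ⟨n, hn⟩) ha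

end Measurable

/-- A continuous path meets a closed ball if it comes arbitrarily close at the times of a
dense set. -/
theorem exists_mem_closedBall_iff {f : ℝ → Plane} (hf : ContinuousOn f (Set.Ici 0)) {a b : ℝ}
    (ha : 0 ≤ a) (hab : a < b) (p : Plane) (ρ : ℝ) :
    (∃ s ∈ Set.Icc a b, f s ∈ Metric.closedBall p ρ) ↔
      ∀ m : ℕ, ∃ q : ℚ, (q : ℝ) ∈ Set.Icc a b ∧ dist (f q) p < ρ + 1 / (m + 1) := by
  have hsub : Set.Icc a b ⊆ Set.Ici 0 := fun x hx => ha.trans hx.1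
  have hd : ContinuousOn (fun s => dist (f s) p) (Set.Icc a b) :=
    (continuous_id.dist continuous_const).comp_continuousOn (hf.mono hsub)
  constructor
  · rintro ⟨s, hs, hfs⟩ m
    have hlt : dist (f s) p < ρ + 1 / ((m : ℝ) + 1) :=
      lt_of_le_of_lt hfs (by have : (0 : ℝ) < 1 / ((m : ℝ) + 1) := by positivity
                             linarith)
    have hev : ∀ᶠ x in 𝓝[Set.Icc a b] s, dist (f x) p < ρ + 1 / ((m : ℝ) + 1) :=
      (hd s hs).eventually_lt_const hlt
    obtain ⟨U, hU, hsU, hUs⟩ := mem_nhdsWithin.mp hev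
    -- An endpoint of the interval may be irrational, so it is approached by rationals from the
    -- interior; this needs `a < b`.
    have hcl : s ∈ closure (Set.Ioo a b) := by rw [closure_Ioo hab.ne]; exact hs
    obtain ⟨x, hxU, hx⟩ := mem_closure_iff.mp hcl U hU hsU
    obtain ⟨q, hq, hq2⟩ := Rat.isDenseEmbedding_coe_real.dense.exists_mem_open
      (hU.inter isOpen_Ioo) ⟨x, hxU, hx⟩ |>.imp fun q hq => hq
    exact ⟨q, Set.Ioo_subset_Icc_self hq2, hUs ⟨hq, Set.Ioo_subset_Icc_self hq2⟩⟩
  · intro hm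
    obtain ⟨s, hs, hmin⟩ := isCompact_Icc.exists_isMinOn (Set.nonempty_Icc.mpr hab.le) hd
    refine ⟨s, hs, ?_⟩
    rw [Metric.mem_closedBall]
    refine le_of_forall_pos_lt_add fun δ hδ => ?_
    obtain ⟨m, hm'⟩ := exists_nat_one_div_lt hδ
    obtain ⟨q, hq, hlt⟩ := hm m
    have := hmin hq
    simp only [Set.mem_ofPred_eq] at this
    linarith

/-- The trajectory of `z` meets some disc of radius `R` about a lattice point, leaves it, and
returns. -/
def MakesLoop (c : Site → Plane) (h r R T : ℝ) (z : Phase) : Prop :=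
  ∃ (i : Site) (s₁ s₂ s₃ : ℝ), 0 ≤ s₁ ∧ s₁ < s₂ ∧ s₂ < s₃ ∧ s₃ ≤ T ∧
    (flow c r s₁ z).1 ∈ Metric.closedBall (h • sitePoint i) R ∧
    (flow c r s₂ z).1 ∉ Metric.closedBall (h • sitePoint i) R ∧
    (flow c r s₃ z).1 ∈ Metric.closedBall (h • sitePoint i) R

/-- Being outside a closed disc is an open condition, so the intermediate time can be rational; the
two visits are expressed by rational times through compactness. Only countable quantifiers remain,
whence measurability. -/
theorem IsPerturbedLattice.makesLoop_iff {h r R T : ℝ} {c : Site → Plane}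
    (H : IsPerturbedLattice h r R c) (z : Phase) :
    MakesLoop c h r R T z ↔ ∃ (i : Site) (q : ℚ), (0 < (q : ℝ) ∧ (q : ℝ) < T) ∧
      (flow c r q z).1 ∉ Metric.closedBall (h • sitePoint i) R ∧
      (∀ m : ℕ, ∃ q' : ℚ, (q' : ℝ) ∈ Set.Icc 0 (q : ℝ) ∧
        dist (flow c r q' z).1 (h • sitePoint i) < R + 1 / (m + 1)) ∧
      (∀ m : ℕ, ∃ q' : ℚ, (q' : ℝ) ∈ Set.Icc (q : ℝ) T ∧
        dist (flow c r q' z).1 (h • sitePoint i) < R + 1 / (m + 1)) := by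
  have hcont := H.continuousOn_flow z
  constructor
  · rintro ⟨i, s₁, s₂, s₃, h0, h12, h23, h3, m1, m2, m3⟩
    have hs2 : 0 < s₂ := h0.trans_lt h12
    have hev : ∀ᶠ s in 𝓝 s₂, (flow c r s z).1 ∈ (Metric.closedBall (h • sitePoint i) R)ᶜ :=
      (hcont.continuousAt (Ici_mem_nhds hs2)).eventually_mem
        (Metric.isClosed_closedBall.isOpen_compl.mem_nhds m2)
    obtain ⟨U, hUs, hU, hsU⟩ := mem_nhds_iff.mp hev
    obtain ⟨q, hqU, hq⟩ := Rat.isDenseEmbedding_coe_real.dense.exists_mem_open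
      (hU.inter isOpen_Ioo) ⟨s₂, hsU, h12, h23⟩
    have hq0 : 0 < (q : ℝ) := h0.trans_lt hq.1
    have hqT : (q : ℝ) < T := hq.2.trans_le h3
    refine ⟨i, q, ⟨hq0, hqT⟩, hUs hqU, ?_, ?_⟩
    · exact (exists_mem_closedBall_iff hcont le_rfl hq0 _ _).mp ⟨s₁, ⟨h0, hq.1.le⟩, m1⟩
    · exact (exists_mem_closedBall_iff hcont hq0.le hqT _ _).mp ⟨s₃, ⟨hq.2.le, h3⟩, m3⟩
  · rintro ⟨i, q, ⟨hq0, hqT⟩, m2, m1, m3⟩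
    obtain ⟨s₁, hs₁, m1⟩ := (exists_mem_closedBall_iff hcont le_rfl hq0 _ _).mpr m1
    obtain ⟨s₃, hs₃, m3⟩ := (exists_mem_closedBall_iff hcont hq0.le hqT _ _).mpr m3
    refine ⟨i, s₁, q, s₃, hs₁.1, hs₁.2.lt_of_ne ?_, hs₃.1.lt_of_ne ?_, hs₃.2, m1, m2, m3⟩
    · rintro rfl; exact m2 m1
    · rintro rfl; exact m2 m3

theorem measurableSet_makesLoop {α : Type*} [MeasurableSpace α] {h r R : ℝ}
    {c : α → Site → Plane} {z : α → Phase} (H : ∀ a, IsPerturbedLattice h r R (c a))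
    (hr : 0 < r) (hc : ∀ i, Measurable fun a => c a i) (hz : Measurable z) (T : ℝ) :
    MeasurableSet {a | MakesLoop (c a) h r R T (z a)} := by
  simp only [(H _).makesLoop_iff, Metric.mem_closedBall, not_le]
  have hX : ∀ t, Measurable fun a => (flow (c a) r t (z a)).1 := fun t =>
    (measurable_flow H hr hc hz t).fst
  have hD : ∀ t p, Measurable fun a => dist (flow (c a) r t (z a)).1 p := fun t p =>
    (hX t).dist measurable_const
  simp only [Set.ofPred_exists, Set.ofPred_and, Set.ofPred_forall]
  refine MeasurableSet.iUnion fun i => MeasurableSet.iUnion fun q => ?_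
  refine MeasurableSet.inter (MeasurableSet.inter (.const _) (.const _))
    (MeasurableSet.inter ?_ (MeasurableSet.inter ?_ ?_))
  · exact measurableSet_lt measurable_const (hD q _)
  · exact MeasurableSet.iInter fun m => MeasurableSet.iUnion fun q' =>
      MeasurableSet.inter (.const _) (measurableSet_lt (hD q' _) measurable_const)
  · exact MeasurableSet.iInter fun m => MeasurableSet.iUnion fun q' =>
      MeasurableSet.inter (.const _) (measurableSet_lt (hD q' _) measurable_const)

/-! ### The itinerary of a loop -/

/-- The ray from `z` meets the disc about site `i`, then hits obstacle `j`, makes the jumps `l`, and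
returns to the disc about `i`. -/
def FirstFlightLoop (c : Site → Plane) (h r R T : ℝ) (z : Phase) (i j : Site) (σ : Bool)
    (l : List (Site × Bool)) : Prop :=
  ∃ s₀ s₁ z₁ τ z' s, HitStep c r z s₀ j σ z₁ ∧ 0 ≤ s₁ ∧ s₁ ≤ s₀ ∧
    ‖z.1 + s₁ • (z.2 : Plane) - h • sitePoint i‖ ≤ R ∧ Follows c r j z₁ τ l z' ∧ 0 ≤ s ∧
    ‖z'.1 + s • (z'.2 : Plane) - h • sitePoint i‖ ≤ R ∧ s₀ + τ + s ≤ T ∧ i ≠ j ∧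
    i ≠ j + totalJump l

/-- The trajectory of `z` hits obstacle `j`, makes the jumps `l`, meets the disc about site `i`
during the next jump `a`, makes the jumps `l'`, and returns to the disc about `i`. -/
def LaterLoop (c : Site → Plane) (h r R T : ℝ) (z : Phase) (i j : Site) (σ : Bool)
    (l : List (Site × Bool)) (a : Site × Bool) (l' : List (Site × Bool)) : Prop :=
  ∃ s₀ z₁ τ z₂ s₁ s₂ z₃ τ' z' s, HitStep c r z s₀ j σ z₁ ∧ Follows c r j z₁ τ l z₂ ∧
    HitStep c r z₂ s₂ (j + totalJump l + a.1) a.2 z₃ ∧ a.1 ≠ 0 ∧ 0 ≤ s₁ ∧ s₁ ≤ s₂ ∧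
    ‖z₂.1 + s₁ • (z₂.2 : Plane) - h • sitePoint i‖ ≤ R ∧
    Follows c r (j + totalJump l + a.1) z₃ τ' l' z' ∧ 0 ≤ s ∧
    ‖z'.1 + s • (z'.2 : Plane) - h • sitePoint i‖ ≤ R ∧ s₀ + τ + s₂ + τ' + s ≤ T ∧
    i ≠ j + totalJump l + a.1 ∧ i ≠ j + totalJump l + a.1 + totalJump l'

theorem toReal_collisionTime_succ {ι : Type*} {c : ι → Plane} {r : ℝ} {z : Phase} {n : ℕ}
    (hn : collisionTime c r (n + 1) z ≠ ⊤) :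
    (collisionTime c r (n + 1) z).toReal = (collisionTime c r n z).toReal +
      (hitTime c r ((bounce c r)^[n] z)).toReal := by
  rw [collisionTime_succ] at hn ⊢
  rw [ENNReal.add_ne_top] at hn
  exact ENNReal.toReal_add hn.1 hn.2

namespace IsPerturbedLattice

variable {h r R : ℝ} {c : Site → Plane} (H : IsPerturbedLattice h r R c)
include H

/-- The sites and signs of the successive collisions. -/
theorem exists_itinerary (z : Phase) : ∃ (J : ℕ → Site) (σ : ℕ → Bool), ∀ n,
    collisionTime c r (n + 1) z ≠ ⊤ → HitStep c r ((bounce c r)^[n] z)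
      (hitTime c r ((bounce c r)^[n] z)).toReal (J n) (σ n) ((bounce c r)^[n + 1] z) := by
  have : ∀ n, ∃ (i : Site) (σ : Bool), collisionTime c r (n + 1) z ≠ ⊤ →
      HitStep c r ((bounce c r)^[n] z) (hitTime c r ((bounce c r)^[n] z)).toReal i σ
        ((bounce c r)^[n + 1] z) := by
    intro n
    by_cases hn : collisionTime c r (n + 1) z = ⊤
    · exact ⟨0, true, fun h => absurd hn h⟩
    · have hn' := hn
      rw [collisionTime_succ, ← Ne, ENNReal.add_ne_top] at hn'
      obtain ⟨i, σ, hi⟩ := H.hitStep_bounce hn'.2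
      exact ⟨i, σ, fun _ => by rw [Function.iterate_succ_apply']; exact hi⟩
  choose J σ hJ using this
  exact ⟨J, σ, hJ⟩

/-- The jumps are the differences of the sites of consecutive collisions, nonzero because an
obstacle is never hit twice in a row. -/
theorem exists_follows {z : Phase} {J : ℕ → Site} {σ : ℕ → Bool}
    (hJ : ∀ n, collisionTime c r (n + 1) z ≠ ⊤ → HitStep c r ((bounce c r)^[n] z)
      (hitTime c r ((bounce c r)^[n] z)).toReal (J n) (σ n) ((bounce c r)^[n + 1] z))
    (k a : ℕ) (hk : collisionTime c r (a + 1 + k) z ≠ ⊤) :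
    ∃ l, Follows c r (J a) ((bounce c r)^[a + 1] z)
      ((collisionTime c r (a + 1 + k) z).toReal - (collisionTime c r (a + 1) z).toReal) l
      ((bounce c r)^[a + 1 + k] z) ∧ J a + totalJump l = J (a + k) := by
  induction k generalizing a with
  | zero => exact ⟨[], ⟨by simp, rfl⟩, by simp⟩
  | succ k ih =>
    have hk' : collisionTime c r (a + 1 + 1 + k) z ≠ ⊤ := by
      rwa [show a + 1 + 1 + k = a + 1 + (k + 1) by ring]
    have h2 : collisionTime c r (a + 1 + 1) z ≠ ⊤ :=
      ne_top_of_le_ne_top hk' (collisionTime_mono z (by omega))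
    have h1 : collisionTime c r (a + 1) z ≠ ⊤ :=
      ne_top_of_le_ne_top h2 (collisionTime_mono z (by omega))
    obtain ⟨l, hl, hl'⟩ := ih (a + 1) hk'
    have hstep := hJ (a + 1) h2
    have e : J a + (J (a + 1) - J a) = J (a + 1) := by abel
    refine ⟨(J (a + 1) - J a, σ (a + 1)) :: l,
      ⟨?_, (hitTime c r ((bounce c r)^[a + 1] z)).toReal, (bounce c r)^[a + 1 + 1] z, ?_, ?_⟩, ?_⟩
    · exact sub_ne_zero.mpr (H.ne_of_hit_of_hitStep (hJ a h1) hstep.1)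
    · simp only [e]; exact hstep
    · simp only [e]
      rw [show a + 1 + (k + 1) = a + 1 + 1 + k by ring, sub_sub,
        ← toReal_collisionTime_succ h2]
      exact hl
    · rw [totalJump_cons, ← add_assoc, e, hl']
      congr 1; ring

/-- A flight is a straight segment, so a disc cannot be left and entered again during the same
flight. -/
theorem flow_mem_of_between {z : Phase} {n : ℕ} {s t u : ℝ} {S : Set Plane} (hS : Convex ℝ S)
    (hs : 0 ≤ s) (hst : s ≤ t) (htu : t ≤ u) (h1 : collisionTime c r n z ≤ ENNReal.ofReal s)
    (h2 : ENNReal.ofReal u ≤ collisionTime c r (n + 1) z)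
    (hsS : (flow c r s z).1 ∈ S) (huS : (flow c r u z).1 ∈ S) : (flow c r t z).1 ∈ S := by
  have hst' := ENNReal.ofReal_le_ofReal hst
  have htu' := ENNReal.ofReal_le_ofReal htu
  rw [H.flow_position hs h1 (hst'.trans (htu'.trans h2))] at hsS
  rw [H.flow_position (hs.trans (hst.trans htu)) (h1.trans (hst'.trans htu')) h2] at huS
  rw [H.flow_position (hs.trans hst) (h1.trans hst') (htu'.trans h2)]
  rcases (hst.trans htu).eq_or_lt with h | h
  · have : t = s := by linarith
    rw [this]; exact hsS
  · have hus : 0 < u - s := by linarith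
    have hab : (u - t) / (u - s) + (t - s) / (u - s) = 1 := by field_simp; ring
    convert hS hsS huS (div_nonneg (by linarith) hus.le) (div_nonneg (by linarith) hus.le) hab
      using 1
    set p := ((bounce c r)^[n] z).1
    set v : Plane := (((bounce c r)^[n] z).2 : Plane)
    set m := (collisionTime c r n z).toReal
    have e : t - m = (u - t) / (u - s) * (s - m) + (t - s) / (u - s) * (u - m) := by
      field_simp; ring
    rw [smul_add, smul_add, smul_smul, smul_smul, e, add_smul]
    have : p = ((u - t) / (u - s)) • p + ((t - s) / (u - s)) • p := by
      rw [← add_smul, hab, one_smul]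
    nth_rewrite 1 [this]
    abel

/-- A trajectory that makes a loop meets the disc about some site during a flight that ends at
another site, and again during a later flight that starts at another site. -/
theorem exists_flights_of_makesLoop {T : ℝ} {z : Phase} (hz : MakesLoop c h r R T z)
    {J : ℕ → Site} {σ : ℕ → Bool}
    (hJ : ∀ n, collisionTime c r (n + 1) z ≠ ⊤ → HitStep c r ((bounce c r)^[n] z)
      (hitTime c r ((bounce c r)^[n] z)).toReal (J n) (σ n) ((bounce c r)^[n + 1] z)) :
    ∃ (i : Site) (a n : ℕ) (s t : ℝ), a ≤ n ∧ 0 ≤ s ∧ s ≤ t ∧ t ≤ T ∧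
      collisionTime c r a z ≤ ENNReal.ofReal s ∧
      ENNReal.ofReal s ≤ collisionTime c r (a + 1) z ∧
      collisionTime c r (n + 1) z ≤ ENNReal.ofReal t ∧
      ENNReal.ofReal t ≤ collisionTime c r (n + 1 + 1) z ∧
      (flow c r s z).1 ∈ Metric.closedBall (h • sitePoint i) R ∧
      (flow c r t z).1 ∈ Metric.closedBall (h • sitePoint i) R ∧
      i ≠ J a ∧ i ≠ J n := by
  classical
  obtain ⟨i, s₁, s₂, s₃, h0, h12, h23, h3, m1, m2, m3⟩ := hz
  set B := Metric.closedBall (h • sitePoint i) R with hB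
  have hBc : Convex ℝ B := convex_closedBall _ _
  set C : ℕ → ℝ≥0∞ := fun n => collisionTime c r n z with hC
  have hmono : Monotone C := collisionTime_mono z
  obtain ⟨n₁, a1, b1⟩ := H.exists_collisionTime_le_lt z s₁
  obtain ⟨n₂, a2, b2⟩ := H.exists_collisionTime_le_lt z s₂
  obtain ⟨n₃, a3, b3⟩ := H.exists_collisionTime_le_lt z s₃
  have index_le : ∀ {m n : ℕ} {s t : ℝ}, s ≤ t → C m ≤ ENNReal.ofReal s →
      ENNReal.ofReal t < C (n + 1) → m ≤ n := by
    intro m n s t hst hm hn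
    by_contra hlt
    exact absurd ((hmono (by omega : n + 1 ≤ m)).trans (hm.trans (ENNReal.ofReal_le_ofReal hst)))
      (not_le.mpr hn)
  have h12' : n₁ ≤ n₂ := index_le h12.le a1 b2
  have h23' : n₂ ≤ n₃ := index_le h23.le a2 b3
  -- the last flight before `s₂` and the first after `s₂` that meet the disc
  let P : ℕ → Prop := fun k => ∃ s, 0 ≤ s ∧ s ≤ s₂ ∧ C k ≤ ENNReal.ofReal s ∧
    ENNReal.ofReal s ≤ C (k + 1) ∧ (flow c r s z).1 ∈ B
  let Q : ℕ → Prop := fun k => n₂ ≤ k ∧ ∃ t, s₂ ≤ t ∧ t ≤ s₃ ∧ C k ≤ ENNReal.ofReal t ∧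
    ENNReal.ofReal t ≤ C (k + 1) ∧ (flow c r t z).1 ∈ B
  have hP : P n₁ := ⟨s₁, h0, h12.le, a1, b1.le, m1⟩
  have hQ : ∃ k, Q k := ⟨n₃, h23', s₃, h23.le, le_rfl, a3, b3.le, m3⟩
  set a := Nat.findGreatest P n₂ with ha
  obtain ⟨s, hs0, hs2, hsa, hsa', hsB⟩ : P a := Nat.findGreatest_spec h12' hP
  have hamax : ∀ k, a < k → k ≤ n₂ → ¬ P k := fun k => Nat.findGreatest_is_greatest
  have han : a ≤ n₂ := Nat.findGreatest_le _
  set n := Nat.find hQ with hn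
  obtain ⟨hn2, t, ht2, ht3, htn, htn', htB⟩ : Q n := Nat.find_spec hQ
  have hnmin : ∀ k, k < n → ¬ Q k := fun k => Nat.find_min hQ
  have hs2' : 0 ≤ s₂ := h0.trans h12.le
  have han' : a < n := by
    -- If the two flights coincided, convexity would put the position at time `s₂` into the disc.
    rcases (han.trans hn2).lt_or_eq with hlt | heq
    · exact hlt
    · exfalso
      rw [← heq] at htn'
      exact m2 (H.flow_mem_of_between hBc hs0 hs2 ht2 hsa htn' hsB htB)
  -- collision points with the obstacle of site `i` are in the disc
  have hit : ∀ k, k < n → J k = i →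
      (flow c r (C (k + 1)).toReal z).1 ∈ B ∧ ENNReal.ofReal (C (k + 1)).toReal = C (k + 1) := by
    intro k hk hki
    have hfin : C (k + 1) ≠ ⊤ :=
      ne_top_of_le_ne_top ENNReal.ofReal_ne_top ((hmono (by omega : k + 1 ≤ n)).trans htn)
    have e : ENNReal.ofReal (C (k + 1)).toReal = C (k + 1) := ENNReal.ofReal_toReal hfin
    refine ⟨?_, e⟩
    rw [H.flow_position (n := k + 1) ENNReal.toReal_nonneg e.ge
      (e.le.trans (hmono (Nat.le_succ _))), sub_self, zero_smul, add_zero, hB,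
      Metric.mem_closedBall, dist_eq_norm]
    have h1 := (hJ k hfin).norm_eq
    rw [hki] at h1
    have h2 := H.displacement i
    have e2 : ((bounce c r)^[k + 1] z).1 - h • sitePoint i =
      (((bounce c r)^[k + 1] z).1 - c i) + (c i - h • sitePoint i) := by abel
    rw [e2]
    refine (norm_add_le _ _).trans ?_
    linarith
  have hJa : i ≠ J a := by
    intro hi
    obtain ⟨hmem, e⟩ := hit a han' hi.symm
    -- If flight `a` ended at site `i`, its end point would be in the disc. Either this is before
    -- `s₂`, and flight `a + 1` contradicts the maximality of `a`; or flight `a = n₂` meets the disc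
    -- after `s₂`, contradicting the minimality of `n`.
    rcases han.lt_or_eq with hlt | heq
    · refine hamax (a + 1) (by omega) (by omega) ⟨_, ENNReal.toReal_nonneg, ?_, e.ge,
        e.le.trans (hmono (Nat.le_succ _)), hmem⟩
      apply (ENNReal.ofReal_le_ofReal_iff hs2').mp
      rw [e]
      exact (hmono (by omega : a + 1 ≤ n₂)).trans a2
    · refine hnmin n₂ (heq ▸ han') ⟨le_rfl, _, ?_, ?_, ?_, ?_, hmem⟩
      · apply (ENNReal.ofReal_le_ofReal_iff ENNReal.toReal_nonneg).mp
        rw [e, heq]; exact b2.le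
      · refine le_trans ?_ ht3
        apply (ENNReal.ofReal_le_ofReal_iff (hs2'.trans ht2)).mp
        rw [e]
        exact (hmono (by omega : a + 1 ≤ n)).trans htn
      · rw [e, heq]; exact hmono (Nat.le_succ _)
      · rw [e, heq]
  obtain ⟨n', hn'⟩ : ∃ n', n = n' + 1 := ⟨n - 1, by omega⟩
  have hJn : i ≠ J n' := by
    intro hi
    obtain ⟨hmem, e⟩ := hit n' (by omega) hi.symm
    rw [← hn'] at hmem e
    -- If flight `n` started at site `i`, either flight `n'` already meets the disc after `s₂`,
    -- against minimality, or flight `n = n₂` is in the disc both before and after `s₂`, against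
    -- convexity.
    rcases hn2.lt_or_eq with hlt | heq
    · refine hnmin n' (by omega) ⟨by omega, _, ?_, ?_, ?_, ?_, hmem⟩
      · apply (ENNReal.ofReal_le_ofReal_iff ENNReal.toReal_nonneg).mp
        rw [e]
        exact b2.le.trans (hmono (by omega))
      · refine le_trans ?_ ht3
        apply (ENNReal.ofReal_le_ofReal_iff (hs2'.trans ht2)).mp
        rw [e]; exact htn
      · rw [e]; exact hmono (by omega)
      · rw [e, hn']
    · refine m2 (H.flow_mem_of_between (n := n) hBc ENNReal.toReal_nonneg ?_ ht2 e.ge htn'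
        hmem htB)
      apply (ENNReal.ofReal_le_ofReal_iff hs2').mp
      rw [e, ← heq]; exact a2
  rw [hn'] at htn htn' han'
  exact ⟨i, a, n', s, t, by omega, hs0, hs2.trans ht2, ht3.trans h3, hsa, hsa', htn, htn', hsB,
    htB, hJa, hJn⟩

theorem norm_sub_center_le {i j : Site} (hij : i ≠ j) {x y : Plane}
    (hx : ‖x - h • sitePoint i‖ ≤ R) (hy : ‖y - c j‖ ≤ r) : h - 2 * R ≤ ‖x - y‖ := by
  have h1 := H.norm_smul_sitePoint (i - j)
  have h2 := H.le_mul_supNorm (sub_ne_zero.mpr hij)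
  have h3 := H.displacement j
  have e : h • sitePoint (i - j) =
      (x - y) + (y - c j) + (c j - h • sitePoint j) - (x - h • sitePoint i) := by
    rw [sitePoint_sub, smul_sub]; abel
  rw [e] at h1
  have a1 := norm_sub_le ((x - y) + (y - c j) + (c j - h • sitePoint j)) (x - h • sitePoint i)
  have a2 := norm_add_le ((x - y) + (y - c j)) (c j - h • sitePoint j)
  have a3 := norm_add_le (x - y) (y - c j)
  linarith

/-- The itinerary of a loop. Loops take some time. -/
theorem exists_loop_of_makesLoop {T : ℝ} {z : Phase} (hz : MakesLoop c h r R T z) :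
    3 / 2 * h ≤ T ∧ ((∃ i j σ l, FirstFlightLoop c h r R T z i j σ l) ∨
      ∃ i j σ l a l', LaterLoop c h r R T z i j σ l a l') := by
  obtain ⟨J, σ, hJ⟩ := H.exists_itinerary z
  obtain ⟨i, a, n, s, t, han, hs0, hst, htT, hsa, hsa', htn, htn', hsB, htB, hia, hin⟩ :=
    H.exists_flights_of_makesLoop hz hJ
  have hfin : ∀ k, k ≤ n + 1 → collisionTime c r k z ≠ ⊤ := fun k hk =>
    ne_top_of_le_ne_top ENNReal.ofReal_ne_top ((collisionTime_mono z hk).trans htn)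
  have hmono : ∀ {k m}, k ≤ m → m ≤ n + 1 →
      (collisionTime c r k z).toReal ≤ (collisionTime c r m z).toReal := fun hkm hm =>
    ENNReal.toReal_mono (hfin _ hm) (collisionTime_mono z hkm)
  have ht0 : 0 ≤ t := hs0.trans hst
  have htn1 : (collisionTime c r (n + 1) z).toReal ≤ t := ENNReal.toReal_le_of_le_ofReal ht0 htn
  have hsa1 : (collisionTime c r a z).toReal ≤ s := ENNReal.toReal_le_of_le_ofReal hs0 hsa
  have hsa2 : s ≤ (collisionTime c r (a + 1) z).toReal :=
    (ENNReal.ofReal_le_iff_le_toReal (hfin _ (by omega))).mp hsa'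
  have hstepa := hJ a (hfin _ (by omega))
  have hstepn := hJ n (hfin _ le_rfl)
  have hta := toReal_collisionTime_succ (hfin (a + 1) (by omega))
  rw [Metric.mem_closedBall, dist_eq_norm] at hsB htB
  have hpos : ∀ k, k ≤ n + 1 →
      (flow c r (collisionTime c r k z).toReal z).1 = ((bounce c r)^[k] z).1 := by
    intro k hk
    have e := ENNReal.ofReal_toReal (hfin k hk)
    rw [H.flow_position ENNReal.toReal_nonneg e.ge
      (e.le.trans (collisionTime_mono z (Nat.le_succ _))), sub_self, zero_smul, add_zero]
  refine ⟨?_, ?_⟩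
  -- The loop contains a passage from the disc to obstacle `J a` and one from obstacle `J n` back,
  -- each of length at least `h - 2 * R`.
  · have h1 := H.norm_flow_sub_le (z := z) hs0 hsa2
    have h2 := H.norm_flow_sub_le (z := z) ENNReal.toReal_nonneg htn1
    rw [hpos _ (by omega), norm_sub_rev] at h1
    rw [hpos _ le_rfl] at h2
    have h3 := H.norm_sub_center_le hia hsB hstepa.norm_eq.le
    have h4 := H.norm_sub_center_le hin htB hstepn.norm_eq.le
    have h5 := hmono (show a + 1 ≤ n + 1 by omega) le_rfl
    linarith [H.small, H.R_pos]
  rw [H.flow_position hs0 hsa hsa'] at hsB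
  rw [H.flow_position ht0 htn htn'] at htB
  have h01 : (collisionTime c r (0 + 1) z).toReal =
      (hitTime c r ((bounce c r)^[0] z)).toReal := by
    rw [toReal_collisionTime_succ (hfin _ (by omega)), collisionTime_zero]; simp
  -- For `a = 0` the first visit takes place before any collision.
  rcases a with _ | a
  · left
    obtain ⟨l, hl, hl'⟩ := H.exists_follows hJ n 0 (hfin _ (by omega))
    rw [show 0 + 1 + n = n + 1 by ring] at hl
    rw [zero_add n] at hl'
    rw [collisionTime_zero, ENNReal.toReal_zero] at hsB hta hsa1
    refine ⟨i, J 0, σ 0, l, _, s - 0, _, _, _, _, hstepa, by linarith, by linarith, hsB, hl,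
      sub_nonneg.mpr htn1, htB, ?_, hia, by rwa [hl']⟩
    linarith
  · right
    obtain ⟨l, hl, hl'⟩ := H.exists_follows hJ a 0 (hfin _ (by omega))
    obtain ⟨l₂, hl₂, hl₂'⟩ := H.exists_follows hJ (n - (a + 1)) (a + 1) (hfin _ (by omega))
    rw [show 0 + 1 + a = a + 1 by ring] at hl
    rw [zero_add a] at hl'
    rw [show a + 1 + 1 + (n - (a + 1)) = n + 1 by omega] at hl₂
    rw [show a + 1 + (n - (a + 1)) = n by omega] at hl₂'
    have e : J 0 + totalJump l + (J (a + 1) - J a) = J (a + 1) := by rw [hl']; abel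
    refine ⟨i, J 0, σ 0, l, (J (a + 1) - J a, σ (a + 1)), l₂, _, _, _, _,
      s - (collisionTime c r (a + 1) z).toReal, (hitTime c r ((bounce c r)^[a + 1] z)).toReal,
      (bounce c r)^[a + 1 + 1] z,
      (collisionTime c r (n + 1) z).toReal - (collisionTime c r (a + 1 + 1) z).toReal, _, _,
      hJ 0 (hfin _ (by omega)), hl, ?_, ?_, by linarith, ?_, hsB, ?_, sub_nonneg.mpr htn1, htB,
      ?_, ?_, ?_⟩
    · simp only [e]; exact hstepa
    · exact sub_ne_zero.mpr (H.ne_of_hit_of_hitStep (hJ a (hfin _ (by omega))) hstepa.1)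
    · linarith
    · simp only [e]; exact hl₂
    · linarith
    · simp only [e]; exact hia
    · simp only [e]; rwa [hl₂']

end IsPerturbedLattice

/-! ### Sums over the lattice -/

theorem ncard_supNorm_eq (m : ℕ) (hm : m ≠ 0) : ENat.card (supNorm ⁻¹' {m}) = 8 * m := by
  have e : supNorm ⁻¹' {m} ≃ (Finset.box m : Finset (ℤ × ℤ)) :=
    (finTwoArrowEquiv ℤ).subtypeEquiv (by intro u; simp [supNorm])
  rw [ENat.card_congr e, ENat.card_eq_coe_fintype_card, Fintype.card_coe, Int.card_box hm]
  simp

theorem tsum_supNorm (F : ℕ → ℝ≥0∞) (h0 : F 0 = 0) :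
    ∑' u : Site, F (supNorm u) = ∑' m : ℕ, 8 * m * F m := by
  rw [← ENNReal.tsum_fiberwise _ supNorm]
  congr 1
  ext m
  have : ∀ a : supNorm ⁻¹' {m}, F (supNorm a) = F m := fun a => by rw [a.2]
  simp only [this, ENNReal.tsum_const]
  rcases eq_or_ne m 0 with rfl | hm
  · simp [h0]
  · rw [ncard_supNorm_eq m hm]; simp

/-- The sum over words of length `n` factorises, so the sum over all itineraries is a geometric
series in the total weight of one jump. -/
theorem tsum_list_prod {α : Type*} (f : α → ℝ≥0∞) :
    ∑' l : List α, (l.map f).prod = ∑' n : ℕ, (∑' a, f a) ^ n := by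
  have key : ∀ n : ℕ, ∑' l : List.Vector α n, (l.1.map f).prod = (∑' a, f a) ^ n := by
    intro n
    induction n with
    | zero =>
      rw [tsum_eq_single List.Vector.nil (fun b hb => absurd (List.Vector.eq_nil b) hb)]
      simp [List.Vector.nil]
    | succ n ih =>
      rw [pow_succ', ← ih, ← ENNReal.tsum_mul_right]
      simp_rw [← ENNReal.tsum_mul_left]
      rw [← ENNReal.tsum_prod]
      let e : α × List.Vector α n ≃ List.Vector α (n + 1) :=
        { toFun := fun p => p.1 ::ᵥ p.2
          invFun := fun v => (v.head, v.tail)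
          left_inv := fun p => by simp
          right_inv := fun v => by simp }
      rw [← e.tsum_eq]
      congr 1
  rw [← ENNReal.tsum_fiberwise _ List.length]
  congr 1
  ext n
  exact key n

theorem ofReal_pathWeight {h r κ : ℝ} (hh : 0 ≤ h) (hr : 0 ≤ r) (l : List (Site × Bool)) :
    ENNReal.ofReal (pathWeight h r κ l) =
      (l.map fun a => ENNReal.ofReal (jumpWeight h r κ a.1)).prod := by
  induction l with
  | nil => simp
  | cons a l ih =>
    rw [pathWeight_cons, ENNReal.ofReal_mul (jumpWeight_nonneg hh hr _), ih]; simp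

theorem tsum_exp_le {x : ℝ} (hx : 0 < x) :
    ∑' m : ℕ, ENNReal.ofReal (Real.exp (-(x * (m + 1)))) ≤ ENNReal.ofReal (1 / x) := by
  have h1 : ∀ m : ℕ, Real.exp (-(x * (m + 1))) = Real.exp (-x) * Real.exp (-x) ^ m := by
    intro m
    rw [← Real.exp_nat_mul, ← Real.exp_add]; congr 1; ring
  have h2 : Real.exp (-x) < 1 := by rw [Real.exp_lt_one_iff]; linarith
  have hs := (hasSum_geometric_of_lt_one (Real.exp_pos (-x)).le h2).mul_left (Real.exp (-x))
  simp only [h1]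
  rw [← ENNReal.ofReal_tsum_of_nonneg (fun n => by positivity) hs.summable, hs.tsum_eq]
  apply ENNReal.ofReal_le_ofReal
  rw [← div_eq_mul_inv, div_le_div_iff₀ (by linarith) hx]
  have h3 : x + 1 ≤ Real.exp x := Real.add_one_le_exp x
  have h4 : Real.exp (-x) * Real.exp x = 1 := by rw [← Real.exp_add]; simp
  nlinarith [Real.exp_pos (-x)]

/-- With `r = h²` the `8 * m` vectors of norm `m` each have weight `16 * h / m` times the damping.
The factor `m` cancels, and a geometric series of size `128 * h / (κ * h)` remains: the bound does
not depend on `h`. -/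
theorem tsum_jumpWeight_le {h κ : ℝ} (hh : 0 < h) (hκ : 0 < κ) :
    ∑' u : Site, ENNReal.ofReal (jumpWeight h (h ^ 2) κ u) ≤ ENNReal.ofReal (128 / κ) := by
  have h1 : ∀ u : Site, ENNReal.ofReal (jumpWeight h (h ^ 2) κ u) =
      (fun m : ℕ => ENNReal.ofReal (16 * h ^ 2 / (h * m) * Real.exp (-(κ * (h * m)))))
        (supNorm u) := fun u => rfl
  simp only [h1]
  rw [tsum_supNorm (fun m : ℕ => ENNReal.ofReal (16 * h ^ 2 / (h * m) *
    Real.exp (-(κ * (h * m))))) (by simp), tsum_eq_zero_add' ENNReal.summable]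
  have h2 : ∀ m : ℕ, 8 * ((m + 1 : ℕ) : ℝ≥0∞) * ENNReal.ofReal (16 * h ^ 2 / (h * (m + 1 : ℕ)) *
      Real.exp (-(κ * (h * (m + 1 : ℕ))))) = ENNReal.ofReal (128 * h) *
      ENNReal.ofReal (Real.exp (-((κ * h) * (m + 1)))) := by
    intro m
    have e8 : (8 : ℝ≥0∞) * ((m + 1 : ℕ) : ℝ≥0∞) = ENNReal.ofReal (8 * (m + 1 : ℕ)) := by
      rw [ENNReal.ofReal_mul (by norm_num), ENNReal.ofReal_natCast]; norm_num
    rw [e8, ← ENNReal.ofReal_mul (by positivity), ← ENNReal.ofReal_mul (by positivity)]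
    congr 1
    push_cast
    rw [show -(κ * (h * ((m : ℝ) + 1))) = -(κ * h * ((m : ℝ) + 1)) by ring]
    field_simp
    ring
  simp only [h2, ENNReal.tsum_mul_left]
  simp only [Nat.cast_zero, mul_zero, zero_mul, zero_add]
  calc _ ≤ ENNReal.ofReal (128 * h) * ENNReal.ofReal (1 / (κ * h)) :=
        mul_le_mul_right (tsum_exp_le (by positivity)) _
    _ = _ := by
      rw [← ENNReal.ofReal_mul (by positivity)]; congr 1; field_simp

/-- The damping rate for which the sum of the weights of all itineraries is finite. -/
def damping : ℝ := 512

/-- The two sides of impact double the bound `128 / 512`, so the ratio of the geometric series is at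
most one half. -/
theorem tsum_pathWeight_le {h : ℝ} (hh : 0 < h) :
    ∑' l, ENNReal.ofReal (pathWeight h (h ^ 2) damping l) ≤ 2 := by
  simp only [ofReal_pathWeight hh.le (sq_nonneg h), tsum_list_prod, damping]
  have h1 : ∑' a : Site × Bool, ENNReal.ofReal (jumpWeight h (h ^ 2) 512 a.1) ≤ 2⁻¹ := by
    rw [ENNReal.tsum_prod (f := fun u (_ : Bool) => ENNReal.ofReal (jumpWeight h (h ^ 2) 512 u))]
    simp only [tsum_bool, ← two_mul, ENNReal.tsum_mul_left]
    calc _ ≤ 2 * ENNReal.ofReal (128 / 512) :=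
          mul_le_mul_right (tsum_jumpWeight_le hh (by norm_num)) _
      _ = 2⁻¹ := by
        rw [← ENNReal.ofReal_ofNat 2, ← ENNReal.ofReal_mul (by norm_num),
          ← ENNReal.ofReal_inv_of_pos (by norm_num)]
        norm_num
  calc _ ≤ ∑' n : ℕ, (2⁻¹ : ℝ≥0∞) ^ n := ENNReal.tsum_le_tsum fun n => by gcongr
    _ = 2 := by rw [ENNReal.tsum_geometric]; simp

/-- The inverse norm of a lattice vector, cut off at `N`, and `0` at the origin. -/
noncomputable def invNorm (N : ℕ) (u : Site) : ℝ := if supNorm u ≤ N then (supNorm u : ℝ)⁻¹ else 0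

theorem invNorm_nonneg (N : ℕ) (u : Site) : 0 ≤ invNorm N u := by
  unfold invNorm; split_ifs <;> positivity

theorem invNorm_eq {N : ℕ} {u : Site} (hu : supNorm u ≤ N) : invNorm N u = (supNorm u : ℝ)⁻¹ :=
  if_pos hu

/-- The logarithmic factor. -/
noncomputable def logFactor (N : ℕ) : ℝ := 1 + Real.log N

theorem one_le_logFactor (N : ℕ) : 1 ≤ logFactor N := by
  unfold logFactor; linarith [Real.log_natCast_nonneg N]

theorem tsum_inv_le (N : ℕ) :
    ∑' m : ℕ, (if m ≤ N then ENNReal.ofReal (m : ℝ)⁻¹ else 0) ≤ ENNReal.ofReal (logFactor N) := by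
  rw [tsum_eq_sum (s := Finset.range (N + 1)) (by
    intro m hm
    rw [Finset.mem_range] at hm
    rw [if_neg (by omega)])]
  rw [Finset.sum_congr rfl (fun m hm => if_pos (by rw [Finset.mem_range] at hm; omega)),
    ← ENNReal.ofReal_sum_of_nonneg (fun m _ => by positivity)]
  apply ENNReal.ofReal_le_ofReal
  rw [Finset.sum_range_succ']
  have := harmonic_le_one_add_log N
  simp only [harmonic, Rat.cast_sum, Rat.cast_inv, Rat.cast_natCast] at this
  simpa [logFactor] using this

theorem ofReal_eight_mul_natCast (m : ℕ) : (8 : ℝ≥0∞) * m = ENNReal.ofReal (8 * m) := by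
  rw [ENNReal.ofReal_mul (by norm_num), ENNReal.ofReal_natCast]; norm_num

theorem tsum_invNorm_sq_le (N : ℕ) :
    ∑' u, ENNReal.ofReal (invNorm N u ^ 2) ≤ ENNReal.ofReal (8 * logFactor N) := by
  have h1 : ∀ u : Site, ENNReal.ofReal (invNorm N u ^ 2) =
      (fun m : ℕ => if m ≤ N then ENNReal.ofReal ((m : ℝ)⁻¹ ^ 2) else 0) (supNorm u) := by
    intro u; simp only [invNorm]; split_ifs <;> simp
  simp only [h1]
  rw [tsum_supNorm (fun m : ℕ => if m ≤ N then ENNReal.ofReal ((m : ℝ)⁻¹ ^ 2) else 0) (by simp)]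
  rw [ENNReal.ofReal_mul (by norm_num)]
  refine le_trans ?_ (mul_le_mul_right (tsum_inv_le N) _)
  rw [← ENNReal.tsum_mul_left]
  refine ENNReal.tsum_le_tsum fun m => ?_
  split_ifs
  · rw [ofReal_eight_mul_natCast, ← ENNReal.ofReal_mul (by positivity),
      ← ENNReal.ofReal_mul (by positivity)]
    apply ENNReal.ofReal_le_ofReal
    rcases eq_or_ne m 0 with rfl | hm
    · simp
    · apply le_of_eq; field_simp
  · simp

theorem tsum_invNorm_le (N : ℕ) :
    ∑' u, ENNReal.ofReal (invNorm N u) ≤ ENNReal.ofReal (8 * N) := by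
  have h1 : ∀ u : Site, ENNReal.ofReal (invNorm N u) =
      (fun m : ℕ => if m ≤ N then ENNReal.ofReal ((m : ℝ)⁻¹) else 0) (supNorm u) := by
    intro u; simp only [invNorm]; split_ifs <;> simp
  simp only [h1]
  rw [tsum_supNorm (fun m : ℕ => if m ≤ N then ENNReal.ofReal ((m : ℝ)⁻¹) else 0) (by simp)]
  rw [tsum_eq_sum (s := Finset.range (N + 1)) (by
    intro m hm
    rw [Finset.mem_range] at hm
    rw [if_neg (by omega), mul_zero]), Finset.sum_range_succ']
  have : ∀ m ∈ Finset.range N, 8 * ((m + 1 : ℕ) : ℝ≥0∞) *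
      (if m + 1 ≤ N then ENNReal.ofReal (((m + 1 : ℕ) : ℝ)⁻¹) else 0) = 8 := by
    intro m hm
    rw [Finset.mem_range] at hm
    rw [if_pos (by omega), ofReal_eight_mul_natCast, ← ENNReal.ofReal_mul (by positivity),
      mul_assoc, mul_inv_cancel₀ (by positivity)]
    norm_num
  rw [Finset.sum_congr rfl this]
  simp [ENNReal.ofReal_mul, mul_comm]

/-- The inequality of the means reduces the product to squares. Uniformity in `q` matters: `q`
contains the total displacement of an arbitrary itinerary, whose weights can then be summed
separately. -/
theorem tsum_invNorm_mul_le (N : ℕ) (q : Site) :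
    ∑' u, ENNReal.ofReal (invNorm N u * invNorm N (u + q)) ≤
      ENNReal.ofReal (8 * logFactor N) := by
  have h1 : ∀ u, ENNReal.ofReal (invNorm N u * invNorm N (u + q)) ≤
      2⁻¹ * ENNReal.ofReal (invNorm N u ^ 2) + 2⁻¹ * ENNReal.ofReal (invNorm N (u + q) ^ 2) := by
    intro u
    rw [← mul_add, ← ENNReal.ofReal_add (by positivity) (by positivity),
      ← ENNReal.ofReal_ofNat 2, ← ENNReal.ofReal_inv_of_pos (by norm_num),
      ← ENNReal.ofReal_mul (by norm_num)]
    apply ENNReal.ofReal_le_ofReal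
    nlinarith [sq_nonneg (invNorm N u - invNorm N (u + q))]
  refine (ENNReal.tsum_le_tsum h1).trans ?_
  have h2 := (Equiv.addRight q).tsum_eq (fun u => ENNReal.ofReal (invNorm N u ^ 2))
  simp only [Equiv.coe_addRight] at h2
  rw [ENNReal.tsum_add, ENNReal.tsum_mul_left, ENNReal.tsum_mul_left, h2, ← add_mul,
    ENNReal.inv_two_add_inv_two, one_mul]
  exact tsum_invNorm_sq_le N

/-! ### Pairs of lattice vectors of almost the same direction -/

/-- The oriented area of the parallelogram spanned by two lattice vectors. -/
def siteCross (u w : Site) : ℤ := u 0 * w 1 - u 1 * w 0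

/-- The lattice vector `w` is not much longer than `u` and is close to the line of `u`. -/
def InTube (θ : ℝ) (u w : Site) : Prop :=
  |(siteCross u w : ℝ)| ≤ 10 * θ * supNorm u ∧ supNorm w ≤ 2 * supNorm u

theorem supNorm_smul (k : ℤ) (u : Site) : supNorm (k • u) = k.natAbs * supNorm u := by
  simp only [supNorm, Pi.smul_apply, smul_eq_mul, Int.natAbs_mul]
  exact Nat.mul_max_mul_left _ _ _

theorem exists_natAbs_eq_supNorm (u : Site) : ∃ k, (u k).natAbs = supNorm u := by
  rcases max_choice (u 0).natAbs (u 1).natAbs with h | h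
  · exact ⟨0, h.symm⟩
  · exact ⟨1, h.symm⟩

/-- Every lattice vector is a multiple of a primitive one. -/
theorem exists_primitive {w : Site} (hw : w ≠ 0) :
    ∃ (g : ℤ) (e : Site), g ≠ 0 ∧ e ≠ 0 ∧ w = g • e ∧ IsCoprime (e 0) (e 1) := by
  have hg : Int.gcd (w 0) (w 1) ≠ 0 := by
    rw [Ne, Int.gcd_eq_zero_iff]
    rintro ⟨h0, h1⟩
    apply hw; ext k; fin_cases k <;> simp [h0, h1]
  obtain ⟨a, b, hab, h0, h1⟩ := Int.exists_gcd_one (Nat.pos_of_ne_zero hg)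
  have hco : IsCoprime a b := Int.isCoprime_iff_gcd_eq_one.mpr hab
  refine ⟨Int.gcd (w 0) (w 1), ![a, b], by exact_mod_cast hg, ?_, ?_, by simpa using hco⟩
  · intro h
    have ha : a = 0 := by simpa using congr_fun h 0
    have hb : b = 0 := by simpa using congr_fun h 1
    rw [ha, hb] at hab; simp at hab
  · ext k; fin_cases k
    · simp [mul_comm, ← h0]
    · simp [mul_comm, ← h1]

theorem exists_eq_smul_of_siteCross_eq_zero {e u : Site} (he : IsCoprime (e 0) (e 1))
    (h : siteCross u e = 0) : ∃ t : ℤ, u = t • e := by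
  obtain ⟨a, b, hab⟩ := he
  refine ⟨a * u 0 + b * u 1, ?_⟩
  unfold siteCross at h
  ext k; fin_cases k
  · simp only [Fin.zero_eta, Pi.smul_apply, smul_eq_mul]
    linear_combination (-u 0) * hab + b * h
  · simp only [Fin.mk_one, Pi.smul_apply, smul_eq_mul]
    linear_combination (-u 1) * hab - a * h

theorem siteCross_smul (g : ℤ) (u e : Site) : siteCross u (g • e) = g * siteCross u e := by
  simp [siteCross]; ring

theorem siteCross_sub (u u' e : Site) :
    siteCross (u - u') e = siteCross u e - siteCross u' e := by
  simp [siteCross]; ring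

/-- The number of lattice vectors close to a line but not on it. -/
theorem card_le_of_siteCross {θ : ℝ} (hθ : 0 ≤ θ) {w : Site} (hw : w ≠ 0) {m : ℕ} {S : Finset Site}
    (hS : ∀ u ∈ S, supNorm u ≤ m ∧ siteCross u w ≠ 0 ∧ |(siteCross u w : ℝ)| ≤ 10 * θ * m)
    (hwm : supNorm w ≤ 2 * m) : (S.card : ℝ) ≤ 320 * θ * m ^ 2 / supNorm w := by
  obtain ⟨g, e, hg, he, rfl, hco⟩ := exists_primitive hw
  obtain ⟨k, hk⟩ := exists_natAbs_eq_supNorm e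
  have hE : 1 ≤ supNorm e := supNorm_pos.mpr he
  have hEm : supNorm e ≤ 2 * m := by
    rw [supNorm_smul] at hwm
    refine le_trans ?_ hwm
    exact Nat.le_mul_of_pos_left _ (Int.natAbs_pos.mpr hg)
  have hek : e k ≠ 0 := by
    intro h; rw [h] at hk; simp at hk; omega
  have hgabs : (0 : ℝ) < g.natAbs := by exact_mod_cast Int.natAbs_pos.mpr hg
  set B : ℕ := ⌊10 * θ * m / g.natAbs⌋₊ with hB
  set M : ℕ := m / supNorm e + 1 with hM
  have hcard : S.card ≤ (((Finset.Icc (-(B : ℤ)) B).erase 0) ×ˢ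
      (Finset.Icc (-(M : ℤ)) M)).card := by
    -- Vectors with equal area against the primitive vector `e` differ by a multiple of `e`, which
    -- the integer quotient detects. The area takes at most `2 * B` values because zero is excluded;
    -- there is no additive constant, so the factor `θ` survives.
    apply Finset.card_le_card_of_injOn (fun u => (siteCross u e, u k / e k))
    · intro u hu
      obtain ⟨h1, h2, h3⟩ := hS u hu
      rw [siteCross_smul] at h2 h3
      have h4 : siteCross u e ≠ 0 := right_ne_zero_of_mul h2
      have h5 : (siteCross u e).natAbs ≤ B := by
        apply Nat.le_floor
        rw [le_div_iff₀ hgabs]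
        rw [Int.cast_mul, abs_mul] at h3
        rw [Nat.cast_natAbs, Nat.cast_natAbs, Int.cast_abs, Int.cast_abs]
        linarith
      have h6 : (u k / e k).natAbs ≤ M := by
        have a1 := (natAbs_le_supNorm u k).trans h1
        have a2 := Int.natAbs_ediv_le_natAbs (u k) (e k)
        have a3 : (u k / e k).natAbs ≤ (u k).natAbs / (e k).natAbs + 1 := by
          rw [Int.natAbs_ediv]
          split_ifs <;> omega
        rw [hk] at a3
        exact a3.trans (Nat.add_le_add_right (Nat.div_le_div_right a1) 1)
      simp only [Finset.coe_product, Set.mem_prod, Finset.mem_coe, Finset.mem_erase,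
        Finset.mem_Icc]
      exact ⟨⟨h4, by omega, by omega⟩, by omega, by omega⟩
    · intro u hu u' hu' heq
      simp only [Prod.mk.injEq] at heq
      obtain ⟨t, ht⟩ := exists_eq_smul_of_siteCross_eq_zero (u := u - u') hco
        (by rw [siteCross_sub, heq.1, sub_self])
      have h1 : u k = u' k + t * e k := by
        have := congr_fun ht k
        simp only [Pi.sub_apply, Pi.smul_apply, smul_eq_mul] at this
        linarith
      have h2 := heq.2
      rw [h1, Int.add_mul_ediv_right _ _ hek] at h2
      have : t = 0 := by linarith
      rw [this, zero_smul] at ht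
      exact sub_eq_zero.mp ht
  rw [Finset.card_product, Finset.card_erase_of_mem (by simp), Int.card_Icc, Int.card_Icc] at hcard
  have hcard' : S.card ≤ (2 * B) * (2 * M + 1) := by
    refine hcard.trans (le_of_eq ?_)
    congr 1 <;> omega
  have hE' : (0 : ℝ) < supNorm e := by exact_mod_cast hE
  have hB' : (B : ℝ) ≤ 10 * θ * m / g.natAbs := Nat.floor_le (by positivity)
  -- The additive constant `3` in `2 * M + 1` is absorbed by means of `supNorm e ≤ 2 * m`.
  have hM' : (2 * M + 1 : ℝ) ≤ 8 * m / supNorm e := by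
    have h1 : ((m / supNorm e : ℕ) : ℝ) ≤ m / supNorm e := Nat.cast_div_le
    have h2 : (1 : ℝ) ≤ 2 * m / supNorm e := by
      rw [le_div_iff₀ hE', one_mul]; exact_mod_cast hEm
    rw [hM]; push_cast
    have h3 : (8 : ℝ) * m / supNorm e = 2 * (m / supNorm e) + 3 * (2 * m / supNorm e) := by ring
    rw [h3]; linarith
  rw [supNorm_smul]
  push_cast
  calc (S.card : ℝ) ≤ (2 * B) * (2 * M + 1) := by exact_mod_cast hcard'
    _ ≤ (2 * (10 * θ * m / g.natAbs)) * (8 * m / supNorm e) := by gcongr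
    _ = 160 * θ * m ^ 2 / (g.natAbs * supNorm e) := by field_simp; ring
    _ ≤ _ := by
      gcongr
      norm_num

/-- Telescoping, for a summation by parts that turns counts of vectors of norm at most `m` into sums
of inverse norms. -/
theorem one_div_eq_add_sum (k N : ℕ) (hk : 1 ≤ k) (hkN : k ≤ N) :
    (k : ℝ)⁻¹ = ((N : ℝ) + 1)⁻¹ + ∑ m ∈ Finset.Icc k N, ((m : ℝ) * (m + 1))⁻¹ := by
  induction N, hkN using Nat.le_induction with
  | base =>
    have : (0 : ℝ) < k := by exact_mod_cast hk
    rw [Finset.Icc_self, Finset.sum_singleton]; field_simp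
  | succ N hN ih =>
    have : (0 : ℝ) < N := by exact_mod_cast hk.trans hN
    rw [Finset.sum_Icc_succ_top (by omega), ih]
    push_cast
    field_simp
    ring

open Classical in
/-- The sum over the lattice vectors close to a line but not on it. -/
theorem tsum_tube_le {θ : ℝ} (hθ : 0 ≤ θ) (N : ℕ) {w : Site} (hw : w ≠ 0) :
    ∑' u, (if InTube θ u w ∧ siteCross u w ≠ 0 then ENNReal.ofReal (invNorm N u) else 0) ≤
      ENNReal.ofReal (640 * θ * N / supNorm w) := by
  set U : Finset Site := (finite_supNorm_le N).toFinset.filter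
    fun u => InTube θ u w ∧ siteCross u w ≠ 0 with hU
  have hwp := one_le_supNorm hw
  have memU : ∀ u ∈ U, supNorm u ≤ N ∧ 1 ≤ supNorm u ∧ InTube θ u w ∧ siteCross u w ≠ 0 := by
    intro u hu
    rw [hU, Finset.mem_filter, Set.Finite.mem_toFinset] at hu
    refine ⟨hu.1, ?_, hu.2⟩
    rw [Nat.one_le_iff_ne_zero, Ne, supNorm_eq_zero]
    rintro rfl
    exact hu.2.2 (by simp [siteCross])
  have card_le : ∀ m : ℕ, (((U.filter fun u => supNorm u ≤ m).card : ℕ) : ℝ) ≤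
      320 * θ * m ^ 2 / supNorm w := by
    intro m
    -- Otherwise no vector is counted, since the tube condition includes `supNorm w ≤ 2 * supNorm
    -- u`.
    by_cases hm : supNorm w ≤ 2 * m
    · apply card_le_of_siteCross hθ hw _ hm
      intro u hu
      rw [Finset.mem_filter] at hu
      obtain ⟨h1, h2, h3, h4⟩ := memU u hu.1
      refine ⟨hu.2, h4, h3.1.trans ?_⟩
      have : (supNorm u : ℝ) ≤ m := by exact_mod_cast hu.2
      gcongr
    · rw [Finset.filter_false_of_mem]
      · simp; positivity
      · intro u hu hum
        have := (memU u hu).2.2.1.2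
        omega
  rw [tsum_eq_sum (s := U) (by
    intro u hu
    rw [hU, Finset.mem_filter, Set.Finite.mem_toFinset] at hu
    split_ifs with h
    · rw [invNorm, if_neg (fun h' : supNorm u ≤ N => hu ⟨h', h⟩), ENNReal.ofReal_zero]
    · rfl)]
  rw [Finset.sum_congr rfl (fun u hu => if_pos (memU u hu).2.2),
    ← ENNReal.ofReal_sum_of_nonneg (fun u _ => invNorm_nonneg N u)]
  apply ENNReal.ofReal_le_ofReal
  -- After summation by parts the boundary term is at most `320 * θ * N / supNorm w`, and each of
  -- the `N` levels gives at most `320 * θ / supNorm w`.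
  have h1 : ∀ u ∈ U, invNorm N u = ((N : ℝ) + 1)⁻¹ +
      ∑ m ∈ Finset.Icc 1 N, if supNorm u ≤ m then ((m : ℝ) * (m + 1))⁻¹ else 0 := by
    intro u hu
    obtain ⟨h1, h2, -⟩ := memU u hu
    rw [invNorm_eq h1, one_div_eq_add_sum _ N h2 h1, ← Finset.sum_filter]
    congr 2
    ext m
    simp only [Finset.mem_Icc, Finset.mem_filter]
    omega
  rw [Finset.sum_congr rfl h1, Finset.sum_add_distrib, Finset.sum_comm]
  have h2 : ∑ u ∈ U, ((N : ℝ) + 1)⁻¹ ≤ 320 * θ * N / supNorm w := by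
    have := card_le N
    rw [Finset.filter_true_of_mem (fun u hu => (memU u hu).1)] at this
    rw [Finset.sum_const, nsmul_eq_mul, ← div_eq_mul_inv, div_le_iff₀ (by positivity)]
    refine this.trans ?_
    rw [div_mul_eq_mul_div]
    apply div_le_div_of_nonneg_right _ (by positivity)
    nlinarith [mul_nonneg hθ (Nat.cast_nonneg (α := ℝ) N)]
  have h3 : ∀ m ∈ Finset.Icc 1 N,
      ∑ u ∈ U, (if supNorm u ≤ m then ((m : ℝ) * (m + 1))⁻¹ else 0) ≤ 320 * θ / supNorm w := by
    intro m hm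
    rw [Finset.mem_Icc] at hm
    have hm' : (1 : ℝ) ≤ m := by exact_mod_cast hm.1
    rw [← Finset.sum_filter, Finset.sum_const, nsmul_eq_mul, ← div_eq_mul_inv,
      div_le_iff₀ (by positivity)]
    refine (card_le m).trans ?_
    rw [div_mul_eq_mul_div]
    gcongr ?_ / _
    nlinarith
  refine (add_le_add h2 (Finset.sum_le_sum h3)).trans (le_of_eq ?_)
  rw [Finset.sum_const, Nat.card_Icc, nsmul_eq_mul]
  simp only [add_tsub_cancel_right]
  field_simp
  ring

/-- A parametrisation that covers the support may count points several times. -/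
theorem tsum_le_tsum_comp {X Y : Type*} (φ : X → Y) (F : Y → ℝ≥0∞)
    (h : ∀ y, F y ≠ 0 → ∃ x, φ x = y) : ∑' y, F y ≤ ∑' x, F (φ x) := by
  choose ψ hψ using fun y : Function.support F => h y y.2
  have hinj : Function.Injective ψ := fun a b hab => by
    apply Subtype.ext; rw [← hψ a, ← hψ b, hab]
  rw [← tsum_subtype_support F]
  refine le_trans (le_of_eq ?_) (ENNReal.tsum_comp_le_tsum_of_injective hinj fun x => F (φ x))
  simp only [hψ]

/-- The inverse of the absolute value of an integer, cut off at `N`. -/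
noncomputable def invAbs (N : ℕ) (k : ℤ) : ℝ := if k.natAbs ≤ N then ((k.natAbs : ℕ) : ℝ)⁻¹ else 0

theorem invAbs_nonneg (N : ℕ) (k : ℤ) : 0 ≤ invAbs N k := by
  unfold invAbs; split_ifs <;> positivity

theorem tsum_invAbs_le (N : ℕ) :
    ∑' k : ℤ, ENNReal.ofReal (invAbs N k) ≤ ENNReal.ofReal (2 * logFactor N) := by
  refine (tsum_le_tsum_comp (Sum.elim (fun m : ℕ => (m : ℤ)) (fun m : ℕ => -(m : ℤ))) _
    fun k _ => ?_).trans ?_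
  · rcases Int.eq_nat_or_neg k with ⟨m, hm | hm⟩
    · exact ⟨Sum.inl m, hm.symm⟩
    · exact ⟨Sum.inr m, hm.symm⟩
  rw [ENNReal.summable.tsum_sum ENNReal.summable]
  simp only [invAbs, Sum.elim_inl, Sum.elim_inr, Int.natAbs_neg, Int.natAbs_natCast]
  have e : ∑' m : ℕ, ENNReal.ofReal (if m ≤ N then (m : ℝ)⁻¹ else 0) ≤
      ENNReal.ofReal (logFactor N) :=
    (le_of_eq (tsum_congr fun m => by split_ifs <;> simp)).trans (tsum_inv_le N)
  rw [two_mul, ENNReal.ofReal_add (by linarith [one_le_logFactor N])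
    (by linarith [one_le_logFactor N])]
  exact add_le_add e e

theorem invNorm_smul_le (N : ℕ) (k : ℤ) (e : Site) :
    invNorm N (k • e) ≤ invAbs N k * invNorm N e := by
  have h0 := mul_nonneg (invAbs_nonneg N k) (invNorm_nonneg N e)
  by_cases hle : supNorm (k • e) ≤ N
  · rcases eq_or_ne k 0 with rfl | hk
    · simpa [invNorm, supNorm] using h0
    rcases eq_or_ne e 0 with rfl | he
    · simp [invNorm, supNorm]
    rw [supNorm_smul] at hle
    have h1 : k.natAbs ≤ N := (Nat.le_mul_of_pos_right _ (supNorm_pos.mpr he)).trans hle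
    have h2 : supNorm e ≤ N := (Nat.le_mul_of_pos_left _ (Int.natAbs_pos.mpr hk)).trans hle
    rw [invNorm, invNorm, invAbs, supNorm_smul, if_pos hle, if_pos h1, if_pos h2]
    push_cast
    rw [mul_inv]
  · rw [invNorm, if_neg hle]; exact h0

theorem ne_zero_of_invNorm {N : ℕ} {u : Site} (hu : invNorm N u ≠ 0) : u ≠ 0 := by
  rintro rfl; apply hu; simp [invNorm, supNorm]

open Classical in
-- Collinear vectors are integer multiples of a common vector. The sum over that vector and the two
-- multipliers factorises into three logarithms, `8 * 2 * 2 = 32`; using all vectors and not only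
-- primitive ones overcounts harmlessly.
theorem tsum_collinear_le (N : ℕ) :
    ∑' p : Site × Site, (if siteCross p.1 p.2 = 0 then
      ENNReal.ofReal (invNorm N p.1 * invNorm N p.2) else 0) ≤
      ENNReal.ofReal (32 * logFactor N ^ 3) := by
  refine (tsum_le_tsum_comp (fun x : Site × ℤ × ℤ => (x.2.1 • x.1, x.2.2 • x.1)) _ ?_).trans ?_
  · rintro ⟨u, w⟩ hne
    simp only [ne_eq, ite_eq_right_iff, ENNReal.ofReal_eq_zero, not_forall, not_le] at hne
    obtain ⟨h1, h2⟩ := hne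
    have hw : w ≠ 0 := ne_zero_of_invNorm (N := N) fun h => by simp [h] at h2
    obtain ⟨g, e, hg, he, rfl, hco⟩ := exists_primitive hw
    rw [siteCross_smul] at h1
    obtain ⟨t, rfl⟩ := exists_eq_smul_of_siteCross_eq_zero hco
      ((mul_eq_zero.mp h1).resolve_left hg)
    exact ⟨(e, t, g), rfl⟩
  have h1 : ∀ x : Site × ℤ × ℤ,
      (if siteCross (x.2.1 • x.1) (x.2.2 • x.1) = 0 then
        ENNReal.ofReal (invNorm N (x.2.1 • x.1) * invNorm N (x.2.2 • x.1)) else 0) ≤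
      ENNReal.ofReal (invNorm N x.1 ^ 2) *
        (ENNReal.ofReal (invAbs N x.2.1) * ENNReal.ofReal (invAbs N x.2.2)) := by
    rintro ⟨e, m, k⟩
    refine (ite_le_sup _ _ _).trans ?_
    rw [sup_of_le_left zero_le, ← ENNReal.ofReal_mul (invAbs_nonneg _ _),
      ← ENNReal.ofReal_mul (sq_nonneg _)]
    apply ENNReal.ofReal_le_ofReal
    calc _ ≤ (invAbs N m * invNorm N e) * (invAbs N k * invNorm N e) :=
          mul_le_mul (invNorm_smul_le N m e) (invNorm_smul_le N k e) (invNorm_nonneg _ _)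
            (mul_nonneg (invAbs_nonneg _ _) (invNorm_nonneg _ _))
      _ = _ := by ring
  refine (ENNReal.tsum_le_tsum h1).trans ?_
  rw [ENNReal.tsum_prod (f := fun e (y : ℤ × ℤ) => ENNReal.ofReal (invNorm N e ^ 2) *
    (ENNReal.ofReal (invAbs N y.1) * ENNReal.ofReal (invAbs N y.2)))]
  simp only [ENNReal.tsum_mul_left, ENNReal.tsum_mul_right]
  rw [ENNReal.tsum_prod (f := fun a b : ℤ =>
    ENNReal.ofReal (invAbs N a) * ENNReal.ofReal (invAbs N b))]
  simp only [ENNReal.tsum_mul_left, ENNReal.tsum_mul_right]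
  have hL := one_le_logFactor N
  calc _ ≤ ENNReal.ofReal (8 * logFactor N) * (ENNReal.ofReal (2 * logFactor N) *
        ENNReal.ofReal (2 * logFactor N)) :=
        mul_le_mul' (tsum_invNorm_sq_le N) (mul_le_mul' (tsum_invAbs_le N) (tsum_invAbs_le N))
    _ = _ := by
      rw [← ENNReal.ofReal_mul (by positivity), ← ENNReal.ofReal_mul (by positivity)]
      congr 1; ring

open Classical in
/-- A bound for the sum over the pairs of lattice vectors of almost the same direction, with a
weight `W` of the second one. -/
theorem tsum_inTube_le {θ : ℝ} (hθ : 0 ≤ θ) (N : ℕ) {W : Site → ℝ} {A B : ℝ} (hA : 0 ≤ A)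
    (hB : 0 ≤ B)
    (hW : ∀ w, 0 ≤ W w) (hW0 : W 0 = 0) (hWB : ∀ w, W w ≤ B * invNorm N w)
    (hWA : ∑' w, ENNReal.ofReal (W w / supNorm w) ≤ ENNReal.ofReal A) :
    ∑' p : Site × Site, (if InTube θ p.1 p.2 then
      ENNReal.ofReal (invNorm N p.1 * W p.2) else 0) ≤
      ENNReal.ofReal (640 * θ * N * A + 32 * B * logFactor N ^ 3) := by
  have hL := one_le_logFactor N
  -- Pairs off the line are summed over `u` first, with `w` fixed; on the line the weight is
  -- replaced by its bound through `invNorm`.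
  have h1 : ∀ p : Site × Site, (if InTube θ p.1 p.2 then
      ENNReal.ofReal (invNorm N p.1 * W p.2) else 0) ≤
      ENNReal.ofReal (W p.2) * (if InTube θ p.1 p.2 ∧ siteCross p.1 p.2 ≠ 0 then
        ENNReal.ofReal (invNorm N p.1) else 0) +
      ENNReal.ofReal B * (if siteCross p.1 p.2 = 0 then
        ENNReal.ofReal (invNorm N p.1 * invNorm N p.2) else 0) := by
    rintro ⟨u, w⟩
    simp only
    by_cases hT : InTube θ u w
    · by_cases hc : siteCross u w = 0
      · rw [if_pos hT, if_pos hc, if_neg (by simp [hc]), mul_zero, zero_add,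
          ← ENNReal.ofReal_mul hB]
        apply ENNReal.ofReal_le_ofReal
        nlinarith [mul_le_mul_of_nonneg_left (hWB w) (invNorm_nonneg N u)]
      · rw [if_pos hT, if_neg hc, if_pos ⟨hT, hc⟩, mul_zero, add_zero, mul_comm (invNorm N u),
          ENNReal.ofReal_mul (hW w)]
    · rw [if_neg hT]; exact zero_le
  refine (ENNReal.tsum_le_tsum h1).trans ?_
  rw [ENNReal.tsum_add, ENNReal.tsum_mul_left, ENNReal.ofReal_add (by positivity) (by positivity)]
  refine add_le_add ?_ ?_
  · rw [ENNReal.tsum_prod (f := fun u w => ENNReal.ofReal (W w) *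
      (if InTube θ u w ∧ siteCross u w ≠ 0 then ENNReal.ofReal (invNorm N u) else 0)),
      ENNReal.tsum_comm]
    simp only [ENNReal.tsum_mul_left]
    have h2 : ∀ w, ENNReal.ofReal (W w) * ∑' u, (if InTube θ u w ∧ siteCross u w ≠ 0 then
        ENNReal.ofReal (invNorm N u) else 0) ≤
        ENNReal.ofReal (640 * θ * N) * ENNReal.ofReal (W w / supNorm w) := by
      intro w
      rcases eq_or_ne w 0 with rfl | hw
      · simp [hW0]
      · refine (mul_le_mul_right (tsum_tube_le hθ N hw) _).trans (le_of_eq ?_)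
        rw [← ENNReal.ofReal_mul (hW w), ← ENNReal.ofReal_mul (by positivity)]
        congr 1; ring
    refine (ENNReal.tsum_le_tsum h2).trans ?_
    rw [ENNReal.tsum_mul_left, ENNReal.ofReal_mul (p := 640 * θ * N) (by positivity)]
    exact mul_le_mul_right hWA _
  · refine (mul_le_mul_right (tsum_collinear_le N) _).trans (le_of_eq ?_)
    rw [← ENNReal.ofReal_mul hB]; congr 1; ring

open Classical in
-- The case of a return right after the jump `u`: the last flight has length about `h |w|` and
-- supplies the inverse norm of `w`.
theorem tsum_inTube_inv_le {θ : ℝ} (hθ : 0 ≤ θ) (N : ℕ) :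
    ∑' p : Site × Site, (if InTube θ p.1 p.2 then
      ENNReal.ofReal (invNorm N p.1 * invNorm N p.2) else 0) ≤
      ENNReal.ofReal (5120 * θ * N * logFactor N + 32 * logFactor N ^ 3) := by
  have hL := one_le_logFactor N
  refine (tsum_inTube_le hθ N (A := 8 * logFactor N) (B := 1) (by positivity) zero_le_one
    (invNorm_nonneg N) (by simp [invNorm, supNorm]) (by simp) ?_).trans (le_of_eq ?_)
  · refine le_trans (le_of_eq ?_) (tsum_invNorm_sq_le N)
    congr 1; ext w
    unfold invNorm; split_ifs
    · congr 1; ring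
    · simp
  · congr 1; ring

/-- The indicator of the nonzero lattice vectors of norm at most `N`. -/
noncomputable def cutoff (N : ℕ) (u : Site) : ℝ := supNorm u * invNorm N u

theorem cutoff_nonneg (N : ℕ) (u : Site) : 0 ≤ cutoff N u :=
  mul_nonneg (Nat.cast_nonneg _) (invNorm_nonneg N u)

theorem cutoff_eq_one {N : ℕ} {u : Site} (hu : u ≠ 0) (huN : supNorm u ≤ N) : cutoff N u = 1 := by
  have := one_le_supNorm hu
  rw [cutoff, invNorm_eq huN, mul_inv_cancel₀ (by positivity)]

theorem cutoff_le (N : ℕ) (u : Site) : cutoff N u ≤ N * invNorm N u := by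
  unfold cutoff invNorm
  split_ifs with h
  · gcongr
  · simp

open Classical in
-- The case of further jumps before the return: there is no decay in `w`, which costs a factor `N`;
-- the weight of the next jump compensates for it.
theorem tsum_inTube_cutoff_le {θ : ℝ} (hθ : 0 ≤ θ) (N : ℕ) :
    ∑' p : Site × Site, (if InTube θ p.1 p.2 then
      ENNReal.ofReal (invNorm N p.1 * cutoff N p.2) else 0) ≤
      ENNReal.ofReal (N * (5120 * θ * N + 32 * logFactor N ^ 3)) := by
  refine (tsum_inTube_le hθ N (A := 8 * N) (B := N) (by positivity) (by positivity)
    (cutoff_nonneg N) (by simp [cutoff, supNorm]) (cutoff_le N) ?_).trans (le_of_eq ?_)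
  · refine le_trans (le_of_eq ?_) (tsum_invNorm_le N)
    congr 1; ext w
    congr 1
    rcases eq_or_ne w 0 with rfl | hw
    · simp [cutoff, invNorm, supNorm]
    · have := one_le_supNorm hw
      unfold cutoff; field_simp
  · congr 1; ring

open Classical in
/-- The number of lattice points in a strip. -/
theorem tsum_strip_le (v : Velocity) {N : ℕ} (hN : 1 ≤ N) :
    ∑' u : Site, (if |cross v (sitePoint u)| ≤ 2 ∧ supNorm u ≤ N then (1 : ℝ≥0∞) else 0) ≤
      18 * N := by
  set U : Finset Site := (finite_supNorm_le N).toFinset.filter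
    fun u => |cross v (sitePoint u)| ≤ 2 with hU
  have memU : ∀ u, u ∈ U ↔ supNorm u ≤ N ∧ |cross v (sitePoint u)| ≤ 2 := by
    intro u
    rw [hU, Finset.mem_filter, Set.Finite.mem_toFinset]; rfl
  -- One coordinate of a unit vector exceeds `2 / 3`. For given `u k`, the coordinate `u l` then
  -- lies in an open interval of length `6`, which leaves at most six integers.
  obtain ⟨k, l, hkl, hv⟩ : ∃ k l : Fin 2, k ≠ l ∧ 2 / 3 < |(v : Plane) k| ∧
      ∀ u, |cross v (sitePoint u)| = |(v : Plane) k * u l - (v : Plane) l * u k| := by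
    have h1 := velocity_sq v
    by_cases h0 : 2 / 3 < |(v : Plane) 0|
    · exact ⟨0, 1, by decide, h0, fun u => rfl⟩
    · refine ⟨1, 0, by decide, ?_, fun u => ?_⟩
      · by_contra h2
        rw [not_lt] at h0 h2
        nlinarith [sq_abs ((v : Plane) 0), sq_abs ((v : Plane) 1), abs_nonneg ((v : Plane) 0),
          abs_nonneg ((v : Plane) 1)]
      · rw [← abs_neg]; congr 1; simp [cross, sitePoint]
  have hvk : (v : Plane) k ≠ 0 := by
    intro h; have := hv.1; rw [h] at this; norm_num at this
  set b : ℝ := (v : Plane) l / (v : Plane) k with hb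
  have hcard : U.card ≤ (Finset.Icc (-(N : ℤ)) N ×ˢ Finset.Icc (-3 : ℤ) 2).card := by
    apply Finset.card_le_card_of_injOn (fun u => (u k, u l + ⌊-(b * u k)⌋))
    · intro u hu
      obtain ⟨h1, h2⟩ := (memU u).mp hu
      have h3 := (natAbs_le_supNorm u k).trans h1
      rw [hv.2] at h2
      have h4 : |(u l : ℝ) - b * u k| < 3 := by
        have e : (v : Plane) k * u l - (v : Plane) l * u k =
            (v : Plane) k * ((u l : ℝ) - b * u k) := by rw [hb]; field_simp
        rw [e, abs_mul] at h2
        by_contra hcon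
        rw [not_lt] at hcon
        nlinarith [hv.1]
      have h5 : ⌊(u l : ℝ) - b * u k⌋ = u l + ⌊-(b * u k)⌋ := by
        rw [sub_eq_add_neg, Int.floor_intCast_add]
      have h6 := abs_lt.mp h4
      simp only [Finset.coe_product, Set.mem_prod, Finset.mem_coe, Finset.mem_Icc]
      rw [← h5]
      refine ⟨by omega, Int.le_floor.mpr (by push_cast; linarith),
        Int.le_of_lt_add_one (Int.floor_lt.mpr (by push_cast; linarith))⟩
    · intro u _ u' _ heq
      simp only [Prod.mk.injEq] at heq
      have h1 := heq.1
      have h2 := heq.2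
      rw [h1] at h2
      have h3 : u l = u' l := by linarith
      ext i
      fin_cases k <;> fin_cases l <;> fin_cases i <;> simp_all
  rw [Finset.card_product, Int.card_Icc, Int.card_Icc] at hcard
  rw [tsum_eq_sum (s := U) (fun u hu => if_neg fun h => hu ((memU u).mpr ⟨h.2, h.1⟩))]
  refine (Finset.sum_le_sum (g := fun _ => (1 : ℝ≥0∞)) fun u _ => by split_ifs <;> simp).trans ?_
  rw [Finset.sum_const, nsmul_eq_mul, mul_one]
  rw [show ((2 : ℤ) + 1 - -3).toNat = 6 from rfl,
    show ((N : ℤ) + 1 - -N).toNat = 2 * N + 1 by omega] at hcard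
  have : U.card ≤ 18 * N := by omega
  exact_mod_cast this

/-! ### Areas -/

/-- The coordinates of a vector in the frame of a unit vector. -/
noncomputable def frame (v : Velocity) : Plane ≃ₗᵢ[ℝ] Plane :=
  LinearIsometry.toLinearIsometryEquiv
    { toFun := fun x => WithLp.toLp 2 ![⟪(v : Plane), x⟫, cross v x]
      map_add' := fun x y => by
        ext k; fin_cases k <;> simp [inner_add_right, cross_add]
      map_smul' := fun t x => by
        ext k; fin_cases k <;> simp [inner_smul_right, cross_smul]
      norm_map' := fun x => by
        rw [← pow_left_inj₀ (norm_nonneg _) (norm_nonneg _) two_ne_zero, norm_sq_eq]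
        have := cross_sq_add_inner_sq v x
        rw [norm_eq_of_mem_sphere] at this
        simp
        linarith }
    rfl

theorem frame_zero (v : Velocity) (x : Plane) : frame v x 0 = ⟪(v : Plane), x⟫ := rfl

theorem frame_one (v : Velocity) (x : Plane) : frame v x 1 = cross v x := rfl

theorem volume_box (a b : Fin 2 → ℝ) :
    volume {x : Plane | ∀ k, a k ≤ x k ∧ x k ≤ b k} =
      ENNReal.ofReal (b 0 - a 0) * ENNReal.ofReal (b 1 - a 1) := by
  have h : {x : Plane | ∀ k, a k ≤ x k ∧ x k ≤ b k} = WithLp.ofLp ⁻¹' Set.Icc a b := by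
    ext x
    simp only [Set.mem_ofPred_eq, Set.mem_preimage, Set.mem_Icc, Pi.le_def]
    exact forall_and
  rw [h, (PiLp.volume_preserving_ofLp (Fin 2)).measure_preimage measurableSet_Icc.nullMeasurableSet,
    Real.volume_Icc_pi, Fin.prod_univ_two]

theorem volume_rectangle_le (v : Velocity) (a b : ℝ) {A B : ℝ} (hA : 0 ≤ A) :
    volume {x : Plane | |⟪(v : Plane), x⟫ - a| ≤ A ∧ |cross v x - b| ≤ B} ≤
      ENNReal.ofReal (4 * A * B) := by
  have h : {x : Plane | |⟪(v : Plane), x⟫ - a| ≤ A ∧ |cross v x - b| ≤ B} =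
      frame v ⁻¹' {x : Plane | ∀ k, (![a - A, b - B] : Fin 2 → ℝ) k ≤ x k ∧
        x k ≤ (![a + A, b + B] : Fin 2 → ℝ) k} := by
    ext x
    simp only [Set.mem_ofPred_eq, Set.mem_preimage, Fin.forall_fin_two, frame_zero, frame_one,
      Matrix.cons_val_zero, Matrix.cons_val_one, abs_le]
    constructor <;> rintro ⟨⟨h1, h2⟩, h3, h4⟩ <;>
      refine ⟨⟨by linarith, by linarith⟩, by linarith, by linarith⟩
  rw [h, (frame v).measurePreserving.measure_preimage_emb
    (frame v).toHomeomorph.measurableEmbedding, volume_box]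
  simp only [Matrix.cons_val_zero, Matrix.cons_val_one]
  rw [← ENNReal.ofReal_mul (by linarith)]
  apply ENNReal.ofReal_le_ofReal
  apply le_of_eq; ring

/-- The area of a set which is thin in the direction orthogonal to `v`. -/
theorem volume_le_of_thin (v : Velocity) {S : Set Plane} {A B : ℝ} (hA : 0 ≤ A)
    (hSA : ∀ x ∈ S, ∀ y ∈ S, ‖x - y‖ ≤ A) (hSB : ∀ x ∈ S, ∀ y ∈ S, |cross v (x - y)| ≤ B) :
    volume S ≤ ENNReal.ofReal (4 * A * B) := by
  rcases S.eq_empty_or_nonempty with rfl | ⟨y, hy⟩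
  · simp
  refine (measure_mono fun x hx => ?_).trans
    (volume_rectangle_le v ⟪(v : Plane), y⟫ (cross v y) (B := B) hA)
  constructor
  · rw [← inner_sub_right]
    have := abs_real_inner_le_norm (v : Plane) (x - y)
    rw [norm_eq_of_mem_sphere, one_mul] at this
    exact this.trans (hSA x hx y hy)
  · rw [← cross_sub]; exact hSB x hx y hy

/-- The measure on the circle of velocities. -/
noncomputable abbrev velocityMeasure : Measure Velocity := (volume : Measure Plane).toSphere

theorem velocityMeasure_univ : velocityMeasure Set.univ = ENNReal.ofReal (2 * Real.pi) := by
  rw [velocityMeasure, Measure.toSphere_apply_univ, EuclideanSpace.volume_ball_fin_two,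
    finrank_euclideanSpace_fin, ENNReal.ofReal_mul (by norm_num)]
  simp

theorem continuous_cross_left (p : Plane) : Continuous fun v : Velocity => cross v p := by
  unfold cross; fun_prop

theorem measurableSet_abs_cross_le (p : Plane) (B : ℝ) :
    MeasurableSet {v : Velocity | |cross v p| ≤ B} :=
  (isClosed_le (continuous_cross_left p).abs continuous_const).measurableSet

theorem cross_comm (x y : Plane) : cross x y = -cross y x := by simp [cross]; ring

open scoped Pointwise in
/-- The measure of the set of velocities in almost the direction of `p`. -/
theorem velocityMeasure_le {p : Plane} (hp : p ≠ 0) (B : ℝ) :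
    velocityMeasure {v : Velocity | |cross v p| ≤ B} ≤ ENNReal.ofReal (8 * B / ‖p‖) := by
  rw [velocityMeasure, Measure.toSphere_apply' _ (measurableSet_abs_cross_le p B),
    finrank_euclideanSpace_fin]
  have hp' : 0 < ‖p‖ := norm_pos_iff.mpr hp
  let e : Velocity := ⟨(‖p‖)⁻¹ • p, by simp [norm_smul, hp]⟩
  -- `toSphere` measures the cone over a set of directions. The cone here lies in a thin rectangle
  -- along the line of `p`.
  have hsub : Set.Ioo (0 : ℝ) 1 • (Subtype.val '' {v : Velocity | |cross v p| ≤ B}) ⊆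
      {x : Plane | |⟪(e : Plane), x⟫ - 0| ≤ 1 ∧ |cross e x - 0| ≤ B / ‖p‖} := by
    rintro _ ⟨t, ht, _, ⟨v, hv, rfl⟩, rfl⟩
    have hv' : |cross v p| ≤ B := hv
    simp only [Set.mem_ofPred_eq, sub_zero]
    constructor
    · have := abs_real_inner_le_norm (e : Plane) (t • (v : Plane))
      rw [norm_eq_of_mem_sphere, norm_smul_velocity, one_mul, abs_of_pos ht.1] at this
      exact this.trans ht.2.le
    · have h1 : cross e (t • (v : Plane)) = -(t * (cross v p / ‖p‖)) := by
        rw [cross_comm]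
        simp only [e, cross, PiLp.smul_apply, smul_eq_mul]
        field_simp
      rw [h1, abs_neg, abs_mul, abs_of_pos ht.1, abs_div, abs_of_pos hp']
      calc t * (|cross v p| / ‖p‖) ≤ 1 * (|cross v p| / ‖p‖) := by
            gcongr; exact ht.2.le
        _ ≤ B / ‖p‖ := by rw [one_mul]; gcongr
  calc _ ≤ ((2 : ℕ) : ℝ≥0∞) * ENNReal.ofReal (4 * 1 * (B / ‖p‖)) :=
        mul_le_mul_right ((measure_mono hsub).trans (volume_rectangle_le e 0 0 zero_le_one)) _
    _ = ENNReal.ofReal (8 * B / ‖p‖) := by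
      rw [← ENNReal.ofReal_natCast, ← ENNReal.ofReal_mul (by norm_num)]
      congr 1; push_cast; ring

/-! ### The areas of the sets of starting points with a given itinerary -/

/-- The cell of the lattice of spacing `h`. -/
def squareCell (h : ℝ) (k : Site) : Set Plane :=
  {x | ∀ i, x i ∈ Set.Ico (h * ((k i : ℝ) - 1 / 2)) (h * ((k i : ℝ) + 1 / 2))}

theorem measurableSet_squareCell (h : ℝ) (k : Site) : MeasurableSet (squareCell h k) := by
  unfold squareCell
  simp only [Set.ofPred_forall]
  exact MeasurableSet.iInter fun i => measurableSet_Ico.preimage (by fun_prop)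

theorem norm_sub_sitePoint_le {h : ℝ} (hh : 0 < h) {k : Site} {x : Plane}
    (hx : x ∈ squareCell h k) : ‖x - h • sitePoint k‖ ≤ h := by
  apply le_of_sq_le_sq _ hh.le
  rw [norm_sq_eq]
  have h1 : ∀ i, (x i - h * k i) ^ 2 ≤ (h / 2) ^ 2 := fun i => by
    have := hx i
    apply sq_le_sq' <;> nlinarith [this.1, this.2]
  have h0 := h1 0
  have h1 := h1 1
  simp only [PiLp.sub_apply, PiLp.smul_apply, sitePoint, smul_eq_mul]
  nlinarith

theorem norm_sub_le_of_mem_squareCell {h : ℝ} (hh : 0 < h) {k : Site} {x y : Plane}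
    (hx : x ∈ squareCell h k) (hy : y ∈ squareCell h k) : ‖x - y‖ ≤ 2 * h := by
  have e : x - y = (x - h • sitePoint k) - (y - h • sitePoint k) := by abel
  rw [e]
  refine (norm_sub_le _ _).trans ?_
  linarith [norm_sub_sitePoint_le hh hx, norm_sub_sitePoint_le hh hy]

theorem supNorm_neg (u : Site) : supNorm (-u) = supNorm u := by simp [supNorm]

theorem follows_append {c : Site → Plane} {r : ℝ} {l l' : List (Site × Bool)} {a : Site × Bool}
    {i : Site} {z z₁ z₂ z' : Phase} {τ s τ' : ℝ} (h1 : Follows c r i z τ l z₁) (ha : a.1 ≠ 0)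
    (h2 : HitStep c r z₁ s (i + totalJump l + a.1) a.2 z₂)
    (h3 : Follows c r (i + totalJump l + a.1) z₂ τ' l' z') :
    Follows c r i z (τ + s + τ') (l ++ a :: l') z' := by
  induction l generalizing i z τ with
  | nil =>
    obtain ⟨rfl, rfl⟩ := h1
    rw [totalJump_nil, add_zero] at h2 h3
    refine ⟨ha, s, z₂, h2, ?_⟩
    rwa [show 0 + s + τ' - s = τ' by ring]
  | cons b l ih =>
    obtain ⟨hb, s', z₃, h4, h5⟩ := h1
    rw [totalJump_cons, ← add_assoc] at h2 h3
    refine ⟨hb, s', z₃, h4, ?_⟩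
    rw [show τ + s + τ' - s' = τ - s' + s + τ' by ring]
    exact ih h5 h2 h3

theorem totalJump_append (l l' : List (Site × Bool)) :
    totalJump (l ++ l') = totalJump l + totalJump l' := by simp [totalJump]

theorem pathWeight_append (h r κ : ℝ) (l l' : List (Site × Bool)) :
    pathWeight h r κ (l ++ l') = pathWeight h r κ l * pathWeight h r κ l' := by
  simp [pathWeight]

/-- The cutoff of the lattice sums. -/
noncomputable def range (h T : ℝ) : ℕ := ⌈3 * T / h⌉₊

theorem le_range {h T : ℝ} (hh : 0 < h) {n : ℕ} (hn : h * n ≤ 3 * T) : n ≤ range h T := by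
  have h1 : (n : ℝ) ≤ 3 * T / h := by rw [le_div_iff₀ hh]; linarith
  exact_mod_cast h1.trans (Nat.le_ceil _)

theorem jumpWeight_le {h κ : ℝ} (hh : 0 < h) (hκ : 0 ≤ κ) {N : ℕ} {u : Site}
    (hu : supNorm u ≤ N) : jumpWeight h (h ^ 2) κ u ≤ 16 * h * invNorm N u := by
  rw [invNorm_eq hu, jumpWeight]
  have h1 : Real.exp (-(κ * (h * supNorm u))) ≤ 1 := by
    rw [Real.exp_le_one_iff]
    have : 0 ≤ κ * (h * supNorm u) := by positivity
    linarith
  calc _ ≤ 16 * h ^ 2 / (h * supNorm u) * 1 := by gcongr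
    _ = _ := by rw [mul_one]; field_simp

namespace IsPerturbedLattice

variable {h R T : ℝ} {c : Site → Plane} (H : IsPerturbedLattice h (h ^ 2) R c)
include H

/-- A flight from the disc about a site to the obstacle of another site. -/
theorem flight_to_obstacle {i j : Site} (hij : i ≠ j) {x : Plane} {v : Velocity} {s : ℝ}
    (hs : 0 ≤ s) (hx : ‖x - h • sitePoint i‖ ≤ R) (hy : ‖x + s • (v : Plane) - c j‖ ≤ h ^ 2) :
    h * supNorm (j - i) ≤ 2 * s ∧ |cross v (h • sitePoint (j - i))| ≤ 2 * R := by
  have hu := sub_ne_zero.mpr hij.symm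
  have h1 := H.le_mul_supNorm hu
  have h2 := H.norm_smul_sitePoint (j - i)
  have hy' : ‖x + s • (v : Plane) - h • sitePoint j‖ ≤ R := by
    have e : x + s • (v : Plane) - h • sitePoint j =
      (x + s • (v : Plane) - c j) + (c j - h • sitePoint j) := by abel
    rw [e]
    exact (norm_add_le _ _).trans (by linarith [H.displacement j])
  have h3 := sub_le_of_flight v hs hx hy'
  have h4 := abs_cross_le_of_flight v hx hy'
  rw [← smul_sub, ← sitePoint_sub] at h3 h4
  refine ⟨by linarith [H.small, H.R_pos], by linarith⟩

/-- A flight from an obstacle to the disc about another site. -/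
theorem flight_from_obstacle {i j : Site} (hij : i ≠ j) {x : Plane} {v : Velocity} {s : ℝ}
    (hs : 0 ≤ s) (hx : ‖x - c j‖ ≤ h ^ 2)
    (hy : ‖x + s • (v : Plane) - h • sitePoint i‖ ≤ R) : h * supNorm (i - j) ≤ 2 * s := by
  have hu := sub_ne_zero.mpr hij
  have h1 := H.le_mul_supNorm hu
  have h2 := H.norm_smul_sitePoint (i - j)
  have hx' : ‖x - h • sitePoint j‖ ≤ R := by
    have e : x - h • sitePoint j = (x - c j) + (c j - h • sitePoint j) := by abel
    rw [e]
    exact (norm_add_le _ _).trans (by linarith [H.displacement j])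
  have h3 := sub_le_of_flight v hs hx' hy
  rw [← smul_sub, ← sitePoint_sub] at h3
  linarith [H.small, H.R_pos]

/-- The first obstacle that is hit lies in a strip. -/
theorem first_hit_mem_strip (hT : h ≤ T) {k j : Site} {x : Plane} {v : Velocity}
    {s : ℝ} (hs : s ≤ T) (hx : x ∈ squareCell h k) (hhit : IsHit c (h ^ 2) (x, v) s j) :
    |cross v (sitePoint (j - k))| ≤ 2 ∧ supNorm (j - k) ≤ range h T := by
  have hh := H.h_pos
  have hx' := norm_sub_sitePoint_le hh hx
  have hy : ‖x + s • (v : Plane) - h • sitePoint j‖ ≤ R := by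
    have e : x + s • (v : Plane) - h • sitePoint j =
      (x + s • (v : Plane) - c j) + (c j - h • sitePoint j) := by abel
    rw [e]
    refine (norm_add_le _ _).trans ?_
    have := hhit.2.1
    simp only at this
    linarith [H.displacement j]
  have h3 := sub_le_of_flight v hhit.1.le hx' hy
  have h4 := abs_cross_le_of_flight v hx' hy
  rw [← smul_sub, ← sitePoint_sub] at h3 h4
  have h2 := H.norm_smul_sitePoint (j - k)
  constructor
  · rw [cross_smul, abs_mul, abs_of_pos hh] at h4
    by_contra hcon
    rw [not_le] at hcon
    nlinarith [H.small, H.R_pos]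
  · exact le_range hh (by linarith [H.small, H.R_pos])

/-- If the flight from an obstacle to another one meets the disc about a site, then that site is
close to the line of the jump. -/
theorem inTube_of_flight {j u w : Site} {x : Plane} {v : Velocity} {s₁ s₂ : ℝ} (hs₁ : 0 ≤ s₁)
    (hs₂ : s₁ ≤ s₂) (hu : u ≠ 0) (hx : ‖x - c j‖ ≤ h ^ 2)
    (hi : ‖x + s₁ • (v : Plane) - h • sitePoint (j + u - w)‖ ≤ R)
    (hy : ‖x + s₂ • (v : Plane) - c (j + u)‖ ≤ h ^ 2) : InTube (R / h) u w := by
  have hh := H.h_pos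
  have hR := H.R_pos
  have hsmall := H.small
  have hx' : ‖x - h • sitePoint j‖ ≤ R := by
    have e : x - h • sitePoint j = (x - c j) + (c j - h • sitePoint j) := by abel
    rw [e]
    exact (norm_add_le _ _).trans (by linarith [H.displacement j])
  have hy' : ‖x + s₂ • (v : Plane) - h • sitePoint (j + u)‖ ≤ R := by
    have e : x + s₂ • (v : Plane) - h • sitePoint (j + u) =
      (x + s₂ • (v : Plane) - c (j + u)) + (c (j + u) - h • sitePoint (j + u)) := by abel
    rw [e]
    exact (norm_add_le _ _).trans (by linarith [H.displacement (j + u)])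
  have hy'' : ‖(x + s₁ • (v : Plane)) + (s₂ - s₁) • (v : Plane) - h • sitePoint (j + u)‖ ≤ R := by
    rwa [add_assoc, ← add_smul, add_sub_cancel]
  have p1 := sub_le_of_flight v (hs₁.trans hs₂) hx' hy'
  have p2 := abs_cross_le_of_flight v hx' hy'
  have p3 := norm_add_smul_sub_le v hx' hy'
  have q2 := abs_cross_le_of_flight v hi hy''
  have q3 := norm_add_smul_sub_le v hi hy''
  rw [← smul_sub, ← sitePoint_sub, add_sub_cancel_left] at p1 p2 p3
  rw [← smul_sub, ← sitePoint_sub, sub_sub_cancel] at q2 q3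
  set p := h • sitePoint u with hp
  set q := h • sitePoint w with hq
  have p4 : s₂ ≤ ‖p‖ + 2 * R := by
    have := norm_sub_norm_le (s₂ • (v : Plane)) p
    rw [norm_smul_velocity, abs_of_nonneg (hs₁.trans hs₂)] at this
    linarith
  have q4 : ‖q‖ ≤ s₂ + 2 * R := by
    have := norm_sub_norm_le q ((s₂ - s₁) • (v : Plane))
    rw [norm_smul_velocity, abs_of_nonneg (by linarith), norm_sub_rev q] at this
    linarith
  have hpu : ‖p‖ ≤ h * (3 / 2 * supNorm u) := by
    rw [hp, norm_smul, Real.norm_of_nonneg hh.le]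
    exact mul_le_mul_of_nonneg_left (norm_sitePoint_le u) hh.le
  have hup := H.norm_smul_sitePoint u
  have hwq := H.norm_smul_sitePoint w
  have hu1 := H.le_mul_supNorm hu
  -- The determinant in the orthonormal frame of `v`: both vectors have transversal component at
  -- most `2 * R`, so the parallelogram is thin.
  have hcr : cross p q = ⟪(v : Plane), p⟫ * cross v q - cross v p * ⟪(v : Plane), q⟫ := by
    rw [inner_eq, inner_eq]
    unfold cross
    linear_combination (-(p 0 * q 1 - p 1 * q 0)) * velocity_sq v
  have hsc : cross p q = h ^ 2 * siteCross u w := by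
    simp only [hp, hq, cross, siteCross, sitePoint, PiLp.smul_apply, smul_eq_mul]
    push_cast; ring
  have i1 : |⟪(v : Plane), p⟫| ≤ ‖p‖ := by
    have := abs_real_inner_le_norm (v : Plane) p
    rwa [norm_eq_of_mem_sphere, one_mul] at this
  have i2 : |⟪(v : Plane), q⟫| ≤ ‖q‖ := by
    have := abs_real_inner_le_norm (v : Plane) q
    rwa [norm_eq_of_mem_sphere, one_mul] at this
  constructor
  · have h1 : |cross p q| ≤ ‖p‖ * (2 * R) + (2 * R) * ‖q‖ := by
      rw [hcr]
      refine (abs_sub _ _).trans ?_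
      rw [abs_mul, abs_mul]
      gcongr <;> linarith
    rw [hsc, abs_mul, abs_of_pos (by positivity)] at h1
    have h2 : h ^ 2 * |(siteCross u w : ℝ)| ≤ h ^ 2 * (10 * (R / h) * supNorm u) := by
      have e : h ^ 2 * (10 * (R / h) * supNorm u) = 10 * R * (h * supNorm u) := by field_simp
      rw [e]
      nlinarith
    exact le_of_mul_le_mul_left h2 (by positivity)
  · have h1 : h * (supNorm w : ℝ) ≤ h * (2 * supNorm u) := by nlinarith
    exact_mod_cast le_of_mul_le_mul_left h1 hh

/-- The common factor in the bounds of areas. -/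
theorem volume_le_of_itinerary {k i j : Site} {σ : Bool} {l : List (Site × Bool)} {v : Velocity}
    {S : Set Plane}
    (hS : ∀ x ∈ S, x ∈ squareCell h k ∧ ∃ s₀ z₁ τ z s, HitStep c (h ^ 2) (x, v) s₀ j σ z₁ ∧
      Follows c (h ^ 2) j z₁ τ l z ∧ 0 ≤ s ∧
      ‖z.1 + s • (z.2 : Plane) - h • sitePoint i‖ ≤ R ∧ s₀ + τ + s ≤ T ∧ i ≠ j + totalJump l) :
    volume S ≤ ENNReal.ofReal (256 * h ^ 2 * R * Real.exp (2 * damping * T) *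
      (pathWeight h (h ^ 2) damping l * invNorm (range h T) (j + totalJump l - i))) := by
  have hh := H.h_pos
  have hR := H.R_pos
  have hW := pathWeight_nonneg (κ := damping) hh.le (sq_nonneg h) l
  refine (volume_le_of_thin v (A := 2 * h) (B := 2 * h ^ 2 * (Real.exp (2 * damping * T) *
    pathWeight h (h ^ 2) damping l * (16 * R / h * invNorm (range h T) (j + totalJump l - i))))
    (by positivity) ?_ ?_).trans (le_of_eq ?_)
  · intro x hx y hy
    exact norm_sub_le_of_mem_squareCell hh (hS x hx).1 (hS y hy).1
  · intro x hx y hy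
    obtain ⟨_, s₀, z₁, τ, z, s, h1, h2, h3, h4, h5, h6⟩ := hS x hx
    obtain ⟨_, t₀, w₁, τ', w, t, h1', h2', h3', h4', -, -⟩ := hS y hy
    refine (H.abs_cross_sub_le_of_itinerary (κ := damping) (by norm_num [damping]) h6 h1 h1' h2
      h2' h3 h3' h4 h4').trans ?_
    have hs : h * supNorm (i - (j + totalJump l)) ≤ 2 * s :=
      H.flight_from_obstacle h6 h3 (follows_norm_eq h1.norm_eq h2).le h4
    have hτ := follows_time_nonneg h2
    have hs₀ := h1.1.1
    have hN : supNorm (j + totalJump l - i) ≤ range h T := by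
      rw [← supNorm_neg, neg_sub]
      exact le_range hh (by linarith)
    rw [invNorm_eq hN, ← supNorm_neg (j + totalJump l - i), neg_sub, ← div_eq_mul_inv, div_div]
    have hexp : Real.exp (2 * damping * τ) ≤ Real.exp (2 * damping * T) := by
      rw [Real.exp_le_exp]; unfold damping; linarith
    gcongr
  · congr 1; field_simp; ring

end IsPerturbedLattice

/-! ### The measure of the set of loops in a cell -/

theorem tsum_mul_le {X : Type*} {f g : X → ℝ≥0∞} {F G : ℝ≥0∞} (hf : ∑' x, f x ≤ F)
    (hg : ∀ x, g x ≤ G) : ∑' x, f x * g x ≤ F * G := by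
  refine (ENNReal.tsum_le_tsum fun x => mul_le_mul_right (hg x) (f x)).trans ?_
  rw [ENNReal.tsum_mul_right]
  exact mul_le_mul_left hf G

theorem tsum_bool_le {g : Bool → ℝ≥0∞} {G : ℝ≥0∞} (hg : ∀ b, g b ≤ G) :
    ∑' b, g b ≤ 2 * G := by
  rw [tsum_bool, two_mul]; exact add_le_add (hg _) (hg _)

theorem measure_iUnion_le_of_le {α ι : Type*} [MeasurableSpace α] [Countable ι] {μ : Measure α}
    {S : ι → Set α} {F : ι → ℝ≥0∞} (h : ∀ i, μ (S i) ≤ F i) : μ (⋃ i, S i) ≤ ∑' i, F i :=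
  (measure_iUnion_le S).trans (ENNReal.tsum_le_tsum h)

open Classical in
/-- The indicator of a strip in the direction `v`. -/
noncomputable def stripIndicator (N : ℕ) (v : Velocity) (u : Site) : ℝ≥0∞ :=
  if |cross v (sitePoint u)| ≤ 2 ∧ supNorm u ≤ N then 1 else 0

theorem tsum_stripIndicator_le (v : Velocity) {N : ℕ} (hN : 1 ≤ N) (k : Site) :
    ∑' j, stripIndicator N v (j - k) ≤ 18 * N := by
  have := (Equiv.subRight k).tsum_eq (stripIndicator N v)
  simp only [Equiv.subRight_apply] at this
  rw [this]
  exact tsum_strip_le v hN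

open Classical in
/-- The summand for the pairs of almost the same direction. -/
noncomputable def tubeTerm (θ : ℝ) (N : ℕ) (W : Site → ℝ) (p : Site × Site) : ℝ≥0∞ :=
  if InTube θ p.1 p.2 then ENNReal.ofReal (invNorm N p.1 * W p.2) else 0

/-- The common factor in the bounds of areas. -/
noncomputable def areaFactor (h R T : ℝ) : ℝ := 256 * h ^ 2 * R * Real.exp (2 * damping * T)

namespace IsPerturbedLattice

variable {h R T : ℝ} {c : Site → Plane} (H : IsPerturbedLattice h (h ^ 2) R c)
include H

theorem areaFactor_nonneg : 0 ≤ areaFactor h R T := by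
  have := H.R_pos
  unfold areaFactor; positivity

theorem pathWeight_nonneg' (l : List (Site × Bool)) : 0 ≤ pathWeight h (h ^ 2) damping l :=
  pathWeight_nonneg H.h_pos.le (sq_nonneg h) l

open Classical in
-- An empty set needs no bound, and a single point already forces the constraints on `j`, `w` and
-- `v`; so their indicators can be inserted. The condition on `v` is kept for the later integration.
theorem volume_firstFlightLoop_le (hT : h ≤ T) (v : Velocity) (k j : Site) (σ : Bool)
    (l : List (Site × Bool)) (w : Site) :
    volume {x | x ∈ squareCell h k ∧ FirstFlightLoop c h (h ^ 2) R T (x, v) (j - w) j σ l} ≤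
      stripIndicator (range h T) v (j - k) * (ENNReal.ofReal (pathWeight h (h ^ 2) damping l) *
        (({v : Velocity | |cross v (h • sitePoint w)| ≤ 2 * R}.indicator (fun _ =>
          ENNReal.ofReal (areaFactor h R T *
            (cutoff (range h T) w * invNorm (range h T) (w + totalJump l)))) v))) := by
  set S := {x | x ∈ squareCell h k ∧ FirstFlightLoop c h (h ^ 2) R T (x, v) (j - w) j σ l} with hS
  rcases S.eq_empty_or_nonempty with he | ⟨x, hx⟩
  · rw [he]; simp
  have hW := H.pathWeight_nonneg' l
  have hA := H.areaFactor_nonneg (T := T)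
  obtain ⟨hxk, s₀, s₁, z₁, τ, z', s, h1, h2, h3, h4, h5, h6, h7, h8, h9, h10⟩ := hx
  have hτ := follows_time_nonneg h5
  have hstrip := H.first_hit_mem_strip hT (by linarith) hxk h1.1
  have hfl := H.flight_to_obstacle (x := x + s₁ • (v : Plane)) (v := v) (s := s₀ - s₁) h9
    (by linarith) h4 (by
      rw [add_assoc, ← add_smul, add_sub_cancel]; exact h1.1.2.1.le)
  rw [sub_sub_cancel] at hfl
  have hw : w ≠ 0 := by rintro rfl; simp at h9
  have hwN : supNorm w ≤ range h T := le_range H.h_pos (by linarith)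
  rw [stripIndicator, if_pos hstrip, one_mul, Set.indicator_of_mem (by exact hfl.2),
    cutoff_eq_one hw hwN, one_mul, ← ENNReal.ofReal_mul hW]
  refine (H.volume_le_of_itinerary (k := k) (i := j - w) (j := j) (σ := σ) (l := l) (v := v)
    (T := T) ?_).trans (ENNReal.ofReal_le_ofReal (le_of_eq ?_))
  · rintro y ⟨hyk, s₀, s₁, z₁, τ, z', s, h1, h2, h3, h4, h5, h6, h7, h8, h9, h10⟩
    exact ⟨hyk, s₀, z₁, τ, z', s, h1, h5, h6, h7, h8, h10⟩
  · rw [areaFactor, show j + totalJump l - (j - w) = w + totalJump l by abel]; ring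

/-- The geometric constraints on the jump during which the disc is met. -/
theorem laterLoop_constraints (hT : h ≤ T) {v : Velocity} {k j : Site} {σ : Bool}
    {l l' : List (Site × Bool)} {a : Site × Bool} {w : Site} {x : Plane}
    (hxk : x ∈ squareCell h k)
    (hx : LaterLoop c h (h ^ 2) R T (x, v) (j + totalJump l + a.1 - w) j σ l a l') :
    (|cross v (sitePoint (j - k))| ≤ 2 ∧ supNorm (j - k) ≤ range h T) ∧
      InTube (R / h) a.1 w ∧ w ≠ 0 ∧ supNorm w ≤ range h T ∧ supNorm a.1 ≤ range h T ∧
      ∀ b ∈ l'.head?, supNorm b.1 ≤ range h T := by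
  obtain ⟨s₀, z₁, τ, z₂, s₁, s₂, z₃, τ', z', s, h1, h2, h3, h4, h5, h6, h7, h8, h9, h10, h11,
    h12, h13⟩ := hx
  have hτ := follows_time_nonneg h2
  have hτ' := follows_time_nonneg h8
  have hs₀ := h1.1.1
  have hz₂ := follows_norm_eq h1.norm_eq h2
  have hfl := H.flight_to_obstacle (x := z₂.1 + s₁ • (z₂.2 : Plane)) (v := z₂.2) (s := s₂ - s₁)
    h12 (by linarith) h7 (by
      rw [add_assoc, ← add_smul, add_sub_cancel]; exact h3.1.2.1.le)
  rw [sub_sub_cancel] at hfl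
  have hw : w ≠ 0 := by rintro rfl; simp at h12
  have ha := H.supNorm_le_of_hit (by simpa using h4) hz₂ h3.1
  rw [add_sub_cancel_left] at ha
  refine ⟨H.first_hit_mem_strip hT (by linarith) hxk h1.1,
    H.inTube_of_flight h5 h6 h4 hz₂.le h7 h3.1.2.1.le, hw, le_range H.h_pos (by linarith),
    le_range H.h_pos (by linarith), ?_⟩
  intro b hb
  cases l' with
  | nil => simp at hb
  | cons b' l' =>
    simp only [List.head?_cons, Option.mem_def, Option.some.injEq] at hb
    subst hb
    obtain ⟨hb, s', z₄, h14, h15⟩ := h8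
    have hs' := H.supNorm_le_of_hit (by simpa using hb) h3.norm_eq h14.1
    rw [add_sub_cancel_left] at hs'
    exact le_range H.h_pos (by linarith [follows_time_nonneg h15])

theorem volume_laterLoop_le (v : Velocity) (k j : Site) (σ : Bool)
    (l : List (Site × Bool)) (a : Site × Bool) (l' : List (Site × Bool)) (w : Site) :
    volume {x | x ∈ squareCell h k ∧
      LaterLoop c h (h ^ 2) R T (x, v) (j + totalJump l + a.1 - w) j σ l a l'} ≤
      ENNReal.ofReal (areaFactor h R T * (pathWeight h (h ^ 2) damping (l ++ a :: l') *
        invNorm (range h T) (w + totalJump l'))) := by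
  refine (H.volume_le_of_itinerary (k := k) (i := j + totalJump l + a.1 - w) (j := j) (σ := σ)
    (l := l ++ a :: l') (v := v) (T := T) ?_).trans (ENNReal.ofReal_le_ofReal (le_of_eq ?_))
  · rintro x ⟨hxk, s₀, z₁, τ, z₂, s₁, s₂, z₃, τ', z', s, h1, h2, h3, h4, h5, h6, h7, h8, h9, h10,
      h11, h12, h13⟩
    refine ⟨hxk, s₀, z₁, _, z', s, h1, follows_append h2 h4 h3 h8, h9, h10, by linarith, ?_⟩
    rwa [totalJump_append, totalJump_cons, ← add_assoc, ← add_assoc]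
  · rw [areaFactor, totalJump_append, totalJump_cons]
    congr 3
    abel

/-- The jump during which the disc is met is taken out of the product of weights, with its damping
dropped, and summed together with `w` over the tube. -/
theorem volume_laterLoop_nil_le (hT : h ≤ T) (v : Velocity) (k j : Site) (σ : Bool)
    (l : List (Site × Bool)) (σ' : Bool) (p : Site × Site) :
    volume {x | x ∈ squareCell h k ∧
      LaterLoop c h (h ^ 2) R T (x, v) (j + totalJump l + p.1 - p.2) j σ l (p.1, σ') []} ≤
      stripIndicator (range h T) v (j - k) * (ENNReal.ofReal (pathWeight h (h ^ 2) damping l) *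
        (tubeTerm (R / h) (range h T) (invNorm (range h T)) p *
          ENNReal.ofReal (areaFactor h R T * (16 * h)))) := by
  set S := {x | x ∈ squareCell h k ∧
    LaterLoop c h (h ^ 2) R T (x, v) (j + totalJump l + p.1 - p.2) j σ l (p.1, σ') []} with hS
  rcases S.eq_empty_or_nonempty with he | ⟨x, hx⟩
  · rw [he]; simp
  have hW := H.pathWeight_nonneg' l
  have hA := H.areaFactor_nonneg (T := T)
  obtain ⟨c1, c2, c3, c4, c5, -⟩ := H.laterLoop_constraints hT hx.1 hx.2
  have hI := invNorm_nonneg (range h T)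
  refine (H.volume_laterLoop_le v k j σ l (p.1, σ') [] p.2).trans ?_
  rw [stripIndicator, if_pos c1, one_mul, tubeTerm, if_pos c2,
    ← ENNReal.ofReal_mul (mul_nonneg (hI _) (hI _)), ← ENNReal.ofReal_mul hW]
  apply ENNReal.ofReal_le_ofReal
  rw [pathWeight_append, pathWeight_cons, pathWeight_nil, totalJump_nil, add_zero, mul_one]
  have hj := jumpWeight_le (κ := damping) H.h_pos (by norm_num [damping]) c5
  calc _ ≤ areaFactor h R T * (pathWeight h (h ^ 2) damping l *
        (16 * h * invNorm (range h T) p.1) * invNorm (range h T) p.2) := by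
        have := hI p.2
        gcongr
    _ = _ := by ring

/-- The jump `b` is taken out as well. Together with the return flight it gives a sum over `b` that
is logarithmic uniformly in `w` and `l'`, and its extra factor `h` offsets the `N` of the tube sum.
-/
theorem volume_laterLoop_cons_le (hT : h ≤ T) (v : Velocity) (k j : Site) (σ : Bool)
    (l : List (Site × Bool)) (σ' : Bool) (p : Site × Site) (l' : List (Site × Bool)) (σ'' : Bool)
    (b : Site) :
    volume {x | x ∈ squareCell h k ∧ LaterLoop c h (h ^ 2) R T (x, v)
      (j + totalJump l + p.1 - p.2) j σ l (p.1, σ') ((b, σ'') :: l')} ≤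
      stripIndicator (range h T) v (j - k) * (ENNReal.ofReal (pathWeight h (h ^ 2) damping l) *
        (tubeTerm (R / h) (range h T) (cutoff (range h T)) p *
          (ENNReal.ofReal (pathWeight h (h ^ 2) damping l') *
            (ENNReal.ofReal (invNorm (range h T) b *
              invNorm (range h T) (b + (p.2 + totalJump l'))) *
              ENNReal.ofReal (areaFactor h R T * (16 * h) ^ 2))))) := by
  set S := {x | x ∈ squareCell h k ∧ LaterLoop c h (h ^ 2) R T (x, v)
      (j + totalJump l + p.1 - p.2) j σ l (p.1, σ') ((b, σ'') :: l')} with hS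
  rcases S.eq_empty_or_nonempty with he | ⟨x, hx⟩
  · rw [he]; simp
  have hW := H.pathWeight_nonneg' l
  have hW' := H.pathWeight_nonneg' l'
  have hA := H.areaFactor_nonneg (T := T)
  have hh := H.h_pos
  obtain ⟨c1, c2, c3, c4, c5, c6⟩ := H.laterLoop_constraints hT hx.1 hx.2
  have c6 := c6 (b, σ'') (by simp)
  have hI := invNorm_nonneg (range h T)
  refine (H.volume_laterLoop_le v k j σ l (p.1, σ') ((b, σ'') :: l') p.2).trans ?_
  rw [stripIndicator, if_pos c1, one_mul, tubeTerm, if_pos c2, cutoff_eq_one c3 c4, mul_one,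
    ← ENNReal.ofReal_mul (mul_nonneg (hI _) (hI _)), ← ENNReal.ofReal_mul hW',
    ← ENNReal.ofReal_mul (hI _), ← ENNReal.ofReal_mul hW]
  apply ENNReal.ofReal_le_ofReal
  rw [pathWeight_append, pathWeight_cons, pathWeight_cons, totalJump_cons]
  have hj := jumpWeight_le (κ := damping) H.h_pos (by norm_num [damping]) c5
  have hj' := jumpWeight_le (κ := damping) H.h_pos (by norm_num [damping]) c6
  have hj0 := jumpWeight_nonneg (κ := damping) hh.le (sq_nonneg h) b
  have e : p.2 + (b + totalJump l') = b + (p.2 + totalJump l') := by abel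
  simp only [e]
  calc _ ≤ areaFactor h R T * (pathWeight h (h ^ 2) damping l *
        ((16 * h * invNorm (range h T) p.1) * ((16 * h * invNorm (range h T) b) *
          pathWeight h (h ^ 2) damping l')) *
          invNorm (range h T) (b + (p.2 + totalJump l'))) := by
        have := hI (b + (p.2 + totalJump l'))
        have := hI p.1
        gcongr
    _ = _ := by ring

/-- The part of the bound that depends on the velocity. -/
noncomputable def firstFlightSum (h R T : ℝ) (v : Velocity) : ℝ≥0∞ :=
  ∑' (l : List (Site × Bool)) (w : Site), ENNReal.ofReal (pathWeight h (h ^ 2) damping l) *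
    (({v : Velocity | |cross v (h • sitePoint w)| ≤ 2 * R}.indicator (fun _ =>
      ENNReal.ofReal (areaFactor h R T *
        (cutoff (range h T) w * invNorm (range h T) (w + totalJump l)))) v))

/-- The part of the bound that does not depend on the velocity. -/
noncomputable def laterSum (h R T : ℝ) : ℝ≥0∞ :=
  18 * (range h T : ℝ≥0∞) * (2 * (2 * (2 * (ENNReal.ofReal (5120 * (R / h) * range h T *
    logFactor (range h T) + 32 * logFactor (range h T) ^ 3) *
      ENNReal.ofReal (areaFactor h R T * (16 * h)))))) +
  18 * (range h T : ℝ≥0∞) * (2 * (2 * (2 * (ENNReal.ofReal (range h T * (5120 * (R / h) *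
    range h T + 32 * logFactor (range h T) ^ 3)) *
      (2 * (2 * (ENNReal.ofReal (8 * logFactor (range h T)) *
        ENNReal.ofReal (areaFactor h R T * (16 * h) ^ 2))))))))

/-- Union bound over itineraries. Each inner sum is bounded uniformly in the outer indices, so the
total is a product. -/
theorem volume_section_le (hT : h ≤ T) (v : Velocity) (k : Site) :
    volume {x | x ∈ squareCell h k ∧ MakesLoop c h (h ^ 2) R T (x, v)} ≤
      18 * (range h T : ℝ≥0∞) * (2 * firstFlightSum h R T v) + laterSum h R T := by
  have hh := H.h_pos
  have hθ : 0 ≤ R / h := div_nonneg H.R_pos.le hh.le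
  have hN : 1 ≤ range h T := le_range hh (by push_cast; linarith)
  have hstrip := tsum_stripIndicator_le v hN k
  have hpath := tsum_pathWeight_le hh
  have hsub : {x | x ∈ squareCell h k ∧ MakesLoop c h (h ^ 2) R T (x, v)} ⊆
      (⋃ (j : Site) (σ : Bool) (l : List (Site × Bool)) (w : Site), {x | x ∈ squareCell h k ∧
        FirstFlightLoop c h (h ^ 2) R T (x, v) (j - w) j σ l}) ∪
      ((⋃ (j : Site) (σ : Bool) (l : List (Site × Bool)) (σ' : Bool) (p : Site × Site),
        {x | x ∈ squareCell h k ∧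
        LaterLoop c h (h ^ 2) R T (x, v) (j + totalJump l + p.1 - p.2) j σ l (p.1, σ') []}) ∪
      ⋃ (j : Site) (σ : Bool) (l : List (Site × Bool)) (σ' : Bool) (p : Site × Site)
        (l' : List (Site × Bool)) (σ'' : Bool) (b : Site),
        {x | x ∈ squareCell h k ∧ LaterLoop c h (h ^ 2) R T (x, v)
          (j + totalJump l + p.1 - p.2) j σ l (p.1, σ') ((b, σ'') :: l')}) := by
    rintro x ⟨hxk, hx⟩
    rcases (H.exists_loop_of_makesLoop hx).2 with ⟨i, j, σ, l, hl⟩ | ⟨i, j, σ, l, a, l', hl⟩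
    · left
      simp only [Set.mem_iUnion]
      exact ⟨j, σ, l, j - i, hxk, by rwa [sub_sub_cancel]⟩
    · right
      have e : j + totalJump l + a.1 - (j + totalJump l + a.1 - i) = i := by abel
      cases l' with
      | nil =>
        left
        simp only [Set.mem_iUnion]
        exact ⟨j, σ, l, a.2, (a.1, j + totalJump l + a.1 - i), hxk, by simpa only [e] using hl⟩
      | cons b l' =>
        right
        simp only [Set.mem_iUnion]
        exact ⟨j, σ, l, a.2, (a.1, j + totalJump l + a.1 - i), l', b.2, b.1, hxk,
          by simpa only [e] using hl⟩
  refine (measure_mono hsub).trans ((measure_union_le _ _).trans (add_le_add ?_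
    ((measure_union_le _ _).trans (add_le_add ?_ ?_))))
  · refine (measure_iUnion_le_of_le fun j => measure_iUnion_le_of_le fun σ =>
      measure_iUnion_le_of_le fun l => measure_iUnion_le_of_le fun w =>
        H.volume_firstFlightLoop_le hT v k j σ l w).trans ?_
    simp only [ENNReal.tsum_mul_left (a := stripIndicator _ _ _)]
    exact tsum_mul_le hstrip fun j => tsum_bool_le fun σ => le_rfl
  · refine (measure_iUnion_le_of_le fun j => measure_iUnion_le_of_le fun σ =>
      measure_iUnion_le_of_le fun l => measure_iUnion_le_of_le fun σ' =>
        measure_iUnion_le_of_le fun p => H.volume_laterLoop_nil_le hT v k j σ l σ' p).trans ?_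
    simp only [ENNReal.tsum_mul_left]
    refine tsum_mul_le hstrip fun j => tsum_bool_le fun σ => tsum_mul_le hpath fun l =>
      tsum_bool_le fun σ' => ?_
    rw [ENNReal.tsum_mul_right]
    exact mul_le_mul_left (tsum_inTube_inv_le hθ _) _
  · refine (measure_iUnion_le_of_le fun j => measure_iUnion_le_of_le fun σ =>
      measure_iUnion_le_of_le fun l => measure_iUnion_le_of_le fun σ' =>
        measure_iUnion_le_of_le fun p => measure_iUnion_le_of_le fun l' =>
          measure_iUnion_le_of_le fun σ'' => measure_iUnion_le_of_le fun b =>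
            H.volume_laterLoop_cons_le hT v k j σ l σ' p l' σ'' b).trans ?_
    simp only [ENNReal.tsum_mul_left]
    refine tsum_mul_le hstrip fun j => tsum_bool_le fun σ => tsum_mul_le hpath fun l =>
      tsum_bool_le fun σ' => tsum_mul_le (tsum_inTube_cutoff_le hθ _) fun p =>
        tsum_mul_le hpath fun l' => tsum_bool_le fun σ'' => ?_
    rw [ENNReal.tsum_mul_right]
    exact mul_le_mul_left (tsum_invNorm_mul_le _ _) _

/-- The average over velocities gains `16 * R / (h * supNorm w)`, which turns `cutoff` into
`invNorm` and makes the sum over `w` logarithmic. -/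
theorem lintegral_firstFlightSum_le :
    ∫⁻ v, firstFlightSum h R T v ∂velocityMeasure ≤
      2 * ENNReal.ofReal (areaFactor h R T * (16 * (R / h)) *
        (8 * logFactor (range h T))) := by
  have hh := H.h_pos
  have hR := H.R_pos
  have hA := H.areaFactor_nonneg (T := T)
  unfold firstFlightSum
  have hm : ∀ (l : List (Site × Bool)) (w : Site), Measurable fun v : Velocity =>
      ENNReal.ofReal (pathWeight h (h ^ 2) damping l) *
      (({v : Velocity | |cross v (h • sitePoint w)| ≤ 2 * R}.indicator (fun _ =>
      ENNReal.ofReal (areaFactor h R T *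
        (cutoff (range h T) w * invNorm (range h T) (w + totalJump l)))) v)) := fun l w =>
    (measurable_const.indicator (measurableSet_abs_cross_le _ _)).const_mul _
  rw [lintegral_tsum fun l => (Measurable.tsum fun w => hm l w).aemeasurable]
  simp only [lintegral_tsum fun w => (hm _ w).aemeasurable]
  simp only [lintegral_const_mul' _ _ ENNReal.ofReal_ne_top,
    lintegral_indicator_const (measurableSet_abs_cross_le _ _), ENNReal.tsum_mul_left]
  refine tsum_mul_le (tsum_pathWeight_le hh) fun l => ?_
  have key : ∀ w, ENNReal.ofReal (areaFactor h R T *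
      (cutoff (range h T) w * invNorm (range h T) (w + totalJump l))) *
      velocityMeasure {v : Velocity | |cross v (h • sitePoint w)| ≤ 2 * R} ≤
      ENNReal.ofReal (areaFactor h R T * (16 * (R / h))) *
        ENNReal.ofReal (invNorm (range h T) w * invNorm (range h T) (w + totalJump l)) := by
    intro w
    have hI := invNorm_nonneg (range h T)
    rcases eq_or_ne w 0 with rfl | hw
    · simp [cutoff, supNorm]
    have hp := H.norm_smul_sitePoint w
    have hp1 := H.le_mul_supNorm hw
    have hw1 := one_le_supNorm hw
    have hp0 : h • sitePoint w ≠ 0 := norm_pos_iff.mp (by linarith)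
    refine (mul_le_mul_right (velocityMeasure_le hp0 (2 * R)) _).trans ?_
    rw [← ENNReal.ofReal_mul (mul_nonneg hA (mul_nonneg (cutoff_nonneg _ _) (hI _))),
      ← ENNReal.ofReal_mul (by positivity)]
    apply ENNReal.ofReal_le_ofReal
    have h1 : 8 * (2 * R) / ‖h • sitePoint w‖ ≤ 8 * (2 * R) / (h * supNorm w) := by
      gcongr
    have hc := cutoff_nonneg (range h T) w
    have hI' := hI (w + totalJump l)
    calc _ ≤ areaFactor h R T * (cutoff (range h T) w * invNorm (range h T) (w + totalJump l)) *
          (8 * (2 * R) / (h * supNorm w)) := by gcongr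
      _ = _ := by unfold cutoff; field_simp; ring
  refine (ENNReal.tsum_le_tsum key).trans ?_
  rw [ENNReal.tsum_mul_left, ENNReal.ofReal_mul (p := areaFactor h R T * (16 * (R / h)))
    (by positivity)]
  exact mul_le_mul_right (tsum_invNorm_mul_le _ _) _

/-- The measure of the set of the starting points in a cell which lead to a loop. -/
theorem phaseMeasure_le (hT : h ≤ T) (k : Site) :
    phaseMeasure ({z | MakesLoop c h (h ^ 2) R T z} ∩ squareCell h k ×ˢ Set.univ) ≤
      18 * (range h T : ℝ≥0∞) * (2 * (2 * ENNReal.ofReal (areaFactor h R T * (16 * (R / h)) *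
        (8 * logFactor (range h T))))) + laterSum h R T * ENNReal.ofReal (2 * Real.pi) := by
  have hmeas : MeasurableSet ({z | MakesLoop c h (h ^ 2) R T z} ∩
      squareCell h k ×ˢ (Set.univ : Set Velocity)) :=
    (measurableSet_makesLoop (c := fun _ : Phase => c) (z := id) (fun _ => H) H.r_pos
      (fun _ => measurable_const) measurable_id T).inter ((measurableSet_squareCell h k).prod MeasurableSet.univ)
  rw [phaseMeasure, Measure.prod_apply_symm hmeas]
  calc _ ≤ ∫⁻ v, (18 * (range h T : ℝ≥0∞) * (2 * firstFlightSum h R T v) + laterSum h R T)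
        ∂velocityMeasure := by
        apply lintegral_mono
        intro v
        refine le_trans (measure_mono ?_) (H.volume_section_le hT v k)
        rintro x ⟨h1, h2⟩
        exact ⟨h2.1, h1⟩
    _ = 18 * (range h T : ℝ≥0∞) * (2 * ∫⁻ v, firstFlightSum h R T v ∂velocityMeasure) +
        laterSum h R T * ENNReal.ofReal (2 * Real.pi) := by
        rw [lintegral_add_right _ measurable_const, lintegral_const, velocityMeasure_univ,
          lintegral_const_mul' _ _ (ENNReal.mul_ne_top (by norm_num) (ENNReal.natCast_ne_top _)),
          lintegral_const_mul' _ _ (by norm_num)]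
    _ ≤ _ := by
        gcongr
        exact H.lintegral_firstFlightSum_le

end IsPerturbedLattice

/-! ### Explicit constants -/

theorem logFactor_range_le {h T : ℝ} (hh : 0 < h) (hT : 3 / 2 * h ≤ T) :
    logFactor (range h T) ≤ 13 * Real.log (T / h) := by
  have hX : 3 / 2 ≤ T / h := (le_div_iff₀ hh).mpr hT
  have hN : (range h T : ℝ) ≤ 4 * (T / h) := by
    have := (Nat.ceil_lt_add_one (a := 3 * T / h) (by rw [mul_div_assoc]; linarith)).le
    rw [mul_div_assoc] at this
    unfold range
    rw [mul_div_assoc]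
    linarith
  have hN0 : 0 < (range h T : ℝ) := by
    have : 3 * T / h ≤ range h T := Nat.le_ceil _
    rw [mul_div_assoc] at this
    linarith
  have h1 := Real.log_le_log hN0 hN
  rw [Real.log_mul (by norm_num) (by linarith)] at h1
  have h2 : Real.log 4 ≤ 3 := (Real.log_le_sub_one_of_pos (by norm_num)).trans (by norm_num)
  -- The minimal duration of a loop keeps the logarithm away from zero, so it absorbs the additive
  -- constants.
  have h3 : 1 / 3 ≤ Real.log (T / h) := by
    refine le_trans ?_ (Real.one_sub_inv_le_log_of_pos (by linarith))
    have : (T / h)⁻¹ ≤ (3 / 2)⁻¹ := by gcongr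
    norm_num at this ⊢
    linarith
  unfold logFactor
  linarith

/-- Applied with `γ = 2ν - 1`, positive because `ν > 1/2`: then `h ^ (1 - γ) = ε ^ (1 - ν)`, so the
cubed logarithm of the collinear pairs is as small as the contribution of the tubes. Each logarithm
is bounded by a power `γ / 3`. -/
theorem logFactor_range_pow_three_le {γ h T : ℝ} (hγ : 0 < γ) (hγ' : γ ≤ 1) (hh : 0 < h)
    (hT : 3 / 2 * h ≤ T) :
    h * logFactor (range h T) ^ 3 ≤ (39 / γ) ^ 3 * (1 + T) * h ^ (1 - γ) := by
  have hT0 : 0 < T := by linarith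
  have hX : 0 < T / h := by positivity
  have h1 := Real.log_le_rpow_div hX.le (ε := γ / 3) (by positivity)
  have h2 : logFactor (range h T) ≤ 39 / γ * (T / h) ^ (γ / 3) := by
    refine (logFactor_range_le hh hT).trans ?_
    calc _ ≤ 13 * ((T / h) ^ (γ / 3) / (γ / 3)) := by gcongr
      _ = _ := by field_simp; ring
  have h0 : 0 ≤ logFactor (range h T) := by
    have : 0 ≤ Real.log (range h T) := Real.log_natCast_nonneg _
    unfold logFactor; linarith
  have h3 : T ^ γ ≤ 1 + T := by
    rcases le_total T 1 with h | h
    · linarith [Real.rpow_le_one hT0.le h hγ.le]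
    · linarith [Real.rpow_le_self_of_one_le h hγ']
  calc _ ≤ h * (39 / γ * (T / h) ^ (γ / 3)) ^ 3 := by gcongr
    _ = (39 / γ) ^ 3 * (T ^ γ * h ^ (1 - γ)) := by
      rw [mul_pow, ← Real.rpow_natCast (_ ^ (γ / 3)), ← Real.rpow_mul hX.le,
        Real.div_rpow hT0.le hh.le, Real.rpow_sub hh, Real.rpow_one]
      push_cast
      rw [div_mul_cancel₀ _ (by norm_num)]
      ring
    _ ≤ (39 / γ) ^ 3 * ((1 + T) * h ^ (1 - γ)) := by gcongr
    _ = _ := by ring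

/-- The constant in the bound on the fraction of the starting points which lead to a loop. -/
noncomputable def loopConstant (K : ℝ) : ℝ := 10 ^ 20 * (1 + K)

/-- Every cutoff `N` is paired with a factor `h` into `u ≤ 4 * T`. One factor `T` is kept; the other
powers of `T` are absorbed in `exp (2 * T)`. -/
theorem real_bound {h δ θ u L E K T : ℝ} {N : ℕ} (hh : 0 < h) (hδ : 0 ≤ δ) (hθ : 0 ≤ θ)
    (hθδ : θ ≤ 2 * δ) (hu : N * h = u) (huT : u ≤ 4 * T) (hL : 1 ≤ L) (hE : 0 ≤ E) (hK : 0 ≤ K)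
    (hT : 0 ≤ T) (hL3 : h * L ^ 3 ≤ K * (1 + T) * δ) :
    72 * N * (256 * h ^ 2 * (h * θ) * E * (16 * θ) * (8 * L)) +
      (144 * N * ((5120 * θ * N * L + 32 * L ^ 3) * (256 * h ^ 2 * (h * θ) * E * (16 * h))) +
       576 * N * (N * (5120 * θ * N + 32 * L ^ 3) * ((8 * L) *
        (256 * h ^ 2 * (h * θ) * E * (16 * h) ^ 2)))) * (2 * Real.pi) ≤
      loopConstant K * (T * (E * Real.exp (2 * T)) * L * δ ^ 2) * h ^ 2 := by
  have hu0 : 0 ≤ u := hu ▸ by positivity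
  have hL0 : 0 ≤ L := by linarith
  have hπ := Real.pi_le_four
  have hπ0 := Real.pi_pos
  have e1 : 1 + T ≤ Real.exp T := by linarith [Real.add_one_le_exp T]
  have hexp : Real.exp (2 * T) = Real.exp T ^ 2 := by rw [two_mul, Real.exp_add, sq]
  set e := Real.exp T
  have he : 1 ≤ e := by linarith
  have hKδ : 0 ≤ K * (1 + T) * δ := by positivity
  have hLL : h * L ^ 3 ≤ K * (1 + T) * δ * L := hL3.trans (le_mul_of_one_le_right hKδ hL)
  have hue : u ≤ 4 * e := by linarith
  have b1 : 5120 * θ * u * L + 32 * (h * L ^ 3) ≤ (40960 + 32 * K) * e * δ * L := by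
    calc _ ≤ 5120 * (2 * δ) * (4 * e) * L + 32 * (K * e * δ * L) := by
          refine add_le_add (by gcongr) (mul_le_mul_of_nonneg_left (hLL.trans ?_) (by norm_num))
          gcongr
      _ = _ := by ring
  have b2 : 5120 * θ * u + 32 * (h * L ^ 3) ≤ (40960 + 32 * K) * e * δ := by
    calc _ ≤ 5120 * (2 * δ) * (4 * e) + 32 * (K * e * δ) := by
          refine add_le_add (by gcongr) (mul_le_mul_of_nonneg_left (hL3.trans ?_) (by norm_num))
          gcongr
      _ = _ := by ring
  have e2 : e ≤ e ^ 2 := by nlinarith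
  calc _ = h ^ 2 * E * u * (72 * 256 * 128 * L * θ ^ 2 +
          (144 * 256 * 16 * (θ * (5120 * θ * u * L + 32 * (h * L ^ 3))) +
          576 * 8 * 256 * 256 * (u * (θ * (L * (5120 * θ * u + 32 * (h * L ^ 3)))))) *
          (2 * Real.pi)) := by rw [← hu]; ring
    _ ≤ h ^ 2 * E * (4 * T) * (72 * 256 * 128 * L * (2 * δ) ^ 2 +
          (144 * 256 * 16 * ((2 * δ) * ((40960 + 32 * K) * e * δ * L)) +
          576 * 8 * 256 * 256 * ((4 * e) * ((2 * δ) * (L * ((40960 + 32 * K) * e * δ))))) *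
          (2 * 4)) := by gcongr
    _ = h ^ 2 * E * (4 * T) * L * δ ^ 2 * (72 * 256 * 128 * 4 +
          (144 * 256 * 16 * 2 * (40960 + 32 * K) * e +
          576 * 8 * 256 * 256 * 8 * (40960 + 32 * K) * e ^ 2) * 8) := by ring
    _ ≤ h ^ 2 * E * (4 * T) * L * δ ^ 2 * (72 * 256 * 128 * 4 * e ^ 2 +
          (144 * 256 * 16 * 2 * (40960 + 32 * K) * e ^ 2 +
          576 * 8 * 256 * 256 * 8 * (40960 + 32 * K) * e ^ 2) * 8) := by
        gcongr ?_ * (?_ + (?_ + _) * 8)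
        · exact le_mul_of_one_le_right (by norm_num) (he.trans e2)
        · gcongr
    _ = h ^ 2 * (T * (E * e ^ 2) * L * δ ^ 2) * (4 * (72 * 256 * 128 * 4 +
          (144 * 256 * 16 * 2 * (40960 + 32 * K) +
          576 * 8 * 256 * 256 * 8 * (40960 + 32 * K)) * 8)) := by ring
    _ ≤ h ^ 2 * (T * (E * e ^ 2) * L * δ ^ 2) * loopConstant K := by
        gcongr
        unfold loopConstant
        linarith
    _ = _ := by rw [hexp]; ring

namespace IsPerturbedLattice

variable {h R T : ℝ} {c : Site → Plane}

theorem phaseMeasure_le_ofReal (H : IsPerturbedLattice h (h ^ 2) R c) {γ : ℝ} (hγ : 0 < γ)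
    (hγ' : γ ≤ 1) (hR : R ≤ h * (2 * h ^ (1 - γ))) (hT : 3 / 2 * h ≤ T) (k : Site) :
    phaseMeasure ({z | MakesLoop c h (h ^ 2) R T z} ∩ squareCell h k ×ˢ Set.univ) ≤
      ENNReal.ofReal (loopConstant ((39 / γ) ^ 3) * (T * Real.exp (1026 * T) *
        logFactor (range h T) * (h ^ (1 - γ)) ^ 2) * h ^ 2) := by
  have hh := H.h_pos
  have hR0 := H.R_pos
  have hT0 : 0 < T := by linarith
  have hL := one_le_logFactor (range h T)
  have hL0 : 0 ≤ logFactor (range h T) := by linarith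
  have hA := H.areaFactor_nonneg (T := T)
  have hθ : 0 ≤ R / h := by positivity
  have hN : (range h T : ℝ) * h ≤ 4 * T := by
    have := (Nat.ceil_lt_add_one (a := 3 * T / h) (by positivity)).le
    have h2 : (range h T : ℝ) * h ≤ (3 * T / h + 1) * h := by unfold range; gcongr
    rw [add_mul, div_mul_cancel₀ _ hh.ne'] at h2
    linarith
  have key := real_bound (N := range h T) (E := Real.exp (2 * damping * T)) hh
    (Real.rpow_nonneg hh.le (1 - γ)) hθ ((div_le_iff₀' hh).mpr hR) rfl hN hL (Real.exp_nonneg _)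
    (by positivity) hT0.le (logFactor_range_pow_three_le hγ hγ' hh hT)
  rw [← Real.exp_add, mul_div_cancel₀ _ hh.ne'] at key
  -- The damping contributes `2 * 512`, the absorbed powers of `T` contribute `2`.
  have hexp : 2 * damping * T + 2 * T = 1026 * T := by norm_num [damping]; ring
  rw [hexp] at key
  refine (H.phaseMeasure_le (by linarith) k).trans (le_trans (le_of_eq ?_)
    (ENNReal.ofReal_le_ofReal key))
  have hNr : (range h T : ℝ≥0∞) = ENNReal.ofReal (range h T) := by simp
  have hn : ∀ n : ℕ, [n.AtLeastTwo] → (OfNat.ofNat n : ℝ≥0∞) = ENNReal.ofReal (OfNat.ofNat n) :=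
    fun n _ => by simp
  unfold laterSum
  have hA2 : areaFactor h R T = 256 * h ^ 2 * R * Real.exp (2 * damping * T) := rfl
  rw [← hA2, hn 18, hn 2, hNr]
  have p1 : 0 ≤ areaFactor h R T * (16 * (R / h)) * (8 * logFactor (range h T)) := by positivity
  have p2 : 0 ≤ 5120 * (R / h) * range h T * logFactor (range h T) +
    32 * logFactor (range h T) ^ 3 := by positivity
  have p3 : 0 ≤ areaFactor h R T * (16 * h) := by positivity
  have p4 : 0 ≤ (range h T : ℝ) * (5120 * (R / h) * range h T +
    32 * logFactor (range h T) ^ 3) := by positivity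
  have p5 : 0 ≤ 8 * logFactor (range h T) := by positivity
  have p6 : 0 ≤ areaFactor h R T * (16 * h) ^ 2 := by positivity
  have p7 : 0 ≤ (range h T : ℝ) := by positivity
  have p8 := Real.pi_pos.le
  generalize areaFactor h R T * (16 * (R / h)) * (8 * logFactor (range h T)) = a1 at *
  generalize 5120 * (R / h) * range h T * logFactor (range h T) +
    32 * logFactor (range h T) ^ 3 = a2 at *
  generalize areaFactor h R T * (16 * h) = a3 at *
  generalize (range h T : ℝ) * (5120 * (R / h) * range h T +
    32 * logFactor (range h T) ^ 3) = a4 at *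
  generalize 8 * logFactor (range h T) = a5 at *
  generalize areaFactor h R T * (16 * h) ^ 2 = a6 at *
  generalize (range h T : ℝ) = n at *
  simp only [← ENNReal.ofReal_mul, p2, p4, p5, p7, Nat.ofNat_nonneg, mul_nonneg]
  rw [← ENNReal.ofReal_add (by positivity) (by positivity), ← ENNReal.ofReal_mul (by positivity),
    ← ENNReal.ofReal_add (by positivity) (by positivity)]
  congr 1
  ring

end IsPerturbedLattice

/-! ### Cells, scales and the bound in a cell -/

theorem volume_squareCell {h : ℝ} (hh : 0 < h) (k : Site) :
    volume (squareCell h k) = ENNReal.ofReal (h ^ 2) := by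
  have e : squareCell h k = (MeasurableEquiv.toLp 2 (Fin 2 → ℝ)).symm ⁻¹' (Set.univ.pi fun i =>
      Set.Ico (h * ((k i : ℝ) - 1 / 2)) (h * ((k i : ℝ) + 1 / 2))) := by
    ext x
    simp [squareCell]
  have hm := (EuclideanSpace.volume_preserving_symm_measurableEquiv_toLp (Fin 2))
  rw [e, hm.measure_preimage (MeasurableSet.univ_pi fun _ => measurableSet_Ico).nullMeasurableSet,
    volume_pi_pi]
  simp only [Real.volume_Ico, Fin.prod_univ_two]
  rw [← ENNReal.ofReal_mul (by nlinarith)]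
  congr 1
  ring

theorem phaseMeasure_squareCell {h : ℝ} (hh : 0 < h) (k : Site) :
    phaseMeasure (squareCell h k ×ˢ Set.univ) = ENNReal.ofReal (2 * Real.pi * h ^ 2) := by
  rw [phaseMeasure, Measure.prod_prod, volume_squareCell hh, velocityMeasure_univ,
    ← ENNReal.ofReal_mul (by positivity), mul_comm]

/-- A scale below which the obstacle ranges are much smaller than the lattice cells. -/
noncomputable def smallScale (ν : ℝ) : ℝ := (1 / 200) ^ (1 / (1 - ν))

theorem smallScale_pos (ν : ℝ) : 0 < smallScale ν := Real.rpow_pos_of_pos (by norm_num) _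

theorem le_one_of_lt_smallScale {ν ε : ℝ} (hν' : ν < 1) (hε' : ε < smallScale ν) : ε ≤ 1 :=
  hε'.le.trans (Real.rpow_le_one (by norm_num) (by norm_num)
    (one_div_nonneg.mpr (by linarith)))

theorem rpow_le_of_lt_smallScale {ν ε : ℝ} (hν' : ν < 1) (hε : 0 < ε) (hε' : ε < smallScale ν) :
    ε ^ (1 - ν) ≤ 1 / 200 := by
  have h1 : 0 < 1 - ν := by linarith
  refine (Real.rpow_le_rpow hε.le hε'.le h1.le).trans ?_
  rw [smallScale, ← Real.rpow_mul (by norm_num), one_div_mul_cancel h1.ne', Real.rpow_one]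

section Scales

variable {ν ε : ℝ} (hν : 1 / 2 < ν) (hν' : ν < 1) (hε : 0 < ε) (hε' : ε < smallScale ν)
include hν hν' hε hε'

theorem sqrt_le_rpow : √ε ≤ ε ^ (1 - ν) := by
  rw [Real.sqrt_eq_rpow]
  exact Real.rpow_le_rpow_of_exponent_ge hε (le_one_of_lt_smallScale hν' hε') (by linarith)

/-- Since `√ε ≤ ε ^ (1 - ν) ≤ 1 / 200`, the range radius is at most a hundredth of the spacing. -/
theorem isPerturbedLattice_center {ξ : Site → Plane} (hξ : IsConfiguration ξ) :
    IsPerturbedLattice √ε ε (√ε * (ε ^ (1 - ν) + √ε)) (center ν ε ξ) := by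
  have h1 := sqrt_le_rpow hν hν' hε hε'
  have h2 := rpow_le_of_lt_smallScale hν' hε hε'
  have h3 : 0 ≤ √ε := Real.sqrt_nonneg ε
  refine ⟨hε, by nlinarith, fun i => ?_⟩
  have h4 : center ν ε ξ i - √ε • sitePoint i = √ε • ε ^ (1 - ν) • ξ i := by
    rw [center, smul_add, add_sub_cancel_left]
  have h5 : 0 ≤ ε ^ (1 - ν) := h3.trans h1
  rw [h4, norm_smul, norm_smul, Real.norm_of_nonneg h3, Real.norm_of_nonneg h5, mul_add,
    Real.mul_self_sqrt hε.le]
  gcongr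
  exact mul_le_of_le_one_right h5 (hξ i).le

end Scales

theorem loopSet_eq (ν ε : ℝ) (ξ : Site → Plane) (T : ℝ) :
    loopSet ν ε ξ T =
      {z | MakesLoop (center ν ε ξ) √ε ε (√ε * (ε ^ (1 - ν) + √ε)) T z} := rfl

/-- The bound on the fraction of the starting points in a cell which lead to a loop. -/
theorem exists_phaseMeasure_loopSet_le {ν : ℝ} (hν : 1 / 2 < ν) (hν' : ν < 1) :
    ∃ C : ℝ, 0 ≤ C ∧ ∀ ε T : ℝ, 0 < ε → ε < smallScale ν →
      ∀ ξ : Site → Plane, IsConfiguration ξ → ∀ j : Site,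
        phaseMeasure (loopSet ν ε ξ T ∩ cell ε j ×ˢ Set.univ) ≤
          ENNReal.ofReal
              (C * (T * Real.exp (1026 * T) * Real.log (T / √ε) * ε ^ (2 * (1 - ν)))) *
            phaseMeasure (cell ε j ×ˢ Set.univ) := by
  have hγ : 0 < 2 * ν - 1 := by linarith
  have hC : 0 ≤ loopConstant ((39 / (2 * ν - 1)) ^ 3) := by unfold loopConstant; positivity
  refine ⟨13 * loopConstant ((39 / (2 * ν - 1)) ^ 3), by positivity, fun ε T hε hε' ξ hξ j => ?_⟩
  have H := isPerturbedLattice_center hν hν' hε hε' hξ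
  have hh := H.h_pos
  -- For shorter times there are no loops, and the bound holds whatever the value of the logarithm.
  by_cases hT : 3 / 2 * √ε ≤ T
  swap
  · have he : loopSet ν ε ξ T = ∅ := by
      rw [loopSet_eq]
      exact Set.eq_empty_of_forall_notMem fun z hz => hT (H.exists_loop_of_makesLoop hz).1
    simp [he]
  have hsq : √ε ^ 2 = ε := Real.sq_sqrt hε.le
  have hδ : √ε ^ (1 - (2 * ν - 1)) = ε ^ (1 - ν) := by
    rw [Real.sqrt_eq_rpow, ← Real.rpow_mul hε.le]
    congr 1
    ring
  have hδ2 : ε ^ (2 * (1 - ν)) = (ε ^ (1 - ν)) ^ 2 := by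
    rw [← Real.rpow_natCast, ← Real.rpow_mul hε.le]
    congr 1
    push_cast
    ring
  have h1 := sqrt_le_rpow hν hν' hε hε'
  have H2 : IsPerturbedLattice √ε (√ε ^ 2) (√ε * (ε ^ (1 - ν) + √ε)) (center ν ε ξ) := by
    rwa [hsq]
  have key := H2.phaseMeasure_le_ofReal hγ (by linarith) (by rw [hδ]; gcongr; linarith) hT j
  rw [hsq, hδ] at key
  have hcell : phaseMeasure (cell ε j ×ˢ Set.univ) = ENNReal.ofReal (2 * Real.pi * √ε ^ 2) :=
    phaseMeasure_squareCell hh j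
  rw [hcell, loopSet_eq]
  have hT0 : 0 < T := by linarith
  have hlog : 0 ≤ Real.log (T / √ε) := Real.log_nonneg ((one_le_div hh).mpr (by linarith))
  have hrp : 0 ≤ ε ^ (2 * (1 - ν)) := Real.rpow_nonneg hε.le _
  refine (show phaseMeasure (_ ∩ squareCell √ε j ×ˢ Set.univ) ≤ _ from key).trans ?_
  rw [← ENNReal.ofReal_mul (by positivity), hsq, ← hδ2]
  apply ENNReal.ofReal_le_ofReal
  have hL := logFactor_range_le hh hT
  have hπ : 1 ≤ 2 * Real.pi := by linarith [Real.pi_gt_three]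
  calc _ ≤ loopConstant ((39 / (2 * ν - 1)) ^ 3) * (T * Real.exp (1026 * T) *
        (13 * Real.log (T / √ε)) * ε ^ (2 * (1 - ν))) * (2 * Real.pi * ε) := by
        gcongr
        exact le_mul_of_one_le_left hε.le hπ
    _ = _ := by ring

theorem tendsto_loopFraction {ν : ℝ} (hν' : ν < 1) (C : ℝ) {T : ℝ} (hT : 0 < T) :
    Tendsto (fun ε : ℝ => ENNReal.ofReal
      (C * (T * Real.exp (1026 * T) * Real.log (T / √ε) * ε ^ (2 * (1 - ν))))) (𝓝[>] 0) (𝓝 0) := by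
  have hr : 0 < 2 * (1 - ν) := by linarith
  have h1 : Tendsto (fun ε : ℝ => ε ^ (2 * (1 - ν))) (𝓝[>] 0) (𝓝 0) := by
    have := (Real.continuousAt_rpow_const 0 (2 * (1 - ν)) (Or.inr hr.le)).tendsto
    rw [Real.zero_rpow hr.ne'] at this
    exact this.mono_left nhdsWithin_le_nhds
  have h2 := tendsto_log_mul_rpow_nhdsGT_zero hr
  have h3 : Tendsto (fun ε : ℝ => C * T * Real.exp (1026 * T) * (Real.log T * ε ^ (2 * (1 - ν)) -
      1 / 2 * (Real.log ε * ε ^ (2 * (1 - ν))))) (𝓝[>] 0) (𝓝 0) := by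
    have := ((h1.const_mul (Real.log T)).sub (h2.const_mul (1 / 2))).const_mul
      (C * T * Real.exp (1026 * T))
    simpa only [mul_zero, sub_zero] using this
  have h4 := (ENNReal.continuous_ofReal.tendsto 0).comp h3
  rw [ENNReal.ofReal_zero] at h4
  refine h4.congr' ?_
  filter_upwards [self_mem_nhdsWithin] with ε hε
  have hε : 0 < ε := hε
  simp only [Function.comp]
  rw [Real.log_div hT.ne' (Real.sqrt_pos.mpr hε).ne', Real.log_sqrt hε.le]
  congr 1
  ring

/-! ### From cells to densities on phase space -/

theorem mem_squareCell_iff {h : ℝ} (hh : 0 < h) (k : Site) (x : Plane) :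
    x ∈ squareCell h k ↔ ∀ i, ⌊x i / h + 1 / 2⌋ = k i := by
  refine forall_congr' fun i => ?_
  rw [Int.floor_eq_iff, Set.mem_Ico, ← le_div_iff₀' hh, ← div_lt_iff₀' hh]
  constructor <;> rintro ⟨h1, h2⟩ <;> constructor <;> linarith

/-- A bound on the fraction of a set in every cell gives a bound in a ball. -/
theorem phaseMeasure_inter_ball_le {h M : ℝ} (hh : 0 < h) (hh1 : h ≤ 1) (A : Set Phase) (q : ℝ≥0∞)
    (hA : ∀ k, phaseMeasure (A ∩ squareCell h k ×ˢ Set.univ) ≤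
      q * phaseMeasure (squareCell h k ×ˢ Set.univ)) :
    phaseMeasure (A ∩ Metric.closedBall 0 M ×ˢ Set.univ) ≤
      q * phaseMeasure (Metric.closedBall 0 (M + 2) ×ˢ Set.univ) := by
  -- Two points of a cell are at most `2 * h ≤ 2` apart, so every cell that meets the ball of radius
  -- `M` belongs to `I`.
  let I : Set Site := {k | squareCell h k ⊆ Metric.closedBall 0 (M + 2)}
  have hsub : A ∩ Metric.closedBall 0 M ×ˢ Set.univ ⊆
      ⋃ k : I, A ∩ squareCell h k ×ˢ (Set.univ : Set Velocity) := by
    rintro z ⟨hz, hzM, -⟩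
    have hzM : ‖z.1‖ ≤ M := by simpa using hzM
    have hk : z.1 ∈ squareCell h fun i => ⌊z.1 i / h + 1 / 2⌋ :=
      (mem_squareCell_iff hh _ _).mpr fun _ => rfl
    refine Set.mem_iUnion.mpr ⟨⟨_, fun y hy => ?_⟩, hz, hk, trivial⟩
    have := norm_sub_le_of_mem_squareCell hh hy hk
    rw [mem_closedBall_zero_iff]
    linarith [norm_le_norm_add_norm_sub' y z.1]
  calc _ ≤ ∑' k : I, phaseMeasure (A ∩ squareCell h k ×ˢ Set.univ) :=
        (measure_mono hsub).trans (measure_iUnion_le _)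
    _ ≤ ∑' k : I, q * phaseMeasure (squareCell h k ×ˢ Set.univ) :=
        ENNReal.tsum_le_tsum fun k => hA k
    _ = q * phaseMeasure (⋃ k : I, squareCell h k ×ˢ Set.univ) := by
        rw [ENNReal.tsum_mul_left, measure_iUnion]
        · intro k l hkl
          refine Set.disjoint_left.mpr fun z hz hz' => hkl (Subtype.ext (funext fun i => ?_))
          rw [← (mem_squareCell_iff hh _ _).mp hz.1 i, (mem_squareCell_iff hh _ _).mp hz'.1 i]
        · exact fun k => (measurableSet_squareCell h k).prod MeasurableSet.univ
    _ ≤ _ := by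
        gcongr
        exact Set.iUnion_subset fun k => Set.prod_mono k.2 subset_rfl

theorem sFinite_phaseMeasure : SFinite phaseMeasure :=
  Measure.prod.instSFinite

theorem phaseMeasure_closedBall_ne_top (M : ℝ) :
    phaseMeasure (Metric.closedBall 0 M ×ˢ Set.univ) ≠ ⊤ := by
  rw [phaseMeasure, Measure.prod_prod]
  exact ENNReal.mul_ne_top measure_closedBall_lt_top.ne (measure_ne_top _ _)

theorem exists_setLIntegral_compl_ball_le {f : Phase → ℝ≥0∞}
    (hf : ∫⁻ z, f z ∂phaseMeasure ≠ ⊤) {η : ℝ≥0∞} (hη : 0 < η) :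
    ∃ M : ℝ, ∫⁻ z in (Metric.closedBall 0 M ×ˢ Set.univ)ᶜ, f z ∂phaseMeasure ≤ η := by
  have hm : ∀ n : ℕ, MeasurableSet (Metric.closedBall (0 : Plane) n ×ˢ (Set.univ : Set Velocity)) :=
    fun n => Metric.isClosed_closedBall.measurableSet.prod MeasurableSet.univ
  have h := tendsto_measure_iInter_atTop (μ := phaseMeasure.withDensity f)
    (s := fun n : ℕ => (Metric.closedBall (0 : Plane) n ×ˢ (Set.univ : Set Velocity))ᶜ)
    (fun n => (hm n).compl.nullMeasurableSet)
    (fun m n hmn => Set.compl_subset_compl.mpr (Set.prod_mono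
      (Metric.closedBall_subset_closedBall (by exact_mod_cast hmn)) subset_rfl))
    ⟨0, ne_top_of_le_ne_top hf
      ((withDensity_apply _ (hm 0).compl).trans_le (setLIntegral_le_lintegral _ _))⟩
  have he : ⋂ n : ℕ, (Metric.closedBall (0 : Plane) n ×ˢ (Set.univ : Set Velocity))ᶜ = ∅ := by
    refine Set.eq_empty_of_forall_notMem fun z hz => ?_
    obtain ⟨n, hn⟩ := exists_nat_ge ‖z.1‖
    exact Set.mem_iInter.mp hz n ⟨by simpa using hn, trivial⟩
  rw [he, measure_empty] at h
  obtain ⟨n, hn⟩ := (h.eventually (gt_mem_nhds hη)).exists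
  refine ⟨n, ?_⟩
  rw [← withDensity_apply _ (hm n).compl]
  exact hn.le

/-- The mass of the starting points which lead to a loop is small, uniformly in the
configuration. -/
theorem exists_setLIntegral_loopSet_le {ν : ℝ} (hν : 1 / 2 < ν) (hν' : ν < 1)
    {f : Phase → ℝ≥0∞} (hf : ∫⁻ z, f z ∂phaseMeasure ≠ ⊤) {T : ℝ} (hT : 0 < T) {η : ℝ≥0∞}
    (hη : 0 < η) :
    ∃ ε₁ : ℝ, 0 < ε₁ ∧ ε₁ ≤ smallScale ν ∧ ∀ ε : ℝ, 0 < ε → ε < ε₁ →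
      ∀ ξ : Site → Plane, IsConfiguration ξ →
        ∫⁻ z in loopSet ν ε ξ T, f z ∂phaseMeasure ≤ η := by
  -- Half of `η` is spent on the tail outside a ball, half on the loops inside it, by absolute
  -- continuity of the integral.
  obtain ⟨M, hM⟩ := exists_setLIntegral_compl_ball_le hf (ENNReal.half_pos hη.ne')
  obtain ⟨δ, hδ, hδ'⟩ := exists_pos_setLIntegral_lt_of_measure_lt hf (ENNReal.half_pos hη.ne').ne'
  obtain ⟨C, -, hC⟩ := exists_phaseMeasure_loopSet_le hν hν'
  have h1 := ENNReal.Tendsto.mul_const (tendsto_loopFraction hν' C hT)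
    (Or.inr (phaseMeasure_closedBall_ne_top (M + 2)))
  rw [zero_mul] at h1
  obtain ⟨ε₂, hε₂, h2⟩ := mem_nhdsGT_iff_exists_Ioo_subset.mp (h1.eventually (gt_mem_nhds hδ))
  refine ⟨min ε₂ (smallScale ν), lt_min hε₂ (smallScale_pos ν), min_le_right _ _,
    fun ε hε hε' ξ hξ => ?_⟩
  have hεs := hε'.trans_le (min_le_right _ _)
  have h3 := phaseMeasure_inter_ball_le (M := M) (Real.sqrt_pos.mpr hε)
    (Real.sqrt_le_one.mpr (le_one_of_lt_smallScale hν' hεs)) (loopSet ν ε ξ T) _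
    (hC ε T hε hεs ξ hξ)
  have h4 := hδ' _ (h3.trans_lt (h2 ⟨hε, hε'.trans_le (min_le_left _ _)⟩))
  calc _ ≤ ∫⁻ z in (loopSet ν ε ξ T ∩ Metric.closedBall 0 M ×ˢ Set.univ) ∪
          (Metric.closedBall 0 M ×ˢ Set.univ)ᶜ, f z ∂phaseMeasure := by
        apply lintegral_mono_set
        intro z hz
        by_cases hzM : z ∈ Metric.closedBall (0 : Plane) M ×ˢ (Set.univ : Set Velocity)
        exacts [Or.inl ⟨hz, hzM⟩, Or.inr hzM]
    _ ≤ η / 2 + η / 2 := (lintegral_union_le _ _ _).trans (add_le_add h4.le hM)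
    _ = η := ENNReal.add_halves η

/-! ### The observable on the set of loops -/

section Observable

variable {ν ε : ℝ} (hν : 1 / 2 < ν) (hν' : ν < 1) (hε : 0 < ε) (hε' : ε < smallScale ν)
  {α : Type*} [MeasurableSpace α] {ξ : α → Site → Plane} {z : α → Phase}
include hν hν' hε hε'

/-- Starting point and configuration depend on a common parameter, so that one statement covers a
fixed configuration and the product space of the random case. -/
theorem measurable_loopObservable (hξ : ∀ a, IsConfiguration (ξ a))
    (hξm : ∀ i, Measurable fun a => ξ a i) (hz : Measurable z) (T t : ℝ) (g : Phase →ᵇ ℝ) :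
    Measurable fun a => loopObservable ν ε (ξ a) T t g (z a) := by
  have H := fun a => isPerturbedLattice_center hν hν' hε hε' (hξ a)
  have hc : ∀ i, Measurable fun a => center ν ε (ξ a) i := fun i => by
    unfold center
    exact (((hξm i).fun_const_smul _).const_add _).fun_const_smul _
  exact (g.continuous.measurable.comp (measurable_flow H hε hc hz t)).indicator
    (measurableSet_makesLoop H hε hc hz T)

theorem measurableSet_loopSet {ξ : Site → Plane} (hξ : IsConfiguration ξ) (T : ℝ) :
    MeasurableSet (loopSet ν ε ξ T) :=
  measurableSet_makesLoop (c := fun _ : Phase => center ν ε ξ) (z := id)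
    (fun _ => isPerturbedLattice_center hν hν' hε hε' hξ) hε (fun _ => measurable_const)
    measurable_id T

theorem lintegral_loopObservable_le {ξ : Site → Plane} (hξ : IsConfiguration ξ) (f₀ : Phase → ℝ)
    (T t : ℝ) (g : Phase →ᵇ ℝ) :
    ∫⁻ z, ‖f₀ z * loopObservable ν ε ξ T t g z‖ₑ ∂phaseMeasure ≤
      ENNReal.ofReal ‖g‖ * ∫⁻ z in loopSet ν ε ξ T, ‖f₀ z‖ₑ ∂phaseMeasure := by
  rw [← lintegral_indicator (measurableSet_loopSet hν hν' hε hε' hξ T),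
    ← lintegral_const_mul' _ _ ENNReal.ofReal_ne_top]
  refine lintegral_mono fun z => ?_
  by_cases hz : z ∈ loopSet ν ε ξ T
  · rw [loopObservable, Set.indicator_of_mem hz, Set.indicator_of_mem hz, enorm_mul, mul_comm]
    gcongr
    rw [← ofReal_norm]
    exact ENNReal.ofReal_le_ofReal (g.norm_coe_le_norm _)
  · simp [loopObservable, hz]

end Observable

/-- The convergence to zero, uniformly in the configuration, in terms of the extended norm. -/
theorem exists_lintegral_loopObservable_le {ν : ℝ} (hν : 1 / 2 < ν) (hν' : ν < 1) {f₀ : Phase → ℝ}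
    (hf : Integrable f₀ phaseMeasure) (g : Phase →ᵇ ℝ) {T : ℝ} (hT : 0 < T) {η : ℝ} (hη : 0 < η) :
    ∃ ε₁ : ℝ, 0 < ε₁ ∧ ε₁ ≤ smallScale ν ∧ ∀ ε : ℝ, 0 < ε → ε < ε₁ →
      ∀ ξ : Site → Plane, IsConfiguration ξ → ∀ t,
        ∫⁻ z, ‖f₀ z * loopObservable ν ε ξ T t g z‖ₑ ∂phaseMeasure ≤ ENNReal.ofReal η := by
  have hg : 0 < ‖g‖ + 1 := by positivity
  obtain ⟨ε₁, h1, h2, h3⟩ := exists_setLIntegral_loopSet_le hν hν'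
    (f := fun z => ‖f₀ z‖ₑ) hf.hasFiniteIntegral.ne hT
    (ENNReal.ofReal_pos.mpr (div_pos hη hg))
  refine ⟨ε₁, h1, h2, fun ε hε hε' ξ hξ t =>
    (lintegral_loopObservable_le hν hν' hε (hε'.trans_le h2) hξ f₀ T t g).trans ?_⟩
  calc _ ≤ ENNReal.ofReal (‖g‖ + 1) * ENNReal.ofReal (η / (‖g‖ + 1)) := by
        gcongr
        · linarith
        · exact h3 ε hε hε' ξ hξ
    _ = ENNReal.ofReal η := by
        rw [← ENNReal.ofReal_mul hg.le, mul_div_cancel₀ _ hg.ne']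

theorem integral_abs_le_of_lintegral_enorm_le {α : Type*} [MeasurableSpace α] {μ : Measure α}
    {f : α → ℝ} (hf : AEStronglyMeasurable f μ) {η : ℝ} (hη : 0 ≤ η)
    (h : ∫⁻ a, ‖f a‖ₑ ∂μ ≤ ENNReal.ofReal η) :
    Integrable f μ ∧ ∫ a, |f a| ∂μ ≤ η := by
  refine ⟨⟨hf, h.trans_lt ENNReal.ofReal_lt_top⟩, ?_⟩
  simp only [← Real.norm_eq_abs]
  rw [integral_norm_eq_lintegral_enorm hf]
  exact ENNReal.toReal_le_of_le_ofReal hη h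

theorem exists_integral_loopObservable_le {ν : ℝ} (hν : 1 / 2 < ν) (hν' : ν < 1) {f₀ : Phase → ℝ}
    (hf : Integrable f₀ phaseMeasure) (g : Phase →ᵇ ℝ) {T : ℝ} (hT : 0 < T) {η : ℝ} (hη : 0 < η) :
    ∃ ε₁ : ℝ, 0 < ε₁ ∧ ∀ ε : ℝ, 0 < ε → ε < ε₁ → ∀ ξ : Site → Plane, IsConfiguration ξ → ∀ t,
      Integrable (fun z => f₀ z * loopObservable ν ε ξ T t g z) phaseMeasure ∧
      ∫ z, |f₀ z * loopObservable ν ε ξ T t g z| ∂phaseMeasure ≤ η := by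
  obtain ⟨ε₁, h1, h2, h3⟩ := exists_lintegral_loopObservable_le hν hν' hf g hT hη
  refine ⟨ε₁, h1, fun ε hε hε' ξ hξ t =>
    integral_abs_le_of_lintegral_enorm_le ?_ hη.le (h3 ε hε hε' ξ hξ t)⟩
  exact hf.aestronglyMeasurable.mul (measurable_loopObservable (ξ := fun _ => ξ) hν hν' hε
    (hε'.trans_le h2) (fun _ => hξ) (fun _ => measurable_const) measurable_id T t
    g).aestronglyMeasurable

/-! ### Random configurations -/

section Random

variable {Ω : Type*} [MeasurableSpace Ω] {P : Measure Ω} {φ : Plane → ℝ} {ξ : Site → Ω → Plane}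

theorem IsDisplacementField.ae_isConfiguration (hξ : IsDisplacementField P φ ξ)
    (hφ : IsDisplacementDensity φ) : ∀ᵐ ω ∂P, IsConfiguration fun i => ξ i ω := by
  refine ae_all_iff.mpr fun i => ?_
  have hs : MeasurableSet {x : Plane | 1 ≤ ‖x‖} := measurableSet_le measurable_const measurable_norm
  have h : P.map (ξ i) {x | 1 ≤ ‖x‖} = 0 := by
    rw [hξ.law i, withDensity_apply _ hs]
    refine (setLIntegral_congr_fun hs fun x hx => ?_).trans lintegral_zero
    simp [hφ.eq_zero_of_one_le_norm x hx]
  rw [Measure.map_apply (hξ.measurable i) hs] at h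
  rw [ae_iff]
  simpa using h

theorem IsDisplacementField.exists_integral_loopObservable_le [IsProbabilityMeasure P]
    (hξ : IsDisplacementField P φ ξ) (hφ : IsDisplacementDensity φ) {ν : ℝ} (hν : 1 / 2 < ν)
    (hν' : ν < 1) {f₀ : Phase → ℝ} (hf : Integrable f₀ phaseMeasure) (g : Phase →ᵇ ℝ) {T : ℝ}
    (hT : 0 < T) (t : ℝ) {η : ℝ} (hη : 0 < η) :
    ∃ ε₁ : ℝ, 0 < ε₁ ∧ ∀ ε : ℝ, 0 < ε → ε < ε₁ →
      Integrable (fun p : Phase × Ω => f₀ p.1 * loopObservable ν ε (fun i => ξ i p.2) T t g p.1)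
        (phaseMeasure.prod P) ∧
      ∫ p : Phase × Ω, |f₀ p.1 * loopObservable ν ε (fun i => ξ i p.2) T t g p.1|
        ∂(phaseMeasure.prod P) ≤ η := by
  obtain ⟨ε₁, h1, h2, h3⟩ := exists_lintegral_loopObservable_le hν hν' hf g hT hη
  refine ⟨ε₁, h1, fun ε hε hε' => ?_⟩
  classical
  have : SFinite phaseMeasure := sFinite_phaseMeasure
  -- The displacements lie in the open disc only almost surely. The modification on a null set makes
  -- every sample a configuration, as the measurability of the flow and the uniform bound require.
  let ζ : Ω → Site → Plane := fun ω i => if ‖ξ i ω‖ < 1 then ξ i ω else 0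
  have hζ : ∀ ω, IsConfiguration (ζ ω) := fun ω i => by
    by_cases h : ‖ξ i ω‖ < 1 <;> simp [ζ, h]
  have hζm : ∀ i, Measurable fun ω => ζ ω i := fun i =>
    Measurable.ite (measurableSet_lt (hξ.measurable i).norm measurable_const) (hξ.measurable i)
      measurable_const
  have hae : (fun p : Phase × Ω => f₀ p.1 * loopObservable ν ε (ζ p.2) T t g p.1)
      =ᵐ[phaseMeasure.prod P]
      fun p => f₀ p.1 * loopObservable ν ε (fun i => ξ i p.2) T t g p.1 := by
    filter_upwards [Measure.quasiMeasurePreserving_snd.ae (hξ.ae_isConfiguration hφ)] with p hp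
    have e : ζ p.2 = fun i => ξ i p.2 := funext fun i => if_pos (hp i)
    rw [e]
  have hm : AEStronglyMeasurable
      (fun p : Phase × Ω => f₀ p.1 * loopObservable ν ε (ζ p.2) T t g p.1)
      (phaseMeasure.prod P) :=
    hf.aestronglyMeasurable.comp_fst.mul (measurable_loopObservable hν hν' hε
      (hε'.trans_le h2) (fun p : Phase × Ω => hζ p.2) (fun i => (hζm i).comp measurable_snd)
      measurable_fst T t g).aestronglyMeasurable
  have hle : ∫⁻ p : Phase × Ω, ‖f₀ p.1 * loopObservable ν ε (ζ p.2) T t g p.1‖ₑ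
      ∂(phaseMeasure.prod P) ≤ ENNReal.ofReal η := by
    rw [lintegral_prod_symm _ hm.enorm]
    calc _ ≤ ∫⁻ _, ENNReal.ofReal η ∂P := lintegral_mono fun ω => h3 ε hε hε' _ (hζ ω) t
      _ = _ := by simp
  obtain ⟨h4, h5⟩ := integral_abs_le_of_lintegral_enorm_le hm hη.le hle
  exact ⟨h4.congr hae, (integral_congr_ae (hae.fun_comp abs)).symm.trans_le h5⟩

end Random

end LorentzGas


theorem proposition4 (ν : ℝ) (hν : 1 / 2 < ν) (hν' : ν < 1) :
    -- The fraction of phase space, in any lattice cell, that leads to a loop.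
    (∃ C a ε₀ : ℝ, 0 < ε₀ ∧
      ∀ ε T : ℝ, 0 < ε → ε < ε₀ → √ε ≤ T →
        ∀ ξ : Site → Plane, IsConfiguration ξ → ∀ j : Site,
          phaseMeasure (loopSet ν ε ξ T ∩ cell ε j ×ˢ Set.univ) ≤
            ENNReal.ofReal
                (C * (T * Real.exp (a * T) * Real.log (T / √ε) * ε ^ (2 * (1 - ν)))) *
              phaseMeasure (cell ε j ×ˢ Set.univ)) ∧
    ∀ (f₀ : Phase → ℝ), IsPhaseDensity f₀ → ∀ (g : Phase →ᵇ ℝ) (T : ℝ), 0 < T →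
      -- Convergence to zero, uniformly in the obstacle configuration.
      (∀ η : ℝ, 0 < η → ∃ ε₁ : ℝ, 0 < ε₁ ∧ ∀ ε : ℝ, 0 < ε → ε < ε₁ →
        ∀ ξ : Site → Plane, IsConfiguration ξ → ∀ t ∈ Set.Icc 0 T,
          Integrable (fun z => f₀ z * loopObservable ν ε ξ T t g z) phaseMeasure ∧
          ∫ z, |f₀ z * loopObservable ν ε ξ T t g z| ∂phaseMeasure ≤ η) ∧
      -- Convergence to zero of the expectation over the random configuration.
      (∀ (Ω : Type*) [MeasurableSpace Ω] (P : Measure Ω) [IsProbabilityMeasure P]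
        (φ : Plane → ℝ) (ξ : Site → Ω → Plane),
        IsDisplacementDensity φ → IsDisplacementField P φ ξ → ∀ t ∈ Set.Icc 0 T,
          (∀ᶠ ε in 𝓝[>] (0 : ℝ),
            Integrable
              (fun p : Phase × Ω => f₀ p.1 * loopObservable ν ε (fun i => ξ i p.2) T t g p.1)
              (phaseMeasure.prod P)) ∧
          Tendsto
            (fun ε : ℝ => ∫ z, f₀ z *
              (∫ ω, loopObservable ν ε (fun i => ξ i ω) T t g z ∂P) ∂phaseMeasure)
            (𝓝[>] 0) (𝓝 0)) := by
  refine ⟨?_, fun f₀ hf g T hT => ⟨fun η hη => ?_, fun Ω _ P _ φ ξ hφ hξ t _ => ?_⟩⟩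
  · obtain ⟨C, -, hC⟩ := exists_phaseMeasure_loopSet_le hν hν'
    exact ⟨C, 1026, smallScale ν, smallScale_pos ν, fun ε T hε hε' _ => hC ε T hε hε'⟩
  · obtain ⟨ε₁, h1, h2⟩ := exists_integral_loopObservable_le hν hν' hf.integrable g hT hη
    exact ⟨ε₁, h1, fun ε hε hε' ξ hξ t _ => h2 ε hε hε' ξ hξ t⟩
  · have : SFinite phaseMeasure := sFinite_phaseMeasure
    have key := fun {η : ℝ} (hη : 0 < η) =>
      hξ.exists_integral_loopObservable_le hφ hν hν' hf.integrable g hT t hη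
    refine ⟨?_, Metric.tendsto_nhds.mpr fun η hη => ?_⟩
    · obtain ⟨ε₁, h1, h2⟩ := key one_pos
      filter_upwards [Ioo_mem_nhdsGT h1] with ε hε using (h2 ε hε.1 hε.2).1
    · obtain ⟨ε₁, h1, h2⟩ := key (half_pos hη)
      filter_upwards [Ioo_mem_nhdsGT h1] with ε hε
      obtain ⟨h3, h4⟩ := h2 ε hε.1 hε.2
      -- By Fubini the iterated integral is the integral over the product, whose absolute value has
      -- just been bounded.
      have e := integral_prod _ h3
      simp only [integral_const_mul] at e
      rw [← e, dist_zero_right, Real.norm_eq_abs]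
      exact (abs_integral_le_integral_abs.trans h4).trans_lt (half_lt_self hη)
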